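/- **Setting.** Let $\Gamma(1)=\mathrm{PSL}_2(\mathbb Z)$, $S=\pm\begin{pmatrix}0&1\\-1&0\end{pmatrix}$, $T=\pm\begin{pmatrix}1&1\\0&1\end{pmatrix}$, and let $\Gamma\subset\Gamma(1)$ be a torsion-free normal subgroup of finite index. Let $(\eta,V_\eta)$ be a finite-dimensional complex representation of $\Gamma(1)$ such that $\eta$ is trivial on the subgroup $\Gamma_{\rm par}$ of $\Gamma$ generated by the parabolic elements of $\Gamma$, and such that $\eta|_\Gamma$ is unipotent of length $q$, i.e. there is a $\Gamma$-stable filtration $0=V_{-1}\subseteq V_0\subseteq\dots\subseteq V_q=V_\eta$ with $\Gamma$ acting trivially on every $V_k/V_{k-1}$. Let $\nu\in\mathbb C$. All complex powers are principal powers. *Hyperfunctions.* For $\Omega\subseteq\mathbb P_1(\mathbb R)$ open, the $V_\eta$-valued hyperfunctions on $\Omega$ are $\mathcal O(U\smallsetminus\mathbb P_1(\mathbb R))/\mathcal O(U)$, with $U$ running through the open neighbourhoods of $\Omega$ in $\mathbb P_1(\mathbb C)$ ($V_\eta$-valued holomorphic functions). The group $\mathrm{PSL}_2(\mathbb R)$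 acts on the hyperfunctions on $\mathbb P_1(\mathbb R)$ by $$\pi_\nu(g)f(z)=\left(\frac{1+z^2}{(cz-a)^2+(dz-b)^2}\right)^{\nu+\frac12}f\left(\frac{dz-b}{-cz+a}\right),\qquad g=\pm\begin{pmatrix}a&b\\c&d\end{pmatrix}$$ ($z$ near $\mathbb P_1(\mathbb R)$). Let $A^{-\omega}_{\nu,\eta}=(\pi_\nu^{-\omega}\otimes\eta)^{\Gamma(1)}$ be the space of $V_\eta$-valued hyperfunctions $\alpha$ on $\mathbb P_1(\mathbb R)$ with $\eta(\gamma)\pi_\nu(\gamma)\alpha=\alpha$ for all $\gamma\in\Gamma(1)$. *The space $\mathcal F_{\nu,\eta}$* consists of all holomorphic $f:\mathbb C\smallsetminus\mathbb R\to V_\eta$ such that $f(z+1)=\eta(T)f(z)$, $f$ is bounded as $|\mathrm{Im}(z)|\to\infty$, $f(i\infty)+f(-i\infty)=0$ (where $f(\pm i\infty)=\lim_{\mathrm{Im}(z)\to\pm\infty}f(z)$), and $z\mapsto f(z)-z^{-2\nu-1}\eta(S)f(-1/z)$ extends holomorphically to $\mathbb C\smallsetminus(-\infty,0]$. *The space $\Psi_{\nu,\eta}$*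 consists of all holomorphic $\psi:\mathbb C\smallsetminus(-\infty,0]\to V_\eta$ that satisfy the Lewis equation $$\eta(T)\psi(z)=\psi(z+1)+(z+1)^{-2\nu-1}\eta(ST^{-1})\psi\left(\frac z{z+1}\right)$$ and the limit condition $$0=e^{\pi i\nu}\lim_{\mathrm{Im}(z)\to\infty}\Big(\psi(z)+z^{-2\nu-1}\eta(S)\psi\big(\tfrac{-1}z\big)\Big)+e^{-\pi i\nu}\lim_{\mathrm{Im}(z)\to-\infty}\Big(\psi(z)+z^{-2\nu-1}\eta(S)\psi\big(\tfrac{-1}z\big)\Big),$$ where both limits are required to exist. **Proposition (Bruggeman transform).** For every $\alpha\in A^{-\omega}_{\nu,\eta}$ there is a unique $f_\alpha\in\mathcal F_{\nu,\eta}$ such that $z\mapsto(1+z^2)^{\nu+\frac12}f_\alpha(z)$ represents the restriction $\alpha|_{\mathbb R}$. Put $$\psi_\alpha(z)=f_\alpha(z)-z^{-2\nu-1}\eta(S)f_\alpha\left(\frac{-1}z\right),$$ extended holomorphically to $\mathbb C\smallsetminus(-\infty,0]$. Then $\alpha\mapsto\psi_\alpha$ is a linear map $B:A^{-\omega}_{\nu,\eta}\to\Psi_{\nu,\eta}$,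 and $B$ is bijective if $\nu\notin\frac12+\mathbb Z$. -/

import Mathlib

open scoped OnePoint MatrixGroups Topology
open Filter

noncomputable section

namespace LewisTransform

/-! ### The complex projective line and its real locus

The complex projective line is `OnePoint ℂ`, with `[z : 1] = z` and `[1 : 0] = ∞`. -/

/-- The real projective line `ℝ ∪ {∞}` inside the complex projective line `ℂ ∪ {∞}`. -/
def realLine : Set (OnePoint ℂ) :=
  Set.range (OnePoint.map (Complex.ofReal))

/-- The inverse `w ↦ 1 / w` of the affine coordinate at infinity, with `1 / 0 = ∞`. -/
def invChart (w : ℂ) : OnePoint ℂ :=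
  if w = 0 then ∞ else ((w⁻¹ : ℂ) : OnePoint ℂ)

/-- The point `[v.1 : v.2]` of the complex projective line. -/
def homog (v : ℂ × ℂ) : OnePoint ℂ :=
  if v.2 = 0 then ∞ else ((v.1 / v.2 : ℂ) : OnePoint ℂ)

section Holomorphic

variable {V : Type*} [NormedAddCommGroup V] [NormedSpace ℂ V]

/-- Holomorphy on an (open) subset of the complex projective line: holomorphy in the two
standard affine charts `z` and `w = 1 / z`. -/
def HolomorphicOn (f : OnePoint ℂ → V) (U : Set (OnePoint ℂ)) : Prop :=
  DifferentiableOn ℂ (fun z : ℂ => f (z : OnePoint ℂ)) {z : ℂ | (z : OnePoint ℂ) ∈ U} ∧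
  DifferentiableOn ℂ (fun w : ℂ => f (invChart w)) {w : ℂ | invChart w ∈ U}

theorem HolomorphicOn.mono {f : OnePoint ℂ → V} {U U' : Set (OnePoint ℂ)}
    (h : HolomorphicOn f U) (hU : U' ⊆ U) : HolomorphicOn f U' :=
  ⟨h.1.mono fun _ hz => hU hz, h.2.mono fun _ hz => hU hz⟩

theorem HolomorphicOn.congr {f g : OnePoint ℂ → V} {U : Set (OnePoint ℂ)}
    (h : HolomorphicOn f U) (hfg : Set.EqOn g f U) : HolomorphicOn g U :=
  ⟨h.1.congr fun _ hz => hfg hz, h.2.congr fun _ hz => hfg hz⟩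

theorem HolomorphicOn.add {f g : OnePoint ℂ → V} {U : Set (OnePoint ℂ)}
    (hf : HolomorphicOn f U) (hg : HolomorphicOn g U) : HolomorphicOn (f + g) U :=
  ⟨hf.1.add hg.1, hf.2.add hg.2⟩

theorem HolomorphicOn.smul {f : OnePoint ℂ → V} {U : Set (OnePoint ℂ)}
    (hf : HolomorphicOn f U) (c : ℂ) : HolomorphicOn (c • f) U :=
  ⟨hf.1.const_smul c, hf.2.const_smul c⟩

theorem HolomorphicOn.zero (U : Set (OnePoint ℂ)) :
    HolomorphicOn (0 : OnePoint ℂ → V) U :=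
  ⟨differentiableOn_const (0 : V), differentiableOn_const (0 : V)⟩

theorem homog_of_ne {v : ℂ × ℂ} (h : v.2 ≠ 0) : homog v = ((v.1 / v.2 : ℂ) : OnePoint ℂ) := by
  simp [homog, h]

theorem homog_eq_invChart {v : ℂ × ℂ} (h : v.1 ≠ 0) : homog v = invChart (v.2 / v.1) := by
  by_cases h2 : v.2 = 0 <;> simp [homog, invChart, h, h2]

theorem ne_zero_cases {v : ℂ × ℂ} (h : v ≠ 0) : v.2 ≠ 0 ∨ v.1 ≠ 0 := by
  by_contra! hc
  exact h (Prod.ext hc.2 hc.1)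

theorem exists_homog (p : OnePoint ℂ) : ∃ v : ℂ × ℂ, v ≠ 0 ∧ homog v = p := by
  induction p with
  | infty => exact ⟨(1, 0), by simp, by simp [homog]⟩
  | coe z => exact ⟨(z, 1), by simp, by simp [homog]⟩

/-- Holomorphy in homogeneous coordinates. -/
theorem holomorphicOn_iff {f : OnePoint ℂ → V} {U : Set (OnePoint ℂ)} :
    HolomorphicOn f U ↔
      DifferentiableOn ℂ (fun v => f (homog v)) {v | v ≠ 0 ∧ homog v ∈ U} := by
  constructor
  · rintro ⟨h1, h2⟩ v ⟨hv, hvU⟩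
    rcases ne_zero_cases hv with h | h
    · have hev : ∀ᶠ u : ℂ × ℂ in 𝓝[{v | v ≠ 0 ∧ homog v ∈ U}] v, u.2 ≠ 0 :=
        (continuous_snd.continuousAt.eventually_ne h).filter_mono nhdsWithin_le_nhds
      have hd : DifferentiableWithinAt ℂ (fun u : ℂ × ℂ => u.1 / u.2)
          ({v | v ≠ 0 ∧ homog v ∈ U} ∩ {u | u.2 ≠ 0}) v := by
        have h' : DifferentiableAt ℂ (fun u : ℂ × ℂ => u.1 / u.2) v := by fun_prop (disch := exact h)
        exact h'.differentiableWithinAt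
      have := (h1 (v.1 / v.2) (by simpa [homog_of_ne h] using hvU)).comp v hd
        (fun u hu => by simpa [homog_of_ne hu.2] using hu.1.2)
      have this2 : DifferentiableWithinAt ℂ (fun v => f (homog v))
          ({v | v ≠ 0 ∧ homog v ∈ U} ∩ {u | u.2 ≠ 0}) v :=
        this.congr (fun u hu => by simp [homog_of_ne hu.2]) (by simp [homog_of_ne h])
      exact this2.mono_of_mem_nhdsWithin (inter_mem self_mem_nhdsWithin hev)
    · have hev : ∀ᶠ u : ℂ × ℂ in 𝓝[{v | v ≠ 0 ∧ homog v ∈ U}] v, u.1 ≠ 0 :=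
        (continuous_fst.continuousAt.eventually_ne h).filter_mono nhdsWithin_le_nhds
      have hd : DifferentiableWithinAt ℂ (fun u : ℂ × ℂ => u.2 / u.1)
          ({v | v ≠ 0 ∧ homog v ∈ U} ∩ {u | u.1 ≠ 0}) v := by
        have h' : DifferentiableAt ℂ (fun u : ℂ × ℂ => u.2 / u.1) v := by fun_prop (disch := exact h)
        exact h'.differentiableWithinAt
      have := (h2 (v.2 / v.1) (by simpa [homog_eq_invChart h] using hvU)).comp v hd
        (fun u hu => by simpa [homog_eq_invChart hu.2] using hu.1.2)
      have this2 : DifferentiableWithinAt ℂ (fun v => f (homog v))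
          ({v | v ≠ 0 ∧ homog v ∈ U} ∩ {u | u.1 ≠ 0}) v :=
        this.congr (fun u hu => by simp [homog_eq_invChart hu.2]) (by simp [homog_eq_invChart h])
      exact this2.mono_of_mem_nhdsWithin (inter_mem self_mem_nhdsWithin hev)
  · intro h
    have e1 : ∀ z : ℂ, homog (z, 1) = (z : OnePoint ℂ) := fun z => by simp [homog]
    have e2 : ∀ w : ℂ, homog (1, w) = invChart w := fun w => by
      simp [homog_eq_invChart (v := (1, w)) one_ne_zero]
    constructor
    · have := h.comp (f := fun z : ℂ => (z, (1 : ℂ))) (s := {z : ℂ | (z : OnePoint ℂ) ∈ U})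
        (by fun_prop) (fun z hz => ⟨by simp, by simpa [e1] using hz⟩)
      exact this.congr fun z _ => by simp [e1]
    · have := h.comp (f := fun w : ℂ => ((1 : ℂ), w)) (s := {w : ℂ | invChart w ∈ U})
        (by fun_prop) (fun z hz => ⟨by simp, by simpa [e2] using hz⟩)
      exact this.congr fun z _ => by simp [e2]

theorem continuous_invChart : Continuous invChart := by
  rw [continuous_iff_continuousAt]
  intro w
  by_cases hw : w = 0
  · subst hw
    rw [continuousAt_iff_punctured_nhds]
    have h : Tendsto (fun w : ℂ => ((w⁻¹ : ℂ) : OnePoint ℂ)) (𝓝[≠] 0) (𝓝 ∞) := by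
      refine OnePoint.tendsto_coe_infty.comp ?_
      rw [coclosedCompact_eq_cocompact, ← Metric.cobounded_eq_cocompact]
      exact tendsto_inv₀_nhdsNE_zero
    have h0 : invChart 0 = ∞ := by simp [invChart]
    rw [h0]
    refine h.congr' ?_
    filter_upwards [self_mem_nhdsWithin] with w hw
    have hw' : w ≠ 0 := hw
    simp [invChart, hw']
  · have h : ContinuousAt (fun w : ℂ => ((w⁻¹ : ℂ) : OnePoint ℂ)) w :=
      OnePoint.continuous_coe.continuousAt.comp (continuousAt_inv₀ hw)
    refine h.congr ?_
    filter_upwards [continuousAt_id.eventually_ne hw] with u hu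
    have hu' : u ≠ 0 := hu
    simp [invChart, hu']

theorem isOpen_iff_homog {U : Set (OnePoint ℂ)} :
    IsOpen U ↔ IsOpen {v : ℂ × ℂ | v ≠ 0 ∧ homog v ∈ U} := by
  constructor
  · intro hU
    rw [isOpen_iff_mem_nhds]
    rintro v ⟨hv, hvU⟩
    have hv' : ∀ᶠ u in 𝓝 v, u ≠ 0 := continuousAt_id.eventually_ne hv
    have hc : ContinuousAt homog v := by
      rcases ne_zero_cases hv with h | h
      · have : ContinuousAt (fun u : ℂ × ℂ => ((u.1 / u.2 : ℂ) : OnePoint ℂ)) v :=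
          OnePoint.continuous_coe.continuousAt.comp
            (continuousAt_fst.div continuousAt_snd h)
        refine this.congr ?_
        filter_upwards [continuousAt_snd.eventually_ne h] with u hu
        exact (homog_of_ne hu).symm
      · have : ContinuousAt (fun u : ℂ × ℂ => invChart (u.2 / u.1)) v :=
          ContinuousAt.comp (f := fun u : ℂ × ℂ => u.2 / u.1)
            continuous_invChart.continuousAt (continuousAt_snd.div continuousAt_fst h)
        refine this.congr ?_
        filter_upwards [continuousAt_fst.eventually_ne h] with u hu
        exact (homog_eq_invChart hu).symm
    filter_upwards [hv', hc (hU.mem_nhds hvU)] with u h1 h2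
    exact ⟨h1, h2⟩
  · intro hU
    have h1 : IsOpen ((↑) ⁻¹' U : Set ℂ) := by
      have := hU.preimage (f := fun z : ℂ => (z, (1 : ℂ))) (by fun_prop)
      convert this using 1
      ext z
      simp [homog]
    rw [OnePoint.isOpen_def]
    refine ⟨fun hinf => ?_, h1⟩
    have h2 : IsOpen {w : ℂ | invChart w ∈ U} := by
      have := hU.preimage (f := fun w : ℂ => ((1 : ℂ), w)) (by fun_prop)
      convert this using 1
      ext w
      simp [homog_eq_invChart (v := (1, w)) one_ne_zero]
    obtain ⟨ε, hε, hb⟩ := Metric.isOpen_iff.1 h2 0 (by simpa [invChart] using hinf)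
    refine Metric.isCompact_of_isClosed_isBounded h1.isClosed_compl ?_
    refine (Metric.isBounded_closedBall (x := (0 : ℂ)) (r := ε⁻¹)).subset ?_
    intro z hz
    by_contra hlt
    simp only [Metric.mem_closedBall, dist_zero_right, not_le] at hlt
    have hz0 : z ≠ 0 := by
      rintro rfl
      simp only [norm_zero] at hlt
      exact absurd hlt (not_lt.2 (inv_nonneg.2 hε.le))
    refine hz ?_
    have : z⁻¹ ∈ Metric.ball (0 : ℂ) ε := by
      simpa using inv_lt_of_inv_lt₀ hε hlt
    have := hb this
    simpa [invChart, hz0] using this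

/-! ### Hyperfunctions

For an open subset `Ω` of the real projective line, the hyperfunctions on `Ω` are
`𝒪(U ∖ ℙ¹(ℝ)) / 𝒪(U)`, for `U` running through the open neighbourhoods of `Ω` in `ℙ¹(ℂ)`. -/

variable (V) in
/-- Functions that are holomorphic on `U ∖ ℙ¹(ℝ)` for some open neighbourhood `U` of `Ω`. -/
def boundaryGerms (Ω : Set (OnePoint ℂ)) : Submodule ℂ (OnePoint ℂ → V) where
  carrier := {f | ∃ U, IsOpen U ∧ Ω ⊆ U ∧ HolomorphicOn f (U \ realLine)}
  add_mem' := by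
    rintro f g ⟨U, hU, hΩ, hf⟩ ⟨U', hU', hΩ', hg⟩
    exact ⟨U ∩ U', hU.inter hU', Set.subset_inter hΩ hΩ',
      (hf.mono (Set.sdiff_subset_sdiff_left Set.inter_subset_left)).add
        (hg.mono (Set.sdiff_subset_sdiff_left Set.inter_subset_right))⟩
  zero_mem' := ⟨Set.univ, isOpen_univ, Set.subset_univ _, HolomorphicOn.zero _⟩
  smul_mem' := by
    rintro c f ⟨U, hU, hΩ, hf⟩
    exact ⟨U, hU, hΩ, hf.smul c⟩

variable (V) in
/-- Functions whose restriction to `U ∖ ℙ¹(ℝ)`, for some open neighbourhood `U` of `Ω`, extends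
to a holomorphic function on `U`. -/
def nullGerms (Ω : Set (OnePoint ℂ)) : Submodule ℂ (OnePoint ℂ → V) where
  carrier := {f | ∃ U, IsOpen U ∧ Ω ⊆ U ∧
    ∃ h : OnePoint ℂ → V, HolomorphicOn h U ∧ Set.EqOn f h (U \ realLine)}
  add_mem' := by
    rintro f g ⟨U, hU, hΩ, h, hh, hf⟩ ⟨U', hU', hΩ', h', hh', hg⟩
    refine ⟨U ∩ U', hU.inter hU', Set.subset_inter hΩ hΩ', h + h',
      (hh.mono Set.inter_subset_left).add (hh'.mono Set.inter_subset_right), ?_⟩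
    intro p hp
    simp [hf ⟨hp.1.1, hp.2⟩, hg ⟨hp.1.2, hp.2⟩]
  zero_mem' := ⟨Set.univ, isOpen_univ, Set.subset_univ _, 0, HolomorphicOn.zero _,
    fun _ _ => rfl⟩
  smul_mem' := by
    rintro c f ⟨U, hU, hΩ, h, hh, hf⟩
    refine ⟨U, hU, hΩ, c • h, hh.smul c, ?_⟩
    intro p hp
    simp [hf hp]

variable (V) in
/-- The space of `V`-valued hyperfunctions on the open subset `Ω` of the real projective line. -/
abbrev Hyperfunction (Ω : Set (OnePoint ℂ)) : Type _ :=
  boundaryGerms V Ω ⧸ (nullGerms V Ω).submoduleOf (boundaryGerms V Ω)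

/-- `F` is a representative of the hyperfunction `α` on `Ω`. -/
def IsRepresentedBy {Ω : Set (OnePoint ℂ)} (α : Hyperfunction V Ω) (F : OnePoint ℂ → V) : Prop :=
  ∃ h : F ∈ boundaryGerms V Ω, Submodule.Quotient.mk ⟨F, h⟩ = α

/-- The linear map between spaces of hyperfunctions induced by a linear map on representatives. -/
def Hyperfunction.lift {Ω Ω' : Set (OnePoint ℂ)} (L : (OnePoint ℂ → V) →ₗ[ℂ] (OnePoint ℂ → V))
    (h1 : ∀ f ∈ boundaryGerms V Ω, L f ∈ boundaryGerms V Ω')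
    (h2 : ∀ f ∈ nullGerms V Ω, L f ∈ nullGerms V Ω') :
    Hyperfunction V Ω →ₗ[ℂ] Hyperfunction V Ω' :=
  Submodule.mapQ _ _ (L.restrict h1) fun f hf => h2 f.1 hf

/-- Restriction of hyperfunctions to a smaller open subset of the real projective line. -/
def Hyperfunction.restrict {Ω Ω' : Set (OnePoint ℂ)} (hΩ : Ω' ⊆ Ω) :
    Hyperfunction V Ω →ₗ[ℂ] Hyperfunction V Ω' :=
  Hyperfunction.lift LinearMap.id
    (fun _ ⟨U, hU, hΩU, hf⟩ => ⟨U, hU, hΩ.trans hΩU, hf⟩)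
    (fun _ ⟨U, hU, hΩU, hf⟩ => ⟨U, hU, hΩ.trans hΩU, hf⟩)

/-- The affine real line `ℝ = ℙ¹(ℝ) ∖ {∞}`. -/
def affineLine : Set (OnePoint ℂ) := realLine \ {∞}

/-- The restriction to `ℝ` of a hyperfunction on the real projective line. -/
def Hyperfunction.toAffine : Hyperfunction V realLine →ₗ[ℂ] Hyperfunction V affineLine :=
  Hyperfunction.restrict Set.sdiff_subset

theorem HolomorphicOn.postcomp [FiniteDimensional ℂ V] {f : OnePoint ℂ → V}
    {U : Set (OnePoint ℂ)} (hf : HolomorphicOn f U) (L : V →ₗ[ℂ] V) :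
    HolomorphicOn (fun p => L (f p)) U :=
  ⟨(LinearMap.toContinuousLinearMap L).differentiable.comp_differentiableOn hf.1,
    (LinearMap.toContinuousLinearMap L).differentiable.comp_differentiableOn hf.2⟩

/-- The action `id ⊗ L` of an endomorphism `L` of `V` on `V`-valued hyperfunctions. -/
def Hyperfunction.mapValues [FiniteDimensional ℂ V] {Ω : Set (OnePoint ℂ)} (L : V →ₗ[ℂ] V) :
    Hyperfunction V Ω →ₗ[ℂ] Hyperfunction V Ω :=
  Hyperfunction.lift (L.compLeft (OnePoint ℂ))
    (fun _ ⟨U, hU, hΩ, hf⟩ => ⟨U, hU, hΩ, hf.postcomp L⟩)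
    (fun _ ⟨U, hU, hΩ, h, hh, hf⟩ => ⟨U, hU, hΩ, fun p => L (h p), hh.postcomp L,
      fun _ hp => congrArg L (hf hp)⟩)

/-! ### The principal series -/

/-- The factor `(1 + z²) / ((c z - a)² + (d z - b)²)` of `g = (a b; c d)` at the point `z` of the
complex projective line; its value at `∞` is `1 / (c² + d²)`. -/
def factor (g : SL(2, ℝ)) (p : OnePoint ℂ) : ℂ :=
  p.elim (1 / ((g 1 0 : ℂ) ^ 2 + (g 1 1 : ℂ) ^ 2))
    (fun z => (1 + z ^ 2) / (((g 1 0 : ℂ) * z - g 0 0) ^ 2 + ((g 1 1 : ℂ) * z - g 0 1) ^ 2))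

/-- The action of `SL₂(ℝ)` on the complex projective line by linear fractional transformations. -/
def moebius (g : SL(2, ℝ)) (p : OnePoint ℂ) : OnePoint ℂ :=
  Matrix.SpecialLinearGroup.mapGL ℂ g • p

/-- The action on functions underlying the principal series:
`f ↦ ((1 + z²) / ((c z - a)² + (d z - b)²)) ^ (ν + 1/2) f (g⁻¹ z)`, where
`g⁻¹ z = (d z - b) / (- c z + a)`. The base of the power is positive on the real projective line,
and the power is the principal one (near the real projective line). -/
def principalSeriesFun (V : Type*) [NormedAddCommGroup V] [NormedSpace ℂ V]
    (ν : ℂ) (g : SL(2, ℝ)) :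
    (OnePoint ℂ → V) →ₗ[ℂ] (OnePoint ℂ → V) where
  toFun f p := factor g p ^ (ν + 1 / 2) • f (moebius g⁻¹ p)
  map_add' f h := by ext p; simp
  map_smul' c f := by ext p; simp [smul_comm c]

/-- The linear action of `g⁻¹` in homogeneous coordinates. -/
def linAct (g : SL(2, ℝ)) (v : ℂ × ℂ) : ℂ × ℂ :=
  ((g 1 1 : ℂ) * v.1 - (g 0 1 : ℂ) * v.2, -(g 1 0 : ℂ) * v.1 + (g 0 0 : ℂ) * v.2)

theorem det_complex (g : SL(2, ℝ)) :
    (g 0 0 : ℂ) * (g 1 1 : ℂ) - (g 0 1 : ℂ) * (g 1 0 : ℂ) = 1 := by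
  have := g.det_coe
  rw [Matrix.det_fin_two] at this
  exact_mod_cast this

theorem linAct_ne_zero (g : SL(2, ℝ)) {v : ℂ × ℂ} (hv : v ≠ 0) : linAct g v ≠ 0 := by
  intro h
  have h1 : (g 1 1 : ℂ) * v.1 - (g 0 1 : ℂ) * v.2 = 0 := congrArg Prod.fst h
  have h2 : -(g 1 0 : ℂ) * v.1 + (g 0 0 : ℂ) * v.2 = 0 := congrArg Prod.snd h
  have hd := det_complex g
  apply hv
  refine Prod.ext ?_ ?_
  · show v.1 = 0
    linear_combination (g 0 0 : ℂ) * h1 + (g 0 1 : ℂ) * h2 - v.1 * hd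
  · show v.2 = 0
    linear_combination (g 1 0 : ℂ) * h1 + (g 1 1 : ℂ) * h2 - v.2 * hd

theorem moebius_inv_homog (g : SL(2, ℝ)) {v : ℂ × ℂ} (hv : v ≠ 0) :
    moebius g⁻¹ (homog v) = homog (linAct g v) := by
  have e : ∀ i j, (Matrix.SpecialLinearGroup.mapGL ℂ g⁻¹) i j = ((g⁻¹ i j : ℝ) : ℂ) :=
    fun i j => rfl
  have i00 : g⁻¹ 0 0 = g 1 1 := by simp [Matrix.SpecialLinearGroup.SL2_inv_expl]
  have i01 : g⁻¹ 0 1 = - g 0 1 := by simp [Matrix.SpecialLinearGroup.SL2_inv_expl]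
  have i10 : g⁻¹ 1 0 = - g 1 0 := by simp [Matrix.SpecialLinearGroup.SL2_inv_expl]
  have i11 : g⁻¹ 1 1 = g 0 0 := by simp [Matrix.SpecialLinearGroup.SL2_inv_expl]
  by_cases h : v.2 = 0
  · have h1 : v.1 ≠ 0 := (ne_zero_cases hv).resolve_left (by simpa using h)
    have : homog v = ∞ := by simp [homog, h]
    rw [this, moebius, OnePoint.smul_infty_eq_ite]
    simp only [e, i00, i10, linAct, homog, h]
    by_cases hc : g 1 0 = 0
    · simp [hc]
    · have hc' : (g 1 0 : ℂ) ≠ 0 := by exact_mod_cast hc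
      simp only [Complex.ofReal_neg, neg_eq_zero, hc', if_false, mul_zero, sub_zero, add_zero,
        mul_eq_zero, h1, or_self, neg_mul]
      congr 1
      field_simp
  · rw [homog_of_ne h, moebius, OnePoint.smul_some_eq_ite]
    simp only [e, i00, i01, i10, i11]
    have hr : homog (linAct g v) = if -(g 1 0 : ℂ) * v.1 + (g 0 0 : ℂ) * v.2 = 0 then ∞ else
        (((((g 1 1 : ℂ) * v.1 - (g 0 1 : ℂ) * v.2) /
          (-(g 1 0 : ℂ) * v.1 + (g 0 0 : ℂ) * v.2) : ℂ)) : OnePoint ℂ) := rfl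
    rw [hr]
    have hk : ((-g 1 0 : ℝ) : ℂ) * (v.1 / v.2) + (g 0 0 : ℂ) =
        (-(g 1 0 : ℂ) * v.1 + (g 0 0 : ℂ) * v.2) / v.2 := by
      push_cast
      field_simp
    have hk2 : (g 1 1 : ℂ) * (v.1 / v.2) + ((-g 0 1 : ℝ) : ℂ) =
        ((g 1 1 : ℂ) * v.1 - (g 0 1 : ℂ) * v.2) / v.2 := by
      push_cast
      field_simp
      ring
    rw [hk, hk2]
    by_cases hz : -(g 1 0 : ℂ) * v.1 + (g 0 0 : ℂ) * v.2 = 0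
    · rw [if_pos hz, hz, zero_div, if_pos rfl]
    · have : (-(g 1 0 : ℂ) * v.1 + (g 0 0 : ℂ) * v.2) / v.2 ≠ 0 := div_ne_zero hz h
      rw [if_neg this, if_neg hz, div_div_div_cancel_right₀ h]

theorem factor_homog (g : SL(2, ℝ)) {v : ℂ × ℂ} (hv : v ≠ 0) :
    factor g (homog v) =
      (v.1 ^ 2 + v.2 ^ 2) / ((linAct g v).1 ^ 2 + (linAct g v).2 ^ 2) := by
  by_cases h : v.2 = 0
  · have h1 : v.1 ≠ 0 := (ne_zero_cases hv).resolve_left (by simpa using h)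
    have : homog v = ∞ := by simp [homog, h]
    rw [this]
    simp only [factor, OnePoint.elim_infty, linAct, h]
    have : ((g 1 1 : ℂ) * v.1 - (g 0 1 : ℂ) * 0) ^ 2 + (-(g 1 0 : ℂ) * v.1 + (g 0 0 : ℂ) * 0) ^ 2
      = v.1 ^ 2 * ((g 1 0 : ℂ) ^ 2 + (g 1 1 : ℂ) ^ 2) := by ring
    rw [this]
    have h2 : v.1 ^ 2 ≠ 0 := pow_ne_zero _ h1
    rw [← mul_one (v.1 ^ 2), mul_assoc, one_mul]
    have e : v.1 ^ 2 * 1 + (0 : ℂ) ^ 2 = v.1 ^ 2 * 1 := by ring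
    rw [e, mul_div_mul_left _ _ h2]
  · rw [homog_of_ne h]
    simp only [factor, OnePoint.elim_some, linAct]
    have h2 : v.2 ^ 2 ≠ 0 := pow_ne_zero _ h
    rw [← mul_div_mul_left _ _ h2]
    congr 1
    · field_simp
      ring
    · field_simp
      ring

theorem factor_mul (g h : SL(2, ℝ)) {p : OnePoint ℂ} (hp : factor g p ≠ 0) :
    factor (g * h) p = factor g p * factor h (moebius g⁻¹ p) := by
  obtain ⟨v, hv, rfl⟩ := exists_homog p
  have hl : linAct (g * h) v = linAct h (linAct g v) := by
    simp only [linAct, Matrix.SpecialLinearGroup.coe_mul, Matrix.mul_apply, Fin.sum_univ_two]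
    push_cast
    refine Prod.ext ?_ ?_ <;> simp only <;> ring
  rw [factor_homog _ hv] at hp
  rw [moebius_inv_homog g hv, factor_homog _ hv, factor_homog _ hv,
    factor_homog _ (linAct_ne_zero g hv), hl]
  have : (linAct g v).1 ^ 2 + (linAct g v).2 ^ 2 ≠ 0 := by
    intro h0
    simp [h0] at hp
  rw [div_mul_div_cancel₀ this]

/-- A neighbourhood of the real projective line on which the factor is well behaved. -/
def goodSet (g : SL(2, ℝ)) : Set (OnePoint ℂ) := {p | 0 < (factor g p).re}

theorem differentiable_linAct (g : SL(2, ℝ)) : Differentiable ℂ (linAct g) := by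
  unfold linAct
  fun_prop

theorem differentiableAt_factor (g : SL(2, ℝ)) {v : ℂ × ℂ}
    (hd : (linAct g v).1 ^ 2 + (linAct g v).2 ^ 2 ≠ 0) :
    DifferentiableAt ℂ (fun v : ℂ × ℂ =>
      (v.1 ^ 2 + v.2 ^ 2) / ((linAct g v).1 ^ 2 + (linAct g v).2 ^ 2)) v := by
  have h1 : Differentiable ℂ (fun v => (linAct g v).1) := (differentiable_linAct g).fst
  have h2 : Differentiable ℂ (fun v => (linAct g v).2) := (differentiable_linAct g).snd
  fun_prop (disch := exact hd)

theorem denom_ne_zero (g : SL(2, ℝ)) {v : ℂ × ℂ} (hv : v ≠ 0) (h : homog v ∈ goodSet g) :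
    (linAct g v).1 ^ 2 + (linAct g v).2 ^ 2 ≠ 0 := by
  intro h0
  have h' : 0 < (factor g (homog v)).re := h
  rw [factor_homog g hv, h0] at h'
  simp at h'

theorem isOpen_goodSet (g : SL(2, ℝ)) : IsOpen (goodSet g) := by
  rw [isOpen_iff_homog, isOpen_iff_mem_nhds]
  rintro v ⟨hv, hg⟩
  have hc := (differentiableAt_factor g (denom_ne_zero g hv hg)).continuousAt
  have h0 : 0 < ((v.1 ^ 2 + v.2 ^ 2) / ((linAct g v).1 ^ 2 + (linAct g v).2 ^ 2)).re := by
    have h' : 0 < (factor g (homog v)).re := hg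
    rwa [factor_homog g hv] at h'
  have hv' : ∀ᶠ u in 𝓝 v, u ≠ 0 := continuousAt_id.eventually_ne hv
  filter_upwards [hv', (continuousAt_const (y := (0 : ℝ))).eventually_lt
    (Complex.continuous_re.continuousAt.comp hc) h0] with u h1 h2
  refine ⟨h1, ?_⟩
  show 0 < (factor g (homog u)).re
  rw [factor_homog g h1]
  exact h2

theorem realLine_subset_goodSet (g : SL(2, ℝ)) : realLine ⊆ goodSet g := by
  have hd : g 0 0 * g 1 1 - g 0 1 * g 1 0 = 1 := by
    have := g.det_coe
    rwa [Matrix.det_fin_two] at this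
  rintro _ ⟨p, rfl⟩
  induction p with
  | infty =>
    show 0 < (1 / ((g 1 0 : ℂ) ^ 2 + (g 1 1 : ℂ) ^ 2)).re
    have : (1 / ((g 1 0 : ℂ) ^ 2 + (g 1 1 : ℂ) ^ 2)) =
      ((1 / ((g 1 0) ^ 2 + (g 1 1) ^ 2) : ℝ) : ℂ) := by push_cast; rfl
    rw [this, Complex.ofReal_re]
    apply one_div_pos.2
    rcases eq_or_ne (g 1 0) 0 with h | h
    · have : g 1 1 ≠ 0 := by rintro h'; rw [h, h'] at hd; norm_num at hd
      positivity
    · positivity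
  | coe x =>
    show 0 < ((1 + (x : ℂ) ^ 2) /
      (((g 1 0 : ℂ) * x - g 0 0) ^ 2 + ((g 1 1 : ℂ) * x - g 0 1) ^ 2)).re
    have : ((1 + (x : ℂ) ^ 2) /
      (((g 1 0 : ℂ) * x - g 0 0) ^ 2 + ((g 1 1 : ℂ) * x - g 0 1) ^ 2)) =
      (((1 + x ^ 2) / ((g 1 0 * x - g 0 0) ^ 2 + (g 1 1 * x - g 0 1) ^ 2) : ℝ) : ℂ) := by
      push_cast; rfl
    rw [this, Complex.ofReal_re]
    apply div_pos (by positivity)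
    rcases eq_or_ne (g 1 0 * x - g 0 0) 0 with h | h
    · have : g 1 1 * x - g 0 1 ≠ 0 := by
        intro h'
        have : (1 : ℝ) = 0 := by linear_combination -hd + g 1 0 * h' - g 1 1 * h
        norm_num at this
      positivity
    · positivity

theorem moebius_mem_realLine (g : SL(2, ℝ)) {p : OnePoint ℂ} (hp : p ∈ realLine) :
    moebius g p ∈ realLine := by
  obtain ⟨x, rfl⟩ := hp
  refine ⟨Matrix.SpecialLinearGroup.mapGL ℝ g • x, ?_⟩
  have := OnePoint.map_smul Complex.ofRealHom (Matrix.SpecialLinearGroup.mapGL ℝ g) x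
  refine this.trans ?_
  rfl

theorem moebius_mul (g h : SL(2, ℝ)) (p : OnePoint ℂ) :
    moebius (g * h) p = moebius g (moebius h p) := by
  simp [moebius, mul_smul]

theorem moebius_one (p : OnePoint ℂ) : moebius 1 p = p := by
  simp [moebius]

theorem moebius_mem_realLine_iff (g : SL(2, ℝ)) {p : OnePoint ℂ} :
    moebius g p ∈ realLine ↔ p ∈ realLine := by
  refine ⟨fun h => ?_, moebius_mem_realLine g⟩
  have := moebius_mem_realLine g⁻¹ h
  rwa [← moebius_mul, inv_mul_cancel, moebius_one] at this

theorem HolomorphicOn.principalSeriesFun {f : OnePoint ℂ → V} {U : Set (OnePoint ℂ)}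
    (hf : HolomorphicOn f U) (ν : ℂ) (g : SL(2, ℝ)) :
    HolomorphicOn (principalSeriesFun V ν g f) (goodSet g ∩ moebius g⁻¹ ⁻¹' U) := by
  rw [holomorphicOn_iff] at hf ⊢
  have h1 : DifferentiableOn ℂ (fun v => f (homog (linAct g v)))
      {v | v ≠ 0 ∧ homog v ∈ goodSet g ∩ moebius g⁻¹ ⁻¹' U} := by
    refine hf.comp (differentiable_linAct g).differentiableOn ?_
    rintro v ⟨hv, -, hvU⟩
    refine ⟨linAct_ne_zero g hv, ?_⟩
    rwa [Set.mem_preimage, moebius_inv_homog g hv] at hvU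
  have h2 : DifferentiableOn ℂ (fun v : ℂ × ℂ =>
      ((v.1 ^ 2 + v.2 ^ 2) / ((linAct g v).1 ^ 2 + (linAct g v).2 ^ 2)) ^ (ν + 1 / 2))
      {v | v ≠ 0 ∧ homog v ∈ goodSet g ∩ moebius g⁻¹ ⁻¹' U} := by
    rintro v ⟨hv, hvg, -⟩
    have h0 : 0 < (factor g (homog v)).re := hvg
    rw [factor_homog g hv] at h0
    exact ((differentiableAt_factor g (denom_ne_zero g hv hvg)).cpow
      (differentiableAt_const _) (Or.inl h0)).differentiableWithinAt
  refine (h2.smul h1).congr ?_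
  rintro v ⟨hv, -⟩
  show factor g (homog v) ^ (ν + 1 / 2) • f (moebius g⁻¹ (homog v)) = _
  rw [moebius_inv_homog g hv, factor_homog g hv]
  rfl

theorem isOpen_preimage_moebius (g : SL(2, ℝ)) {U : Set (OnePoint ℂ)} (hU : IsOpen U) :
    IsOpen (moebius g⁻¹ ⁻¹' U) := by
  rw [isOpen_iff_homog] at hU ⊢
  have h := (hU.preimage (differentiable_linAct g).continuous).inter
    (isOpen_ne (x := (0 : ℂ × ℂ)))
  convert h using 1
  ext v
  constructor
  · rintro ⟨hv, h⟩
    rw [Set.mem_preimage, moebius_inv_homog g hv] at h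
    exact ⟨⟨linAct_ne_zero g hv, h⟩, hv⟩
  · rintro ⟨⟨-, h⟩, hv⟩
    refine ⟨hv, ?_⟩
    rwa [Set.mem_preimage, moebius_inv_homog g hv]

/-- The operator `π_ν(g)` on hyperfunctions on the real projective line. -/
def principalSeriesOp (V : Type*) [NormedAddCommGroup V] [NormedSpace ℂ V]
    (ν : ℂ) (g : SL(2, ℝ)) :
    Hyperfunction V realLine →ₗ[ℂ] Hyperfunction V realLine :=
  Hyperfunction.lift (principalSeriesFun V ν g)
    (by
      rintro f ⟨U, hU, hΩ, hf⟩
      refine ⟨goodSet g ∩ moebius g⁻¹ ⁻¹' U,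
        (isOpen_goodSet g).inter (isOpen_preimage_moebius g hU),
        Set.subset_inter (realLine_subset_goodSet g)
          fun p hp => hΩ (moebius_mem_realLine g⁻¹ hp), ?_⟩
      refine (hf.principalSeriesFun ν g).mono ?_
      rintro p ⟨⟨h1, h2⟩, h3⟩
      exact ⟨h1, h2, fun h => h3 ((moebius_mem_realLine_iff g⁻¹).1 h)⟩)
    (by
      rintro f ⟨U, hU, hΩ, h, hh, hf⟩
      refine ⟨goodSet g ∩ moebius g⁻¹ ⁻¹' U,
        (isOpen_goodSet g).inter (isOpen_preimage_moebius g hU),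
        Set.subset_inter (realLine_subset_goodSet g)
          fun p hp => hΩ (moebius_mem_realLine g⁻¹ hp),
        principalSeriesFun V ν g h, hh.principalSeriesFun ν g, ?_⟩
      rintro p ⟨⟨-, h2⟩, h3⟩
      show factor g p ^ (ν + 1 / 2) • f (moebius g⁻¹ p) =
        factor g p ^ (ν + 1 / 2) • h (moebius g⁻¹ p)
      rw [hf ⟨h2, fun h => h3 ((moebius_mem_realLine_iff g⁻¹).1 h)⟩])

theorem mk_eq_of_eqOn {Ω U : Set (OnePoint ℂ)} {f h : boundaryGerms V Ω} (hU : IsOpen U)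
    (hΩ : Ω ⊆ U) (hfh : Set.EqOn f.1 h.1 U) :
    (Submodule.Quotient.mk f : Hyperfunction V Ω) = Submodule.Quotient.mk h := by
  rw [Submodule.Quotient.eq]
  refine ⟨U, hU, hΩ, 0, HolomorphicOn.zero _, fun p hp => ?_⟩
  show f.1 p - h.1 p = 0
  rw [hfh hp.1, sub_self]

/-- The representation of `SL₂(ℝ)` (trivial on `± 1`) on the `V`-valued hyperfunction vectors of
the principal series with parameter `ν`, i.e. on `π_ν^{-ω} ⊗ V` with `G` acting on the first
factor. -/
def principalSeries (V : Type*) [NormedAddCommGroup V] [NormedSpace ℂ V] (ν : ℂ) :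
    Representation ℂ SL(2, ℝ) (Hyperfunction V realLine) where
  toFun g := principalSeriesOp V ν g
  map_one' := by
    refine LinearMap.ext fun α => ?_
    obtain ⟨f, rfl⟩ := Submodule.Quotient.mk_surjective _ α
    refine mk_eq_of_eqOn (isOpen_goodSet 1) (realLine_subset_goodSet 1) fun p hp => ?_
    have hp0 : 0 < (factor 1 p).re := hp
    have hne : factor 1 p ≠ 0 := by
      intro h
      simp [h] at hp0
    have h1 := factor_mul 1 1 hne
    rw [mul_one, inv_one, moebius_one] at h1
    have h2 : factor 1 p = 1 := by
      have := mul_left_cancel₀ hne ((mul_one _).trans h1)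
      exact this.symm
    show factor 1 p ^ (ν + 1 / 2) • f.1 (moebius 1⁻¹ p) = f.1 p
    rw [h2, inv_one, moebius_one, Complex.one_cpow, one_smul]
  map_mul' g h := by
    refine LinearMap.ext fun α => ?_
    obtain ⟨f, rfl⟩ := Submodule.Quotient.mk_surjective _ α
    refine mk_eq_of_eqOn ((isOpen_goodSet g).inter (isOpen_preimage_moebius g (isOpen_goodSet h)))
      (Set.subset_inter (realLine_subset_goodSet g) fun p hp =>
        realLine_subset_goodSet h (moebius_mem_realLine g⁻¹ hp)) ?_
    rintro p ⟨h1, h2⟩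
    have hp1 : 0 < (factor g p).re := h1
    have hp2 : 0 < (factor h (moebius g⁻¹ p)).re := h2
    have hne1 : factor g p ≠ 0 := by
      intro h
      simp [h] at hp1
    have hne2 : factor h (moebius g⁻¹ p) ≠ 0 := by
      intro h
      simp [h] at hp2
    show factor (g * h) p ^ (ν + 1 / 2) • f.1 (moebius (g * h)⁻¹ p) =
      factor g p ^ (ν + 1 / 2) •
        (factor h (moebius g⁻¹ p) ^ (ν + 1 / 2) • f.1 (moebius h⁻¹ (moebius g⁻¹ p)))
    have ha1 := abs_lt.1 (Complex.abs_arg_lt_pi_div_two_iff.2 (Or.inl hp1))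
    have ha2 := abs_lt.1 (Complex.abs_arg_lt_pi_div_two_iff.2 (Or.inl hp2))
    have hlog := Complex.log_mul_eq_add_log_iff hne1 hne2 |>.2 ⟨by linarith, by linarith⟩
    rw [factor_mul g h hne1, mul_inv_rev, moebius_mul, smul_smul,
      Complex.cpow_def_of_ne_zero (mul_ne_zero hne1 hne2), Complex.cpow_def_of_ne_zero hne1,
      Complex.cpow_def_of_ne_zero hne2, hlog, add_mul, Complex.exp_add]

end Holomorphic

/-! ### The modular group and its representations -/

/-- The element `± (0 1; -1 0)` of the modular group. -/
def S : PSL(2, ℤ) :=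
  QuotientGroup.mk (⟨!![0, 1; -1, 0], by simp [Matrix.det_fin_two]⟩ : SL(2, ℤ))

/-- The element `± (1 1; 0 1)` of the modular group. -/
def T : PSL(2, ℤ) :=
  QuotientGroup.mk (⟨!![1, 1; 0, 1], by simp [Matrix.det_fin_two]⟩ : SL(2, ℤ))

/-- The subgroup of `Γ` generated by all its parabolic elements. -/
def parabolicSubgroup (Γ : Subgroup PSL(2, ℤ)) : Subgroup PSL(2, ℤ) :=
  Subgroup.closure {γ | γ ∈ Γ ∧ ∃ g : SL(2, ℤ), (g : PSL(2, ℤ)) = γ ∧ g.1.IsParabolic}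

section Spaces

variable {V : Type*} [NormedAddCommGroup V] [NormedSpace ℂ V]

/-- The restriction of `η` to `Γ` is unipotent of length `q`: there is a filtration
`0 = F 0 ⊆ F 1 ⊆ ⋯ ⊆ F (q + 1) = V` by `Γ`-stable subspaces such that `Γ` acts trivially on each
quotient `F (k + 1) / F k` (which makes the subspaces `Γ`-stable). -/
def IsUnipotentOfLength (Γ : Subgroup PSL(2, ℤ)) (η : Representation ℂ PSL(2, ℤ) V) (q : ℕ) :
    Prop :=
  ∃ F : ℕ → Submodule ℂ V, F 0 = ⊥ ∧ F (q + 1) = ⊤ ∧ Monotone F ∧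
    ∀ k ≤ q, ∀ γ ∈ Γ, ∀ v ∈ F (k + 1), η γ v - v ∈ F k

/-- The space `A_{ν,η}^{-ω} = (π_ν^{-ω} ⊗ η)^{Γ(1)}` of `η`-automorphic hyperfunctions. -/
def automorphicHyperfunctions [FiniteDimensional ℂ V] (ν : ℂ)
    (η : Representation ℂ PSL(2, ℤ) V) : Submodule ℂ (Hyperfunction V realLine) where
  carrier := {α | ∀ γ : SL(2, ℤ), Hyperfunction.mapValues (η (γ : PSL(2, ℤ)))
    (principalSeries V ν (γ.map (Int.castRingHom ℝ)) α) = α}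
  add_mem' := by
    intro α β hα hβ γ
    rw [map_add, map_add, hα γ, hβ γ]
  zero_mem' := by
    intro γ
    rw [map_zero, map_zero]
  smul_mem' := by
    intro c α hα γ
    rw [map_smul, map_smul, hα γ]

/-- The filter `Im z → +∞` on the complex plane. -/
def atUpper : Filter ℂ := comap Complex.im atTop

/-- The filter `Im z → -∞` on the complex plane. -/
def atLower : Filter ℂ := comap Complex.im atBot

/-- The space `𝓕_η` of holomorphic functions `f : ℂ ∖ ℝ → V` with `f (z + 1) = η(T) f(z)` that
are bounded as `|Im z| → ∞` and satisfy `f(i∞) + f(-i∞) = 0`. A function on `ℂ ∖ ℝ` is encoded as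
the function on `ℂ` that extends it by `0`. -/
def spaceFη (η : Representation ℂ PSL(2, ℤ) V) : Set (ℂ → V) :=
  {f | (∀ z : ℂ, z.im = 0 → f z = 0) ∧
    DifferentiableOn ℂ f {z : ℂ | z.im ≠ 0} ∧
    (∀ z : ℂ, z.im ≠ 0 → f (z + 1) = η T (f z)) ∧
    (∃ C M : ℝ, ∀ z : ℂ, M ≤ |z.im| → ‖f z‖ ≤ C) ∧
    ∃ v w : V, Tendsto f atUpper (𝓝 v) ∧ Tendsto f atLower (𝓝 w) ∧ v + w = 0}

/-- The expression `f(z) - z ^ (-2ν-1) η(S) f(-1/z)`, with the principal branch of the power. -/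
def bruggemanExpr (ν : ℂ) (η : Representation ℂ PSL(2, ℤ) V) (f : ℂ → V) (z : ℂ) : V :=
  f z - z ^ (-2 * ν - 1) • η S (f (-1 / z))

/-- The space `𝓕_{ν,η}` of all `f` in `𝓕_η` for which `f(z) - z ^ (-2ν-1) η(S) f(-1/z)` extends
holomorphically from `ℂ ∖ ℝ` to the slit plane `ℂ ∖ (-∞, 0]`. -/
def spaceF (ν : ℂ) (η : Representation ℂ PSL(2, ℤ) V) : Set (ℂ → V) :=
  {f | f ∈ spaceFη η ∧ ∃ g : ℂ → V, DifferentiableOn ℂ g Complex.slitPlane ∧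
    ∀ z : ℂ, z.im ≠ 0 → g z = bruggemanExpr ν η f z}

/-- The function `z ↦ (1 + z²) ^ (ν + 1/2) f(z)` on the affine part of the projective line (its
value at `∞` plays no role). -/
def affineRepresentative (ν : ℂ) (f : ℂ → V) (p : OnePoint ℂ) : V :=
  p.elim 0 (fun z => (1 + z ^ 2) ^ (ν + 1 / 2) • f z)

/-- `f` is the function `f_α` associated with the automorphic hyperfunction `α`: it lies in
`𝓕_{ν,η}` and `z ↦ (1 + z²) ^ (ν + 1/2) f(z)` represents the restriction of `α` to `ℝ`. -/
def IsAssociated [FiniteDimensional ℂ V] (ν : ℂ) (η : Representation ℂ PSL(2, ℤ) V)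
    (α : automorphicHyperfunctions ν η) (f : ℂ → V) : Prop :=
  f ∈ spaceF ν η ∧
    IsRepresentedBy (Hyperfunction.toAffine (V := V) α.1) (affineRepresentative ν f)

/-- The expression `ψ(z) + z ^ (-2ν-1) η(S) ψ(-1/z)`. -/
def inversionExpr (ν : ℂ) (η : Representation ℂ PSL(2, ℤ) V) (ψ : ℂ → V) (z : ℂ) : V :=
  ψ z + z ^ (-2 * ν - 1) • η S (ψ (-1 / z))

/-- The space `Ψ_{ν,η}` of holomorphic functions `ψ : ℂ ∖ (-∞, 0] → V` that satisfy the Lewis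
equation and the limit condition. A function on `ℂ ∖ (-∞, 0]` is encoded as the function on `ℂ`
that extends it by `0`. -/
def spacePsi (ν : ℂ) (η : Representation ℂ PSL(2, ℤ) V) : Submodule ℂ (ℂ → V) where
  carrier := {ψ | (∀ z : ℂ, z ∉ Complex.slitPlane → ψ z = 0) ∧
    DifferentiableOn ℂ ψ Complex.slitPlane ∧
    (∀ z ∈ Complex.slitPlane, η T (ψ z) =
      ψ (z + 1) + (z + 1) ^ (-2 * ν - 1) • η (S * T⁻¹) (ψ (z / (z + 1)))) ∧
    ∃ v w : V, Tendsto (inversionExpr ν η ψ) atUpper (𝓝 v) ∧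
      Tendsto (inversionExpr ν η ψ) atLower (𝓝 w) ∧
      Complex.exp (Real.pi * Complex.I * ν) • v + Complex.exp (-(Real.pi * Complex.I * ν)) • w = 0}
  add_mem' := by
    rintro ψ φ ⟨h1, h2, h3, v, w, h4, h5, h6⟩ ⟨k1, k2, k3, v', w', k4, k5, k6⟩
    have e : inversionExpr ν η (ψ + φ) = fun z => inversionExpr ν η ψ z + inversionExpr ν η φ z := by
      funext z
      simp only [inversionExpr, Pi.add_apply, map_add, smul_add]
      abel
    refine ⟨fun z hz => by simp [h1 z hz, k1 z hz], h2.add k2, fun z hz => ?_, v + v', w + w',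
      e ▸ h4.add k4, e ▸ h5.add k5, ?_⟩
    · simp only [Pi.add_apply, map_add, smul_add, h3 z hz, k3 z hz]
      abel
    · rw [smul_add, smul_add, add_add_add_comm, h6, k6, add_zero]
  zero_mem' := by
    have e : inversionExpr ν η (0 : ℂ → V) = fun _ => 0 := by
      funext z
      simp [inversionExpr]
    refine ⟨fun _ _ => rfl, differentiableOn_const (0 : V), fun z _ => by simp, 0, 0,
      e ▸ tendsto_const_nhds, e ▸ tendsto_const_nhds, by simp⟩
  smul_mem' := by
    rintro c ψ ⟨h1, h2, h3, v, w, h4, h5, h6⟩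
    have e : inversionExpr ν η (c • ψ) = fun z => c • inversionExpr ν η ψ z := by
      funext z
      simp only [inversionExpr, Pi.smul_apply, map_smul, smul_add]
      rw [smul_comm c]
    refine ⟨fun z hz => by simp [h1 z hz], h2.const_smul c, fun z hz => ?_, c • v, c • w,
      e ▸ h4.const_smul c, e ▸ h5.const_smul c, ?_⟩
    · simp only [Pi.smul_apply, map_smul, h3 z hz, smul_add]
      rw [smul_comm c]
    · rw [smul_comm _ c v, smul_comm _ c w, ← smul_add, h6, smul_zero]

end Spaces

end LewisTransform

end

/-!
The Bruggeman transform attaches to an `η`-automorphic hyperfunction `α` a function `f` on `ℂ ∖ ℝ`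
with `f(z + 1) = η(T) f(z)`, and to `f` the period function
`ψ(z) = f(z) - z ^ (-2ν-1) η(S) f(-1/z)`. The modular group is generated by `S` and `T`; the
invariance of `α` under `T` is what allows `f` to be defined globally, and its invariance under `S`
says that `ψ` extends across the positive real axis.

*From `α` to `f`.* Some power of `T` is a parabolic element of `Γ`, so `η(T)` has finite order `N`.
Let `F` represent `α`, and put `f₀ = (1 + z²) ^ (-ν-1/2) F` on a strip around `ℝ`. Invariance under
`T` means that `f₀(z) - η(T) f₀(z - 1)` extends across `ℝ` to a function `h`; as the hyperfunction
is defined near `∞` too, `h` grows at most like a power of `|z|` in the strip. A holomorphic cutoff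
`1 / (1 + e^{-z})` splits `h` into parts that decay at either end, and summing translates solves
`g(z) - η(T) g(z - 1) = h(z)` (`exists_sub_comp_shift_eq`). Then `f₀ - g` is exactly equivariant,
hence `N`-periodic, and the Laurent splitting in `q = e^{2πiz/N}` replaces it by a function on all
of `ℂ ∖ ℝ` with limits at `± i∞` (`exists_periodic_of_strip`). Averaging over `ℤ/N` restores
equivariance, and subtraction of a constant fixed by `η(T)` makes the two limits opposite
(`exists_equivariant_representative`). The function `f` is unique by Liouville's theorem
(`eq_zero_of_mem_spaceFη`).

*From `f` to `ψ` and back.* The Lewis equation for `ψ` results from the periodicity of `f` and the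
relation `S T⁻¹ S T⁻¹ = T S` (`bruggemanExpr_lewis`). On the upper and lower half-planes,
`z ^ (-2ν-1) (-1/z) ^ (-2ν-1) = -e^{∓2πiν}`, whence
`ψ(z) + z ^ (-2ν-1) η(S) ψ(-1/z) = (1 + e^{∓2πiν}) f(z)` (`inversionExpr_of_eq`). Thus the limit
condition on `ψ` amounts to `2 cos(πν) (f(i∞) + f(-i∞)) = 0`, and for `ν ∉ 1/2 + ℤ`, when the
factors do not vanish, this formula recovers `f` from `ψ` (`exists_mem_spaceF`).

*From `f` to `α`.* An automorphic `α` is determined by its restriction to `ℝ`, since `S` maps `∞`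
to `0`. Conversely, for every `f` in `𝓕_{ν,η}` the germs of `G = (1 + z²) ^ (ν+1/2) f` at the real
points are invariant under `T`, and under `S` except at `0`. To extend `G` across `∞`, the defect
of `S`-invariance near `1`, which is holomorphic, is written as `h(z) - η(S) h(-1/z)` with a
function `h` that is holomorphic on the unit disc and near `± 1` (`exists_sub_comp_inversion_eq`).
Then `G - h` is exactly `S`-invariant near `± 1`, so that it can be continued by means of `S` to a
neighbourhood of the real projective line (`exists_fixedAt_S_of_compatible`). Invariance under `T`
at `∞` is automatic because of `T = S T⁻¹ S T⁻¹ S`, in which `T⁻¹` acts at the points `0` and `-1`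
(`fixedAt_of_generators`).
-/

noncomputable section

namespace LewisTransform

open MeasureTheory

/-! ### Parameter integrals and Cauchy integrals -/

section Analysis

variable {V : Type*} [NormedAddCommGroup V] [NormedSpace ℂ V]

/-- Holomorphic dependence of an integral on a parameter. Local boundedness of the integrand is
enough, since Cauchy's estimate then bounds its derivative. -/
theorem differentiableOn_integral_of_locally_bounded [CompleteSpace V] {X : Type*}
    [MeasurableSpace X] {m : Measure X} [IsFiniteMeasure m] {E : Set ℂ} (hE : IsOpen E)
    {G : ℂ → X → V}
    (hmeas : ∀ z ∈ E, AEStronglyMeasurable (G z) m)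
    (hdiff : ∀ x, DifferentiableOn ℂ (fun z => G z x) E)
    (hbd : ∀ z ∈ E, ∃ C : ℝ, ∀ᶠ w in 𝓝 z, ∀ x, ‖G w x‖ ≤ C) :
    DifferentiableOn ℂ (fun z => ∫ x, G z x ∂m) E := by
  intro z hz
  obtain ⟨C, hC⟩ := hbd z hz
  obtain ⟨r, hr, hball⟩ := Metric.eventually_nhds_iff_ball.1
    (hC.and (hE.mem_nhds hz))
  have hr2 : 0 < r / 2 := by linarith
  have hd : ∀ x, ∀ w ∈ Metric.ball z (r / 2), HasDerivAt (fun z => G z x)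
      (deriv (fun z => G z x) w) w := by
    intro x w hw
    have hw' : w ∈ Metric.ball z r := Metric.ball_subset_ball (by linarith) hw
    exact ((hdiff x).differentiableAt (hE.mem_nhds (hball w hw').2)).hasDerivAt
  have hb : ∀ x, ∀ w ∈ Metric.ball z (r / 2), ‖deriv (fun z => G z x) w‖ ≤ C / (r / 2 / 2) := by
    intro x w hw
    have hsub : Metric.closedBall w (r / 2 / 2) ⊆ Metric.ball z r := by
      intro u hu
      have h1 := dist_triangle u w z
      have h2 : dist u w ≤ r / 2 / 2 := hu
      have h3 : dist w z < r / 2 := hw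
      exact lt_of_le_of_lt h1 (by linarith)
    refine Complex.norm_deriv_le_of_forall_mem_sphere_norm_le (by positivity) ?_ ?_
    · refine DifferentiableOn.diffContOnCl ?_
      refine (hdiff x).mono fun u hu => (hball u (hsub ?_)).2
      exact Metric.closure_ball_subset_closedBall hu
    · intro u hu
      exact (hball u (hsub (Metric.sphere_subset_closedBall hu))).1 x
  have hz' : z ∈ Metric.ball z (r / 2) := Metric.mem_ball_self hr2
  -- The derivative is measurable as a limit of difference quotients.
  have hmeas' : AEStronglyMeasurable (fun x => deriv (fun z => G z x) z) m := by
    refine aestronglyMeasurable_of_tendsto_ae (u := atTop)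
      (f := fun (n : ℕ) x => ((r / 2 / (n + 2) : ℝ) : ℂ)⁻¹ •
        (G (z + (r / 2 / (n + 2) : ℝ)) x - G z x)) (fun n => ?_) ?_
    · refine ((hmeas _ ?_).sub (hmeas z hz)).const_smul _
      refine (hball _ ?_).2
      rw [Metric.mem_ball, dist_eq_norm, add_sub_cancel_left, Complex.norm_real,
        Real.norm_of_nonneg (by positivity)]
      rw [div_lt_iff₀ (by positivity)]
      nlinarith [(n.cast_nonneg : (0 : ℝ) ≤ n)]
    · refine Eventually.of_forall fun x => ?_
      have h := (hd x z hz').tendsto_slope_zero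
      refine h.comp (tendsto_nhdsWithin_iff.2 ⟨?_, Eventually.of_forall fun n => ?_⟩)
      · have h0 : Tendsto (fun n : ℕ => (r / 2 / (n + 2) : ℝ)) atTop (𝓝 0) :=
          tendsto_const_nhds.div_atTop
            (tendsto_natCast_atTop_atTop.atTop_add tendsto_const_nhds)
        exact (Complex.continuous_ofReal.tendsto' 0 0 rfl).comp h0
      · have : (r / 2 / (n + 2) : ℝ) ≠ 0 := by positivity
        exact Set.mem_compl_singleton_iff.2 (Complex.ofReal_ne_zero.2 (by simpa using this))
  have key := hasDerivAt_integral_of_dominated_loc_of_deriv_le (μ := m)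
    (F := G) (F' := fun w x => deriv (fun z => G z x) w) (x₀ := z)
    (bound := fun _ => C / (r / 2 / 2)) (Metric.ball_mem_nhds z hr2)
    (by
      filter_upwards [hE.mem_nhds hz] with w hw using hmeas w hw)
    (Integrable.of_bound (hmeas z hz) C (Eventually.of_forall fun x => (hball z
      (Metric.mem_ball_self hr)).1 x))
    hmeas' (Eventually.of_forall fun x w hw => hb x w hw) (integrable_const _)
    (Eventually.of_forall fun x w hw => hd x w hw)
  exact key.2.differentiableAt.differentiableWithinAt

/-- Gluing local extensions of a function `F` given on `D`: near every point at which `F` has a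
continuous extension `h` from `D`, the limit of `F` along `D` is `h`. -/
theorem limUnder_eq_of_eqOn {X Y : Type*} [TopologicalSpace X] [TopologicalSpace Y] [T2Space Y]
    {D U : Set X} {F h : X → Y} {x : X} [(𝓝[D] x).NeBot] (hU : U ∈ 𝓝 x)
    (hh : ContinuousAt h x) (hF : Set.EqOn F h (U ∩ D)) :
    haveI : Nonempty Y := ⟨F x⟩
    limUnder (𝓝[D] x) F = h x := by
  refine Tendsto.limUnder_eq ?_
  refine (hh.tendsto.mono_left nhdsWithin_le_nhds).congr' ?_
  filter_upwards [mem_nhdsWithin_of_mem_nhds hU, self_mem_nhdsWithin] with y h1 h2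
  exact (hF ⟨h1, h2⟩).symm

theorem integral_circle_eq_circleIntegral (f : ℂ → V) (c : ℂ) (R : ℝ) :
    (∮ z in C(c, R), f z) = ∫ θ in Set.Ioc 0 (2 * Real.pi),
      deriv (circleMap c R) θ • f (circleMap c R θ) := by
  rw [circleIntegral, intervalIntegral.integral_of_le Real.two_pi_pos.le]

/-- An integral of `k z ζ • φ ζ` over a circle is holomorphic in `z` where the kernel `k` is; only
the part of the circle on which `φ` does not vanish matters, which allows `φ` to be supported on an
arc. -/
theorem differentiableOn_circleIntegral [CompleteSpace V] {c : ℂ} {R C : ℝ} {φ : ℂ → V}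
    {E : Set ℂ} (hE : IsOpen E) {k : ℂ → ℂ → ℂ}
    (hφ : AEStronglyMeasurable (fun θ => φ (circleMap c R θ))
      (volume.restrict (Set.Ioc 0 (2 * Real.pi))))
    (hC : ∀ ζ ∈ Metric.sphere c |R|, ‖φ ζ‖ ≤ C)
    (hk : ∀ z ∈ E, Measurable (k z))
    (hkd : ∀ ζ ∈ Metric.sphere c |R|, φ ζ ≠ 0 → DifferentiableOn ℂ (fun z => k z ζ) E)
    (hkb : ∀ z ∈ E, ∃ M : ℝ, ∀ᶠ w in 𝓝 z, ∀ ζ ∈ Metric.sphere c |R|, φ ζ ≠ 0 → ‖k w ζ‖ ≤ M) :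
    DifferentiableOn ℂ (fun z => ∮ ζ in C(c, R), k z ζ • φ ζ) E := by
  simp only [integral_circle_eq_circleIntegral]
  refine differentiableOn_integral_of_locally_bounded hE ?_ ?_ ?_
  · intro z hz
    refine AEStronglyMeasurable.smul ?_ (AEStronglyMeasurable.smul ?_ hφ)
    · have : Continuous (deriv (circleMap c R)) := by
        have : deriv (circleMap c R) = fun θ => circleMap 0 R θ * Complex.I :=
          funext fun θ => by simp [deriv_circleMap]
        rw [this]
        exact (continuous_circleMap 0 R).mul continuous_const
      exact this.aestronglyMeasurable
    · exact ((hk z hz).comp (continuous_circleMap c R).measurable).aestronglyMeasurable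
  · intro θ
    by_cases h0 : φ (circleMap c R θ) = 0
    · simp only [h0, smul_zero]
      exact differentiableOn_const 0
    · exact ((hkd _ (circleMap_mem_sphere' c R θ) h0).smul_const _).const_smul _
  · intro z hz
    obtain ⟨M, hM⟩ := hkb z hz
    refine ⟨|R| * (|M| * |C|), hM.mono fun w hw θ => ?_⟩
    have h1 : ‖deriv (circleMap c R) θ‖ = |R| := by simp [deriv_circleMap]
    by_cases h0 : φ (circleMap c R θ) = 0
    · simp only [h0, smul_zero, norm_zero]
      positivity
    · rw [norm_smul, norm_smul, h1]
      have h2 := (hw _ (circleMap_mem_sphere' c R θ) h0).trans (le_abs_self M)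
      have h3 := (hC _ (circleMap_mem_sphere' c R θ)).trans (le_abs_self C)
      gcongr

/-- An integral of `k z ζ • φ ζ` over a circle is holomorphic in `z ∈ E` if the kernel `k` is
holomorphic in both variables near `E × K`, where the compact set `K` contains
the part of the circle on which `φ` does not vanish. -/
theorem differentiableOn_circleIntegral_of_compact [CompleteSpace V] {c : ℂ} {R C : ℝ}
    {φ : ℂ → V} {E K : Set ℂ} (hE : IsOpen E) (hK : IsCompact K) {k : ℂ → ℂ → ℂ}
    (hφ : AEStronglyMeasurable (fun θ => φ (circleMap c R θ))
      (volume.restrict (Set.Ioc 0 (2 * Real.pi))))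
    (hC : ∀ ζ ∈ Metric.sphere c |R|, ‖φ ζ‖ ≤ C)
    (hφK : ∀ ζ ∈ Metric.sphere c |R|, φ ζ ≠ 0 → ζ ∈ K)
    (hk : ∀ z ∈ E, Measurable (k z))
    (hkd : ∀ z ∈ E, ∀ ζ ∈ K, DifferentiableAt ℂ (fun p : ℂ × ℂ => k p.1 p.2) (z, ζ)) :
    DifferentiableOn ℂ (fun z => ∮ ζ in C(c, R), k z ζ • φ ζ) E := by
  refine differentiableOn_circleIntegral hE hφ hC hk ?_ ?_
  · intro ζ hζ hζ0 z hz
    have h1 : DifferentiableAt ℂ (fun w : ℂ => (w, ζ)) z := by fun_prop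
    exact (DifferentiableAt.comp z (hkd z hz ζ (hφK ζ hζ hζ0)) h1).differentiableWithinAt
  · intro z hz
    have hcont : ∀ ζ ∈ K, ContinuousAt (fun p : ℂ × ℂ => ‖k p.1 p.2‖) (z, ζ) :=
      fun ζ hζ => (hkd z hz ζ hζ).continuousAt.norm
    obtain ⟨M, hM⟩ := hK.exists_bound_of_continuousOn (f := k z) fun ζ hζ => by
      have h1 : DifferentiableAt ℂ (fun ξ : ℂ => (z, ξ)) ζ := by fun_prop
      exact (DifferentiableAt.comp ζ (hkd z hz ζ hζ) h1).continuousAt.continuousWithinAt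
    refine ⟨M + 1, ?_⟩
    have h := hK.eventually_forall_of_forall_eventually (x₀ := z)
      (P := fun w ζ => ‖k w ζ‖ < M + 1) fun ζ hζ =>
        (hcont ζ hζ).eventually_lt_const ((hM ζ hζ).trans_lt (lt_add_one M))
    exact h.mono fun w hw ζ hζ hζ0 => (hw ζ (hφK ζ hζ hζ0)).le

end Analysis

/-! ### Laurent splitting in an annulus -/

section Laurent

variable {V : Type*} [NormedAddCommGroup V] [NormedSpace ℂ V]

theorem isOpen_annulus (r R : ℝ) : IsOpen {z : ℂ | r < ‖z‖ ∧ ‖z‖ < R} :=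
  (isOpen_lt continuous_const continuous_norm).inter (isOpen_lt continuous_norm continuous_const)

theorem circleIntegral_sub_inv_of_norm_gt {R : ℝ} (hR : 0 < R) {q : ℂ} (hq : R < ‖q‖) :
    (∮ ζ in C(0, R), (ζ - q)⁻¹) = 0 := by
  have hne : ∀ z ∈ Metric.closedBall (0 : ℂ) R, z - q ≠ 0 := by
    intro z hz h
    rw [sub_eq_zero] at h
    subst h
    rw [mem_closedBall_zero_iff] at hz
    exact absurd hq (not_lt.2 hz)
  refine Complex.circleIntegral_eq_zero_of_differentiable_on_off_countable hR.le
    Set.countable_empty (fun z hz => ?_) fun z hz => ?_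
  · exact ((continuous_id.sub continuous_const).continuousAt.inv₀ (hne z hz)).continuousWithinAt
  · have := hne z (Metric.ball_subset_closedBall hz.1)
    exact (differentiableAt_id.sub_const q).inv this

/-- Cauchy's formula in an annulus. -/
theorem annulus_cauchy [CompleteSpace V] {r R : ℝ} {f : ℂ → V}
    (hf : DifferentiableOn ℂ f {z | r < ‖z‖ ∧ ‖z‖ < R}) {ρ₁ ρ₂ : ℝ} (h0 : 0 < ρ₁) (h1 : r < ρ₁)
    (h2 : ρ₂ < R) {q : ℂ} (hq1 : ρ₁ < ‖q‖) (hq2 : ‖q‖ < ρ₂) :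
    (∮ ζ in C(0, ρ₂), (ζ - q)⁻¹ • f ζ) - (∮ ζ in C(0, ρ₁), (ζ - q)⁻¹ • f ζ) =
      (2 * Real.pi * Complex.I : ℂ) • f q := by
  have hle : ρ₁ ≤ ρ₂ := (hq1.trans hq2).le
  have hA := isOpen_annulus r R
  have hqA : q ∈ {z : ℂ | r < ‖z‖ ∧ ‖z‖ < R} := ⟨h1.trans hq1, hq2.trans h2⟩
  have hsub : ∀ z ∈ Metric.closedBall (0 : ℂ) ρ₂ \ Metric.ball 0 ρ₁,
      z ∈ {z : ℂ | r < ‖z‖ ∧ ‖z‖ < R} := by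
    rintro z ⟨hz1, hz2⟩
    rw [mem_closedBall_zero_iff] at hz1
    rw [mem_ball_zero_iff, not_lt] at hz2
    exact ⟨h1.trans_le hz2, hz1.trans_lt h2⟩
  -- Cauchy's theorem in the annulus is applied to `ζ ↦ (f ζ - f q) / (ζ - q)`.
  have hcont : ContinuousOn (dslope f q) (Metric.closedBall (0 : ℂ) ρ₂ \ Metric.ball 0 ρ₁) :=
    ((continuousOn_dslope (hA.mem_nhds hqA)).2
      ⟨hf.continuousOn, hf.differentiableAt (hA.mem_nhds hqA)⟩).mono hsub
  have key := Complex.circleIntegral_eq_of_differentiable_on_annulus_off_countable h0 hle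
    (Set.countable_singleton q) hcont (by
      rintro z ⟨⟨hz1, hz2⟩, hz3⟩
      have hzA : z ∈ {z : ℂ | r < ‖z‖ ∧ ‖z‖ < R} :=
        hsub z ⟨Metric.ball_subset_closedBall hz1, fun h => hz2 (Metric.ball_subset_closedBall h)⟩
      exact (differentiableAt_dslope_of_ne hz3).2 (hf.differentiableAt (hA.mem_nhds hzA)))
  have hint : ∀ ρ, r < ρ → ρ < R → 0 < ρ → ρ ≠ ‖q‖ →
      (∮ ζ in C(0, ρ), dslope f q ζ) =
      (∮ ζ in C(0, ρ), (ζ - q)⁻¹ • f ζ) - (∮ ζ in C(0, ρ), (ζ - q)⁻¹) • f q := by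
    intro ρ hρ1 hρ2 hρ0 hρq
    have hne : ∀ z ∈ Metric.sphere (0 : ℂ) ρ, z - q ≠ 0 := by
      intro z hz h
      rw [sub_eq_zero] at h
      subst h
      exact hρq (mem_sphere_zero_iff_norm.1 hz).symm
    have hc1 : ContinuousOn (fun ζ => (ζ - q)⁻¹) (Metric.sphere (0 : ℂ) ρ) := fun z hz =>
      ((continuous_id.sub continuous_const).continuousAt.inv₀ (hne z hz)).continuousWithinAt
    have hc2 : ContinuousOn f (Metric.sphere (0 : ℂ) ρ) := hf.continuousOn.mono fun z hz => by
      rw [mem_sphere_zero_iff_norm] at hz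
      exact ⟨hz ▸ hρ1, hz ▸ hρ2⟩
    rw [← circleIntegral.integral_smul_const, ← circleIntegral.integral_sub]
    · refine circleIntegral.integral_congr hρ0.le fun z hz => ?_
      have := hne z hz
      rw [sub_ne_zero] at this
      rw [dslope_of_ne f this, slope_def_module, smul_sub]
    · exact (hc1.smul hc2).circleIntegrable hρ0.le
    · exact (hc1.smul continuousOn_const).circleIntegrable hρ0.le
  rw [hint ρ₂ (h1.trans_le hle) h2 (h0.trans_le hle) hq2.ne',
    hint ρ₁ h1 (hle.trans_lt h2) h0 hq1.ne, circleIntegral_sub_inv_of_norm_gt h0 hq1,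
    circleIntegral.integral_sub_inv_of_mem_ball (by simpa using hq2), zero_smul, sub_zero] at key
  rw [← key]
  abel

theorem differentiableOn_cauchyIntegral [CompleteSpace V] {ρ : ℝ} (hρ : 0 < ρ) {f : ℂ → V}
    (hf : ContinuousOn f (Metric.sphere 0 ρ)) :
    DifferentiableOn ℂ (fun z => ∮ ζ in C(0, ρ), (ζ - z)⁻¹ • f ζ) (Metric.sphere 0 ρ)ᶜ := by
  obtain ⟨C, hC⟩ := (isCompact_sphere (0 : ℂ) ρ).exists_bound_of_continuousOn hf
  have hab : |ρ| = ρ := abs_of_pos hρ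
  refine differentiableOn_circleIntegral_of_compact (C := C) Metric.isClosed_sphere.isOpen_compl
    (isCompact_sphere 0 ρ) ?_ ?_ ?_ ?_ ?_
  · have : Continuous fun θ => f (circleMap 0 ρ θ) :=
      hf.comp_continuous (continuous_circleMap 0 ρ) fun θ => circleMap_mem_sphere 0 hρ.le θ
    exact this.aestronglyMeasurable
  · rwa [hab]
  · intro ζ hζ _
    rwa [hab] at hζ
  · intro z hz
    fun_prop
  · intro z hz ζ hζ
    have : ζ - z ≠ 0 := sub_ne_zero.2 fun h => hz (h ▸ hζ)
    fun_prop (disch := exact this)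

/-- Laurent splitting of a holomorphic function on the annulus `r < |q| < 1`: the two parts are
Cauchy integrals over circles. -/
theorem exists_laurent_splitting [CompleteSpace V] {r ρ : ℝ} {f : ℂ → V}
    (hf : DifferentiableOn ℂ f {z | r < ‖z‖ ∧ ‖z‖ < 1}) (h0 : 0 < ρ) (h1 : r < ρ) (h2 : ρ < 1) :
    ∃ a b : ℂ → V, DifferentiableOn ℂ a (Metric.ball 0 1) ∧ DifferentiableOn ℂ b {z | ρ < ‖z‖} ∧
      (∀ q, ρ < ‖q‖ → ‖q‖ < 1 → f q = a q + b q) ∧ Tendsto b (Bornology.cobounded ℂ) (𝓝 0) := by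
  obtain ⟨ρ', hρ1, hρ2⟩ := exists_between h2
  have hc : ∀ t, r < t → t < 1 → ContinuousOn f (Metric.sphere (0 : ℂ) t) := fun t ht1 ht2 =>
    hf.continuousOn.mono fun z hz => by
      rw [mem_sphere_zero_iff_norm] at hz
      exact ⟨hz ▸ ht1, hz ▸ ht2⟩
  set κ : ℂ := (2 * Real.pi * Complex.I : ℂ)⁻¹ with hκ
  let I : ℝ → ℂ → V := fun t z => κ • ∮ ζ in C(0, t), (ζ - z)⁻¹ • f ζ
  have hI : ∀ t, 0 < t → r < t → t < 1 → DifferentiableOn ℂ (I t) (Metric.sphere 0 t)ᶜ :=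
    fun t ht0 ht1 ht2 => (differentiableOn_cauchyIntegral ht0 (hc t ht1 ht2)).const_smul κ
  have hsplit : ∀ q, ρ < ‖q‖ → ‖q‖ < ρ' → I ρ' q - I ρ q = f q := by
    intro q hq1 hq2
    simp only [I, ← smul_sub]
    rw [annulus_cauchy hf h0 h1 hρ2 hq1 hq2, smul_smul, inv_mul_cancel₀ Complex.two_pi_I_ne_zero,
      one_smul]
  have hb : DifferentiableOn ℂ (fun z => -I ρ z) {z | ρ < ‖z‖} :=
    ((hI ρ h0 h1 h2).mono fun z hz h => by
      rw [mem_sphere_zero_iff_norm] at h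
      exact absurd (show ρ < ‖z‖ from hz) (by rw [h]; exact lt_irrefl _)).neg
  -- The two formulas for the regular part agree for `ρ < ‖q‖ < ρ'`, by Cauchy's formula.
  refine ⟨fun q => if ‖q‖ < ρ' then I ρ' q else f q + I ρ q, fun z => -I ρ z, ?_, hb, ?_, ?_⟩
  · intro z hz
    rw [mem_ball_zero_iff] at hz
    refine DifferentiableAt.differentiableWithinAt ?_
    by_cases hz' : ‖z‖ < ρ'
    · have hd : DifferentiableAt ℂ (I ρ') z :=
        (hI ρ' (h0.trans hρ1) (h1.trans hρ1) hρ2).differentiableAt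
          (Metric.isClosed_sphere.isOpen_compl.mem_nhds fun h =>
            hz'.ne (mem_sphere_zero_iff_norm.1 h))
      refine hd.congr_of_eventuallyEq ?_
      filter_upwards [(isOpen_lt continuous_norm continuous_const).mem_nhds hz'] with u hu
      exact if_pos hu
    · rw [not_lt] at hz'
      have hz1 : ρ < ‖z‖ := hρ1.trans_le hz'
      have hd : DifferentiableAt ℂ (fun q => f q + I ρ q) z := by
        refine (hf.differentiableAt ((isOpen_annulus r 1).mem_nhds ⟨h1.trans hz1, hz⟩)).add ?_
        have := hb.differentiableAt ((isOpen_lt continuous_const continuous_norm).mem_nhds hz1)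
        simpa using this.neg
      refine hd.congr_of_eventuallyEq ?_
      filter_upwards [(isOpen_lt continuous_const continuous_norm).mem_nhds hz1] with u hu
      split_ifs with h
      · rw [← hsplit u hu h]
        abel
      · rfl
  · intro q hq1 hq2
    simp only
    split_ifs with h
    · rw [← hsplit q hq1 h]
      abel
    · abel
  · obtain ⟨C, hC⟩ := (isCompact_sphere (0 : ℂ) ρ).exists_bound_of_continuousOn (hc ρ h1 h2)
    refine squeeze_zero_norm' (a := fun z => ‖κ‖ * (2 * Real.pi * ρ * ((‖z‖ - ρ)⁻¹ * C))) ?_ ?_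
    · filter_upwards [tendsto_norm_cobounded_atTop.eventually_gt_atTop ρ] with z hz
      rw [norm_neg, norm_smul]
      gcongr
      refine circleIntegral.norm_integral_le_of_norm_le_const h0.le fun ζ hζ => ?_
      rw [norm_smul, norm_inv]
      have h3 := hC ζ hζ
      have h4 : ‖z‖ - ρ ≤ ‖ζ - z‖ := by
        have := norm_sub_norm_le z ζ
        rw [mem_sphere_zero_iff_norm.1 hζ, norm_sub_rev] at this
        exact this
      have h5 : 0 < ‖z‖ - ρ := sub_pos.2 hz
      gcongr
    · have h3 : Tendsto (fun z : ℂ => (‖z‖ - ρ)⁻¹) (Bornology.cobounded ℂ) (𝓝 0) :=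
        tendsto_inv_atTop_zero.comp
          (tendsto_atTop_add_const_right _ (-ρ) tendsto_norm_cobounded_atTop)
      have := ((h3.mul_const C).const_mul (2 * Real.pi * ρ)).const_mul ‖κ‖
      simpa using this

end Laurent

/-! ### Periodic functions and the translation Cousin problem -/

section Periodic

open Function.Periodic

theorem comp_invQParam_qParam {W : Type*} {h : ℝ} (hh : h ≠ 0) {φ : ℂ → W}
    (hφ : Function.Periodic φ h)
    (z : ℂ) : φ (invQParam h (qParam h z)) = φ z := by
  obtain ⟨m, hm⟩ := qParam_left_inv_mod_period hh z
  rw [hm]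
  exact hφ.int_mul m z

variable {V : Type*} [NormedAddCommGroup V] [NormedSpace ℂ V]

/-- A periodic function is holomorphic as a function of `q = e^{2πiz/h}`. The branch cut of
`invQParam` does no harm: by periodicity it can be replaced by a local inverse of `qParam`. -/
theorem differentiableAt_comp_invQParam {h : ℝ} (hh : h ≠ 0) {φ : ℂ → V}
    (hφ : Function.Periodic φ h) {z : ℂ} (hz : DifferentiableAt ℂ φ z) :
    DifferentiableAt ℂ (fun q => φ (invQParam h q)) (qParam h z) := by
  let q := qParam h z
  have qdiff : HasStrictDerivAt (qParam h) (q * (2 * Real.pi * Complex.I / h)) z := by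
    simpa only [id_eq, mul_one] using! (((hasStrictDerivAt_id z).const_mul _).div_const _).cexp
  have diff_ne : q * (2 * Real.pi * Complex.I / h) ≠ 0 :=
    mul_ne_zero (Complex.exp_ne_zero _) (div_ne_zero Complex.two_pi_I_ne_zero <| mod_cast hh)
  let L := (qdiff.localInverse (qParam h) _ z) diff_ne
  have diff_L : DifferentiableAt ℂ L q :=
    (qdiff.to_localInverse diff_ne).hasStrictFDerivAt.differentiableAt
  have hL : qParam h ∘ L =ᶠ[𝓝 q] (id : ℂ → ℂ) :=
    (qdiff.hasStrictFDerivAt_equiv diff_ne).eventually_right_inverse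
  have hF : (fun q => φ (invQParam h q)) =ᶠ[𝓝 q] φ ∘ L := by
    filter_upwards [hL] with u hu
    rw [Function.comp_apply, ← comp_invQParam_qParam hh hφ (L u)]
    exact congrArg (fun q => φ (invQParam h q)) hu.symm
  rw [← EventuallyEq.eq_of_nhds (qdiff.hasStrictFDerivAt_equiv diff_ne).eventually_left_inverse]
    at hz
  exact (hz.comp q diff_L).congr_of_eventuallyEq hF

theorem lt_norm_qParam_iff {h : ℝ} (hh : 0 < h) (A : ℝ) (z : ℂ) :
    Real.exp (-2 * Real.pi * A / h) < ‖qParam h z‖ ↔ z.im < A := by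
  rw [norm_qParam, Real.exp_lt_exp, div_lt_div_iff_of_pos_right hh, mul_lt_mul_left_of_neg]
  simpa using Real.pi_pos

theorem qParam_add_period {h : ℝ} (hh : h ≠ 0) (z : ℂ) : qParam h (z + h) = qParam h z := by
  have hh' : (h : ℂ) ≠ 0 := by exact_mod_cast hh
  rw [qParam, qParam, mul_add, add_div, mul_div_cancel_right₀ _ hh', Complex.exp_add,
    Complex.exp_two_pi_mul_I, mul_one]

theorem qParam_tendsto_cobounded {h : ℝ} (hh : 0 < h) :
    Tendsto (qParam h) atLower (Bornology.cobounded ℂ) := by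
  rw [← tendsto_norm_atTop_iff_cobounded]
  simp only [norm_qParam]
  refine Real.tendsto_exp_atTop.comp (Tendsto.atTop_div_const hh ?_)
  exact tendsto_comap.const_mul_atBot_of_neg (by simpa using Real.pi_pos)

/-- A periodic holomorphic function on a horizontal strip `0 < Im z < ε` is the sum of a periodic
function on the upper half-plane and one on a lower half-plane `Im z < ε'`, with limits at the
respective ends, by Laurent splitting in the coordinate `q = e^{2πiz/h}`. -/
theorem exists_periodic_splitting [CompleteSpace V] {h ε ε' : ℝ} (hh : 0 < h) (hε' : 0 < ε')
    (hε : ε' < ε) {φ : ℂ → V} (hd : DifferentiableOn ℂ φ {z | 0 < z.im ∧ z.im < ε})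
    (hφ : ∀ z : ℂ, 0 < z.im → z.im < ε → φ (z + h) = φ z) :
    ∃ a b : ℂ → V, DifferentiableOn ℂ a {z | 0 < z.im} ∧ DifferentiableOn ℂ b {z | z.im < ε'} ∧
      (∀ z : ℂ, 0 < z.im → z.im < ε' → φ z = a z + b z) ∧
      Function.Periodic a h ∧ Function.Periodic b h ∧
      (∃ v, Tendsto a atUpper (𝓝 v)) ∧ Tendsto b atLower (𝓝 0) := by
  classical
  -- Extension by `0` outside the strip makes periodicity hold everywhere.
  set φ' : ℂ → V := fun z => if 0 < z.im ∧ z.im < ε then φ z else 0 with hφ'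
  have hper : Function.Periodic φ' h := by
    intro z
    simp only [hφ', Complex.add_im, Complex.ofReal_im, add_zero]
    split_ifs with h1
    · exact hφ z h1.1 h1.2
    · rfl
  have hopen : IsOpen {z : ℂ | 0 < z.im ∧ z.im < ε} :=
    (isOpen_lt continuous_const Complex.continuous_im).inter
      (isOpen_lt Complex.continuous_im continuous_const)
  set E : ℝ → ℝ := fun A => Real.exp (-2 * Real.pi * A / h) with hE
  have hE0 : E 0 = 1 := by simp [hE]
  have hEanti : ∀ A B, A < B → E B < E A := by
    intro A B hAB
    simp only [hE]
    rw [Real.exp_lt_exp, div_lt_div_iff_of_pos_right hh]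
    nlinarith [Real.pi_pos]
  have hΦ : DifferentiableOn ℂ (fun q => φ' (invQParam h q)) {q | E ε < ‖q‖ ∧ ‖q‖ < 1} := by
    intro q hq
    have hq0 : q ≠ 0 := by
      rintro rfl
      have h1 : E ε < ‖(0 : ℂ)‖ := hq.1
      rw [norm_zero] at h1
      exact absurd h1 (Real.exp_pos _).le.not_gt
    have hqq : qParam h (invQParam h q) = q := qParam_right_inv hh.ne' hq0
    rw [← hqq] at hq ⊢
    refine (differentiableAt_comp_invQParam hh.ne' hper ?_).differentiableWithinAt
    have hmem : invQParam h q ∈ {z : ℂ | 0 < z.im ∧ z.im < ε} := by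
      refine ⟨?_, (lt_norm_qParam_iff hh _ _).1 hq.1⟩
      rw [← norm_qParam_lt_iff hh]
      exact lt_of_lt_of_eq hq.2 hE0.symm
    refine (hd.differentiableAt (hopen.mem_nhds hmem)).congr_of_eventuallyEq ?_
    filter_upwards [hopen.mem_nhds hmem] with u hu
    exact if_pos hu
  obtain ⟨a, b, ha, hb, hab, hlim⟩ := exists_laurent_splitting hΦ (Real.exp_pos _)
    (hEanti _ _ hε) (hE0 ▸ hEanti _ _ hε')
  refine ⟨fun z => a (qParam h z), fun z => b (qParam h z), ?_, ?_, ?_, ?_, ?_, ?_, ?_⟩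
  · refine ha.comp differentiable_qParam.differentiableOn fun z hz => ?_
    rw [mem_ball_zero_iff]
    exact norm_qParam_lt_one hh hz
  · exact hb.comp differentiable_qParam.differentiableOn fun z hz =>
      (lt_norm_qParam_iff hh _ _).2 hz
  · intro z hz1 hz2
    have := hab (qParam h z) ((lt_norm_qParam_iff hh _ _).2 hz2) (norm_qParam_lt_one hh hz1)
    rw [comp_invQParam_qParam hh.ne' hper] at this
    rw [← this]
    exact (if_pos ⟨hz1, hz2.trans hε⟩).symm
  · intro z
    simp only [qParam_add_period hh.ne']
  · intro z
    simp only [qParam_add_period hh.ne']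
  · refine ⟨a 0, ?_⟩
    have hc : ContinuousAt a 0 :=
      (ha.differentiableAt (Metric.ball_mem_nhds 0 one_pos)).continuousAt
    exact hc.tendsto.comp ((qParam_tendsto hh).mono_right nhdsWithin_le_nhds)
  · exact hlim.comp (qParam_tendsto_cobounded hh)

end Periodic

section Cohomological

variable {V : Type*} [NormedAddCommGroup V] [NormedSpace ℂ V]

theorem isOpen_strip (ε : ℝ) : IsOpen {z : ℂ | |z.im| < ε} :=
  isOpen_lt (continuous_abs.comp Complex.continuous_im) continuous_const

/-- Solution of `g(z) - B g(z - 1) = k(z)` on a strip, for a function `k` that decays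
as `Re z → -∞`, as the sum of the functions `Bⁿ k(z - n)`. -/
theorem exists_sub_comp_shift_eq_of_decay [CompleteSpace V] {ε C K : ℝ} {k : ℂ → V} {B : V →L[ℂ] V}
    (hk : DifferentiableOn ℂ k {z | |z.im| < ε}) (hB : ∀ n : ℕ, ‖B ^ n‖ ≤ K)
    (hC : ∀ z : ℂ, |z.im| < ε → ‖k z‖ ≤ C * Real.exp (z.re + |z.re| / 2)) :
    ∃ g : ℂ → V, DifferentiableOn ℂ g {z | |z.im| < ε} ∧
      ∀ z : ℂ, |z.im| < ε → g z - B (g (z - 1)) = k z := by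
  have hK : 0 ≤ K := (norm_nonneg _).trans (hB 0)
  have hbound : ∀ (n : ℕ) (z : ℂ), |z.im| < ε → ‖(B ^ n) (k (z - n))‖ ≤
      K * (|C| * Real.exp (2 * |z.re|)) * Real.exp (-1 / 2) ^ n := by
    intro n z hz
    have h1 : ‖k (z - n)‖ ≤ |C| * Real.exp (2 * |z.re|) * Real.exp (-1 / 2) ^ n := by
      refine (hC (z - n) (by simpa using hz)).trans ?_
      rw [mul_assoc, ← Real.exp_nat_mul, ← Real.exp_add]
      have h2 : (z - n).re = z.re - n := by simp
      rw [h2]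
      have h3 : |z.re - n| ≤ |z.re| + n := by
        refine (abs_sub _ _).trans ?_
        rw [Nat.abs_cast]
      have h4 : z.re - n + |z.re - n| / 2 ≤ 2 * |z.re| + n * (-1 / 2) := by
        have := le_abs_self z.re
        have := abs_nonneg z.re
        linarith
      exact mul_le_mul (le_abs_self C) (Real.exp_le_exp.2 h4) (Real.exp_pos _).le (abs_nonneg C)
    calc ‖(B ^ n) (k (z - n))‖ ≤ ‖B ^ n‖ * ‖k (z - n)‖ := (B ^ n).le_opNorm _
      _ ≤ K * (|C| * Real.exp (2 * |z.re|) * Real.exp (-1 / 2) ^ n) := by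
        gcongr
        exact hB n
      _ = _ := by ring
  have hgeom : Summable fun n : ℕ => Real.exp (-1 / 2) ^ n :=
    summable_geometric_of_lt_one (Real.exp_pos _).le (by rw [Real.exp_lt_one_iff]; norm_num)
  have hsum : ∀ z : ℂ, |z.im| < ε → Summable fun n : ℕ => (B ^ n) (k (z - n)) := fun z hz =>
    Summable.of_norm_bounded (hgeom.mul_left _) fun n => hbound n z hz
  refine ⟨fun z => ∑' n : ℕ, (B ^ n) (k (z - n)), ?_, ?_⟩
  · intro z hz
    -- The series converges uniformly on the rectangle `|Re w| < R` only.
    set R := |z.re| + 1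
    have hopen : IsOpen {w : ℂ | |w.im| < ε ∧ |w.re| < R} :=
      (isOpen_strip ε).inter
        (isOpen_lt (continuous_abs.comp Complex.continuous_re) continuous_const)
    have hd : DifferentiableOn ℂ (fun z => ∑' n : ℕ, (B ^ n) (k (z - n)))
        {w : ℂ | |w.im| < ε ∧ |w.re| < R} := by
      refine Complex.differentiableOn_tsum_of_summable_norm
        (u := fun n : ℕ => K * (|C| * Real.exp (2 * R)) * Real.exp (-1 / 2) ^ n)
        (hgeom.mul_left _) (fun n => ?_) hopen fun n w hw => ?_
      · refine (B ^ n).differentiable.comp_differentiableOn ?_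
        exact hk.comp (by fun_prop) fun w hw => by simpa using hw.1
      · refine (hbound n w hw.1).trans ?_
        have := hw.2.le
        gcongr
    exact (hd.differentiableAt
      (hopen.mem_nhds ⟨hz, by simp [R]⟩)).differentiableWithinAt
  · intro z hz
    have h1 := (hsum z hz).tsum_eq_zero_add
    have h2 : B (∑' n : ℕ, (B ^ n) (k (z - 1 - n))) =
        ∑' n : ℕ, (B ^ (n + 1)) (k (z - (n + 1 : ℕ))) := by
      rw [B.map_tsum (hsum (z - 1) (by simpa using hz))]
      refine tsum_congr fun n => ?_
      rw [pow_succ', mul_apply_eq_comp]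
      congr 3
      push_cast
      ring
    simp only
    rw [h1, h2]
    simp

/-- The holomorphic cutoff function `1 / (1 + e^{-z})`, which tends to `1` to the right and decays
like `e^z` to the left; its poles do not lie in the strip `|Im z| < 1`. -/
def cutoff (z : ℂ) : ℂ := (1 + Complex.exp (-z))⁻¹

theorem re_exp_neg_pos {z : ℂ} (hz : |z.im| < 1) : 0 < (Complex.exp (-z)).re := by
  rw [Complex.exp_re, Complex.neg_im, Real.cos_neg]
  have h := abs_lt.1 hz
  have := Real.pi_gt_three
  exact mul_pos (Real.exp_pos _) (Real.cos_pos_of_mem_Ioo ⟨by linarith, by linarith⟩)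

theorem one_add_exp_neg_ne_zero {z : ℂ} (hz : |z.im| < 1) : 1 + Complex.exp (-z) ≠ 0 := by
  intro h
  have := congrArg Complex.re h
  have h1 := re_exp_neg_pos hz
  simp only [Complex.add_re, Complex.one_re, Complex.zero_re] at this
  linarith

theorem norm_cutoff_le {z : ℂ} (hz : |z.im| < 1) : ‖cutoff z‖ ≤ Real.exp z.re := by
  have h1 := re_exp_neg_pos hz
  have h2 : Real.exp (-z.re) ≤ ‖1 + Complex.exp (-z)‖ := by
    have h3 : Real.exp (-z.re) = ‖Complex.exp (-z)‖ := by rw [Complex.norm_exp, Complex.neg_re]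
    rw [h3, Complex.norm_def, Complex.norm_def]
    apply Real.sqrt_le_sqrt
    rw [Complex.normSq_apply, Complex.normSq_apply]
    simp only [Complex.add_re, Complex.one_re, Complex.add_im, Complex.one_im, zero_add]
    nlinarith
  rw [cutoff, norm_inv, ← neg_neg z.re, Real.exp_neg (-z.re)]
  exact inv_anti₀ (Real.exp_pos _) h2

theorem differentiableOn_cutoff : DifferentiableOn ℂ cutoff {z | |z.im| < 1} := by
  intro z hz
  have := one_add_exp_neg_ne_zero hz
  unfold cutoff
  fun_prop (disch := exact this)

theorem cutoff_add_cutoff_neg {z : ℂ} (hz : |z.im| < 1) : cutoff z + cutoff (-z) = 1 := by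
  have h1 := one_add_exp_neg_ne_zero hz
  have h2 := one_add_exp_neg_ne_zero (z := -z) (by simpa using hz)
  rw [neg_neg] at h2
  rw [cutoff, cutoff, neg_neg]
  have h3 : Complex.exp (-z) * Complex.exp z = 1 := by rw [← Complex.exp_add]; simp
  field_simp
  linear_combination -h3

/-- Solution of the cohomological equation `g(z) - A g(z - 1) = h(z)` on a strip, for `h` of
moderate growth and `A` of finite order. The function `h` is split, by means of the cutoff
function, into a part that decays to the left and a part that decays to the right. -/
theorem exists_sub_comp_shift_eq [CompleteSpace V] {ε C : ℝ} (hε : ε ≤ 1) {h : ℂ → V}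
    {A : V →L[ℂ] V} {N : ℕ} (hN : 0 < N) (hA : A ^ N = 1)
    (hh : DifferentiableOn ℂ h {z | |z.im| < ε})
    (hC : ∀ z : ℂ, |z.im| < ε → ‖h z‖ ≤ C * Real.exp (|z.re| / 2)) :
    ∃ g : ℂ → V, DifferentiableOn ℂ g {z | |z.im| < ε} ∧
      ∀ z : ℂ, |z.im| < ε → g z - A (g (z - 1)) = h z := by
  have hpow : ∀ n : ℕ, ‖A ^ n‖ ≤ ∑ i ∈ Finset.range N, ‖A ^ i‖ := by
    intro n
    rw [← Nat.div_add_mod n N, pow_add, pow_mul, hA, one_pow, one_mul]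
    exact Finset.single_le_sum (f := fun i => ‖A ^ i‖) (fun i _ => norm_nonneg _)
      (Finset.mem_range.2 (Nat.mod_lt n hN))
  set B := A ^ (N - 1) with hBdef
  have hAB : A * B = 1 := by rw [hBdef, ← pow_succ', Nat.sub_add_cancel hN, hA]
  have hBpow : ∀ n : ℕ, ‖B ^ n‖ ≤ ∑ i ∈ Finset.range N, ‖A ^ i‖ := by
    intro n
    rw [hBdef, ← pow_mul]
    exact hpow _
  have hc0 : ∀ z : ℂ, |z.im| < ε → |z.im| < 1 := fun z hz => hz.trans_le hε
  have hest : ∀ u z : ℂ, |z.im| < ε → |u.im| < ε → |u.re| = |z.re| →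
      ‖cutoff z • h u‖ ≤ C * Real.exp (z.re + |z.re| / 2) := by
    intro u z hz hu huz
    rw [norm_smul, Real.exp_add]
    calc ‖cutoff z‖ * ‖h u‖ ≤ Real.exp z.re * (C * Real.exp (|z.re| / 2)) := by
          gcongr
          · exact norm_cutoff_le (hc0 z hz)
          · exact huz ▸ hC u hu
      _ = _ := by ring
  have hneg : ∀ z : ℂ, |z.im| < ε → |(-z).im| < ε := fun z hz => by simpa using hz
  -- The part that decays to the right is treated by means of the reflection `z ↦ -z`, which turns
  -- `A` into `B = A⁻¹`.
  obtain ⟨g₁, hg1, hg1'⟩ := exists_sub_comp_shift_eq_of_decay (k := fun z => cutoff z • h z)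
    ((differentiableOn_cutoff.mono hc0).smul hh) hpow fun z hz => hest z z hz hz rfl
  obtain ⟨g₂, hg2, hg2'⟩ := exists_sub_comp_shift_eq_of_decay (k := fun z => cutoff z • h (-z))
    ((differentiableOn_cutoff.mono hc0).smul (hh.comp differentiable_neg.differentiableOn hneg))
    hBpow fun z hz => hest (-z) z hz (hneg z hz) (by simp)
  refine ⟨fun z => g₁ z - B (g₂ (-z - 1)), ?_, ?_⟩
  · refine hg1.sub (B.differentiable.comp_differentiableOn ?_)
    exact hg2.comp (by fun_prop) fun z hz => by simpa using hz
  · intro z hz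
    have h1 := hg1' z hz
    have h2 := hg2' (-z) (hneg z hz)
    have h3 : A (B (g₂ (-(z - 1) - 1))) = g₂ (-z) := by
      rw [← mul_apply_eq_comp, hAB, one_apply_eq_self]
      congr 1
      ring
    simp only [map_sub]
    rw [h3]
    have h4 : h z = cutoff z • h z + cutoff (-z) • h (- -z) := by
      rw [neg_neg, ← add_smul, cutoff_add_cutoff_neg (hc0 z hz), one_smul]
    rw [h4, ← h1, ← h2]
    abel

end Cohomological

/-! ### Equivariant representatives -/

section PeriodicRepresentative

instance atUpper_neBot : atUpper.NeBot :=
  NeBot.comap_of_surj inferInstance fun y => ⟨y * Complex.I, by simp⟩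

instance atLower_neBot : atLower.NeBot :=
  NeBot.comap_of_surj inferInstance fun y => ⟨y * Complex.I, by simp⟩

theorem tendsto_add_atUpper {c : ℂ} (hc : c.im = 0) : Tendsto (fun z => z + c) atUpper atUpper := by
  refine tendsto_comap_iff.2 ?_
  simpa [Function.comp_def, hc] using! (tendsto_comap (f := Complex.im) (x := atTop))

theorem tendsto_add_atLower {c : ℂ} (hc : c.im = 0) : Tendsto (fun z => z + c) atLower atLower := by
  refine tendsto_comap_iff.2 ?_
  simpa [Function.comp_def, hc] using! (tendsto_comap (f := Complex.im) (x := atBot))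

theorem tendsto_neg_atUpper : Tendsto (fun z : ℂ => -z) atUpper atLower := by
  refine tendsto_comap_iff.2 ?_
  simpa [Function.comp_def] using! tendsto_neg_atTop_atBot.comp
    (tendsto_comap (f := Complex.im) (x := atTop))

theorem tendsto_neg_atLower : Tendsto (fun z : ℂ => -z) atLower atUpper := by
  refine tendsto_comap_iff.2 ?_
  simpa [Function.comp_def] using! tendsto_neg_atBot_atTop.comp
    (tendsto_comap (f := Complex.im) (x := atBot))

theorem eventually_atUpper (M : ℝ) : ∀ᶠ z in atUpper, M < z.im :=
  tendsto_comap.eventually_gt_atTop M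

theorem eventually_atLower (M : ℝ) : ∀ᶠ z in atLower, z.im < M :=
  tendsto_comap.eventually_lt_atBot M

theorem exists_bound_of_tendsto {V : Type*} [NormedAddCommGroup V] {f : ℂ → V} {v w : V}
    (hv : Tendsto f atUpper (𝓝 v)) (hw : Tendsto f atLower (𝓝 w)) :
    ∃ C M : ℝ, ∀ z : ℂ, M ≤ |z.im| → ‖f z‖ ≤ C := by
  have h1 : ∀ᶠ z in atUpper, ‖f z‖ < ‖v‖ + 1 := hv.norm.eventually_lt_const (by linarith)
  have h2 : ∀ᶠ z in atLower, ‖f z‖ < ‖w‖ + 1 := hw.norm.eventually_lt_const (by linarith)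
  rw [atUpper, eventually_comap, eventually_atTop] at h1
  rw [atLower, eventually_comap, eventually_atBot] at h2
  obtain ⟨M1, h1⟩ := h1
  obtain ⟨M2, h2⟩ := h2
  refine ⟨max (‖v‖ + 1) (‖w‖ + 1), max M1 (-M2), fun z hz => ?_⟩
  rcases le_abs.1 hz with h | h
  · exact (h1 _ ((le_max_left _ _).trans h) z rfl).le.trans (le_max_left _ _)
  · have := (le_max_right M1 (-M2)).trans h
    exact (h2 z.im (by linarith) z rfl).le.trans (le_max_right _ _)

variable {V : Type*} [NormedAddCommGroup V] [NormedSpace ℂ V]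

/-- The average of `F` over the translations `z ↦ z + k` twisted by the operators `B ^ k`. -/
def twistedAverage (N : ℕ) (B : V →L[ℂ] V) (F : ℂ → V) (z : ℂ) : V :=
  (N : ℂ)⁻¹ • ∑ k ∈ Finset.range N, (B ^ k) (F (z + k))

theorem twistedAverage_add_one {N : ℕ} {A B : V →L[ℂ] V} {F : ℂ → V} (hAB : A * B = 1)
    (hB : B ^ N = 1) {z : ℂ} (hF : F (z + N) = F z) :
    twistedAverage N B F (z + 1) = A (twistedAverage N B F z) := by
  have h1 : ∑ k ∈ Finset.range N, (B ^ k) (F (z + k)) =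
      ∑ k ∈ Finset.range N, (B ^ (k + 1)) (F (z + (k + 1 : ℕ))) := by
    have h2 := Finset.sum_range_succ (fun k : ℕ => (B ^ k) (F (z + k))) N
    rw [Finset.sum_range_succ', hF, hB] at h2
    simpa using h2.symm
  rw [twistedAverage, twistedAverage, h1, map_smul, map_sum]
  congr 1
  refine Finset.sum_congr rfl fun k _ => ?_
  rw [← mul_apply_eq_comp, pow_succ', ← mul_assoc, hAB, one_mul]
  congr 2
  push_cast
  ring

theorem tendsto_twistedAverage {N : ℕ} {B : V →L[ℂ] V} {F : ℂ → V} {l : Filter ℂ}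
    (hl : ∀ k : ℕ, Tendsto (fun z => z + (k : ℂ)) l l) {v : V} (hF : Tendsto F l (𝓝 v)) :
    ∃ v', Tendsto (twistedAverage N B F) l (𝓝 v') :=
  ⟨_, (tendsto_finsetSum _ fun k _ =>
    ((B ^ k).continuous.tendsto v).comp (hF.comp (hl k))).const_smul _⟩

theorem twistedAverage_sub (N : ℕ) (B : V →L[ℂ] V) (F G : ℂ → V) (z : ℂ) :
    twistedAverage N B F z - twistedAverage N B G z =
      twistedAverage N B (fun z => F z - G z) z := by
  simp only [twistedAverage, ← smul_sub, ← Finset.sum_sub_distrib, map_sub]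

theorem differentiableOn_twistedAverage {N : ℕ} {B : V →L[ℂ] V} {F : ℂ → V} {s : Set ℂ}
    (hs : ∀ z ∈ s, ∀ k : ℕ, z + k ∈ s) (hF : DifferentiableOn ℂ F s) :
    DifferentiableOn ℂ (twistedAverage N B F) s := by
  refine DifferentiableOn.const_smul (DifferentiableOn.fun_sum fun k _ => ?_) _
  exact (B ^ k).differentiable.comp_differentiableOn
    (hF.comp (by fun_prop) fun z hz => hs z hz k)

theorem differentiableOn_im_ne_zero {f g : ℂ → V} (hf : DifferentiableOn ℂ f {z | 0 < z.im})
    (hg : DifferentiableOn ℂ g {z | z.im < 0}) :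
    DifferentiableOn ℂ (fun z => if 0 < z.im then f z else if z.im < 0 then g z else 0)
      {z | z.im ≠ 0} := by
  intro z hz
  refine DifferentiableAt.differentiableWithinAt ?_
  rcases lt_or_gt_of_ne (show z.im ≠ 0 from hz) with h | h
  · have ho : {z : ℂ | z.im < 0} ∈ 𝓝 z :=
      (isOpen_lt Complex.continuous_im continuous_const).mem_nhds h
    refine (hg.differentiableAt ho).congr_of_eventuallyEq ?_
    filter_upwards [ho] with u hu
    have hu' : u.im < 0 := hu
    rw [if_neg hu'.le.not_gt, if_pos hu']
  · have ho : {z : ℂ | 0 < z.im} ∈ 𝓝 z :=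
      (isOpen_lt continuous_const Complex.continuous_im).mem_nhds h
    refine (hf.differentiableAt ho).congr_of_eventuallyEq ?_
    filter_upwards [ho] with u hu
    exact if_pos hu

/-- A function on `strip ∖ ℝ` which is `N`-periodic differs from a function on `ℂ ∖ ℝ` with limits
at `±i∞` by a function that extends across `ℝ`. With the splittings `f = a + b` above and
`f = a' + b'` (reflected) below the real line, the new function is `a - b'` above and `a' - b`
below, so that the difference is `-b - b'` on both sides. -/
theorem exists_periodic_of_strip [CompleteSpace V] {h ε : ℝ} (hh : 0 < h) (hε : 0 < ε) {f : ℂ → V}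
    (hf : DifferentiableOn ℂ f {z | |z.im| < ε ∧ z.im ≠ 0})
    (hper : ∀ z : ℂ, |z.im| < ε → z.im ≠ 0 → f (z + h) = f z) :
    ∃ F : ℂ → V, DifferentiableOn ℂ F {z | z.im ≠ 0} ∧ (∀ z, F (z + h) = F z) ∧
      (∃ v, Tendsto F atUpper (𝓝 v)) ∧ (∃ w, Tendsto F atLower (𝓝 w)) ∧
      ∃ k : ℂ → V, DifferentiableOn ℂ k {z | |z.im| < ε / 2} ∧
        ∀ z : ℂ, |z.im| < ε / 2 → z.im ≠ 0 → F z - f z = k z := by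
  have hε2 : ε / 2 < ε := half_lt_self hε
  obtain ⟨a, b, ha, hb, hab, hpa, hpb, ⟨v, hv⟩, hb0⟩ := exists_periodic_splitting hh (half_pos hε)
    hε2 (φ := f)
    (hf.mono fun z hz => ⟨abs_lt.2 ⟨by linarith [hz.1], hz.2⟩, ne_of_gt hz.1⟩)
    fun z h1 h2 => hper z (abs_lt.2 ⟨by linarith, h2⟩) h1.ne'
  obtain ⟨a', b', ha', hb', hab', hpa', hpb', ⟨w, hw⟩, hb0'⟩ :=
    exists_periodic_splitting hh (half_pos hε) hε2 (φ := fun z => f (-z))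
    (hf.comp differentiable_neg.differentiableOn fun z hz => ⟨by
      rw [Complex.neg_im, abs_neg]
      exact abs_lt.2 ⟨by linarith [hz.1], hz.2⟩, by
      simpa using ne_of_gt hz.1⟩)
    (fun z h1 h2 => by
      have h3 : |z.im| < ε := abs_lt.2 ⟨by linarith, h2⟩
      have := hper (-(z + h)) (by simpa using h3) (by simpa using h1.ne')
      rw [← this]
      congr 1
      ring)
  refine ⟨fun z => if 0 < z.im then a z - b' (-z) else if z.im < 0 then a' (-z) - b z else 0,
    ?_, ?_, ⟨v, ?_⟩, ⟨w, ?_⟩, fun z => -b z - b' (-z), ?_, ?_⟩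
  · refine differentiableOn_im_ne_zero ?_ ?_
    · refine ha.sub (hb'.comp differentiable_neg.differentiableOn fun z hz => ?_)
      have : 0 < z.im := hz
      simp only [Set.mem_ofPred_eq, Complex.neg_im]
      linarith
    · refine DifferentiableOn.sub (ha'.comp differentiable_neg.differentiableOn fun z hz => ?_)
        (hb.mono fun z hz => ?_)
      · have : z.im < 0 := hz
        simpa using this
      · exact (show z.im < 0 from hz).trans (half_pos hε)
  · intro z
    have e1 := hpa z
    have e2 := hpb z
    have e3 := hpa' (-(z + h))
    have e4 := hpb' (-(z + h))
    have e5 : -(z + h) + h = -z := by ring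
    rw [e5] at e3 e4
    simp only [Complex.add_im, Complex.ofReal_im, add_zero]
    rw [e1, e2, e3, e4]
  · have h1 : Tendsto (fun z => a z - b' (-z)) atUpper (𝓝 (v - 0)) :=
      hv.sub (hb0'.comp tendsto_neg_atUpper)
    rw [sub_zero] at h1
    refine h1.congr' ?_
    filter_upwards [eventually_atUpper 0] with z hz
    exact (if_pos hz).symm
  · have h1 : Tendsto (fun z => a' (-z) - b z) atLower (𝓝 (w - 0)) :=
      (hw.comp tendsto_neg_atLower).sub hb0
    rw [sub_zero] at h1
    refine h1.congr' ?_
    filter_upwards [eventually_atLower 0] with z hz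
    rw [if_neg hz.le.not_gt, if_pos hz]
  · have hsub : ∀ z : ℂ, z ∈ {z : ℂ | |z.im| < ε / 2} → -(ε / 2) < z.im ∧ z.im < ε / 2 :=
      fun z hz => abs_lt.1 hz
    refine DifferentiableOn.sub (hb.mono fun z hz => (hsub z hz).2).neg
      (hb'.comp differentiable_neg.differentiableOn fun z hz => ?_)
    have := (hsub z hz).1
    simp only [Set.mem_ofPred_eq, Complex.neg_im]
    linarith
  · intro z hz hz0
    rcases lt_or_gt_of_ne hz0 with h1 | h1
    · have := hab' (-z) (by simpa using h1) (by simpa using neg_lt.1 (abs_lt.1 hz).1)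
      rw [neg_neg] at this
      simp only
      rw [if_neg h1.le.not_gt, if_pos h1, this]
      abel
    · have := hab z h1 (abs_lt.1 hz).2
      simp only
      rw [if_pos h1, this]
      abel

/-- A function on `strip ∖ ℝ` for which `f₀(z) - A f₀(z - 1)` extends holomorphically across `ℝ`,
with moderate growth, differs by a function that extends across `ℝ` from a holomorphic function `f`
on all of `ℂ ∖ ℝ` with `f(z + 1) = A f(z)` and opposite limits at `±i∞`. -/
theorem exists_equivariant_representative [CompleteSpace V] {ε C : ℝ} (hε0 : 0 < ε) (hε : ε ≤ 1)
    {f₀ h : ℂ → V} {A : V →L[ℂ] V} {N : ℕ} (hN : 0 < N) (hA : A ^ N = 1)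
    (hf₀ : DifferentiableOn ℂ f₀ {z | |z.im| < ε ∧ z.im ≠ 0})
    (hh : DifferentiableOn ℂ h {z | |z.im| < ε})
    (hC : ∀ z : ℂ, |z.im| < ε → ‖h z‖ ≤ C * Real.exp (|z.re| / 2))
    (hrel : ∀ z : ℂ, |z.im| < ε → z.im ≠ 0 → f₀ z - A (f₀ (z - 1)) = h z) :
    ∃ f : ℂ → V, (∀ z : ℂ, z.im = 0 → f z = 0) ∧ DifferentiableOn ℂ f {z | z.im ≠ 0} ∧
      (∀ z : ℂ, z.im ≠ 0 → f (z + 1) = A (f z)) ∧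
      (∃ v w : V, Tendsto f atUpper (𝓝 v) ∧ Tendsto f atLower (𝓝 w) ∧ v + w = 0) ∧
      ∃ k : ℂ → V, DifferentiableOn ℂ k {z | |z.im| < ε / 2} ∧
        ∀ z : ℂ, |z.im| < ε / 2 → z.im ≠ 0 → f z - f₀ z = k z := by
  obtain ⟨g, hg, hgrel⟩ := exists_sub_comp_shift_eq hε hN hA hh hC
  -- After this correction the function is exactly equivariant in the strip.
  set f₁ : ℂ → V := fun z => f₀ z - g z with hf₁
  have hf1d : DifferentiableOn ℂ f₁ {z | |z.im| < ε ∧ z.im ≠ 0} :=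
    hf₀.sub (hg.mono fun z hz => hz.1)
  have hshift : ∀ (n : ℕ) (z : ℂ), |z.im| < ε → z.im ≠ 0 → f₁ (z + n) = (A ^ n) (f₁ z) := by
    intro n
    induction n with
    | zero => intro z _ _; simp
    | succ n ih =>
      intro z hz hz0
      have h1 : |(z + (n + 1 : ℕ)).im| < ε := by simpa using hz
      have h2 : (z + (n + 1 : ℕ)).im ≠ 0 := by simpa using hz0
      have h3 : z + (n + 1 : ℕ) - 1 = z + n := by push_cast; ring
      have h4 := hrel _ h1 h2
      have h5 := hgrel _ h1
      rw [h3] at h4 h5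
      rw [pow_succ', mul_apply_eq_comp, ← ih z hz hz0]
      simp only [hf₁, map_sub]
      rw [← h5] at h4
      exact sub_eq_sub_iff_sub_eq_sub.2 h4
  set B := A ^ (N - 1) with hBdef
  have hAB : A * B = 1 := by rw [hBdef, ← pow_succ', Nat.sub_add_cancel hN, hA]
  have hBA : B * A = 1 := by rw [hBdef, ← pow_succ, Nat.sub_add_cancel hN, hA]
  have hBN : B ^ N = 1 := by rw [hBdef, ← pow_mul, mul_comm, pow_mul, hA, one_pow]
  have hcomm : Commute B A := by rw [Commute, SemiconjBy, hAB, hBA]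
  have hN' : (N : ℂ) ≠ 0 := by exact_mod_cast hN.ne'
  obtain ⟨F, hF, hFper, ⟨v₀, hv₀⟩, ⟨w₀, hw₀⟩, k, hk, hkF⟩ :=
    exists_periodic_of_strip (h := N) (by exact_mod_cast hN) hε0 hf1d (fun z hz hz0 => by
      have := hshift N z hz hz0
      rw [hA, one_apply_eq_self] at this
      simpa using this)
  simp only [Complex.ofReal_natCast] at hFper
  -- The passage from `f₁` to `F` retains periodicity only; averaging restores equivariance, and it
  -- does not change `f₁`.
  set G := twistedAverage N B F with hG
  obtain ⟨v, hv⟩ := tendsto_twistedAverage (N := N) (B := B)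
    (fun k => tendsto_add_atUpper (Complex.natCast_im k)) hv₀
  obtain ⟨w, hw⟩ := tendsto_twistedAverage (N := N) (B := B)
    (fun k => tendsto_add_atLower (Complex.natCast_im k)) hw₀
  have hGadd : ∀ z, G (z + 1) = A (G z) := fun z => twistedAverage_add_one hAB hBN (hFper z)
  have hAv : A v = v := tendsto_nhds_unique ((A.continuous.tendsto v).comp hv)
    ((hv.comp (tendsto_add_atUpper Complex.one_im)).congr hGadd)
  have hAw : A w = w := tendsto_nhds_unique ((A.continuous.tendsto w).comp hw)
    ((hw.comp (tendsto_add_atLower Complex.one_im)).congr hGadd)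
  -- The constant is fixed by `A`, and subtracting it makes the limits at `±i∞` opposite.
  set c : V := (2 : ℂ)⁻¹ • (v + w) with hc
  have hAc : A c = c := by rw [hc, map_smul, map_add, hAv, hAw]
  have hGd : DifferentiableOn ℂ G {z | z.im ≠ 0} :=
    differentiableOn_twistedAverage (fun z hz k => by simpa using hz) hF
  have hff : ∀ z : ℂ, z.im ≠ 0 → (if z.im = 0 then (0 : V) else G z - c) = G z - c :=
    fun z hz => if_neg hz
  refine ⟨fun z => if z.im = 0 then 0 else G z - c, fun z hz => if_pos hz,
    (hGd.sub_const c).congr hff, ?_, ⟨v - c, w - c, ?_, ?_, ?_⟩,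
    fun z => twistedAverage N B k z - c - g z, ?_, ?_⟩
  · intro z hz
    have hz' : (z + 1).im ≠ 0 := by simpa using hz
    simp only
    rw [hff z hz, hff _ hz', hGadd, map_sub, hAc]
  · refine (hv.sub_const c).congr' ?_
    filter_upwards [eventually_atUpper 0] with z hz using (hff z hz.ne').symm
  · refine (hw.sub_const c).congr' ?_
    filter_upwards [eventually_atLower 0] with z hz using (hff z hz.ne).symm
  · have : c + c = v + w := by rw [hc, ← two_smul ℂ, smul_smul]; norm_num
    rw [sub_add_sub_comm, this, sub_self]
  · refine DifferentiableOn.sub (DifferentiableOn.sub_const ?_ c)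
      (hg.mono fun z hz => (show |z.im| < ε / 2 from hz).trans (half_lt_self hε0))
    exact differentiableOn_twistedAverage (fun z hz k => by simpa using hz) hk
  · intro z hz hz0
    have hz1 : |z.im| < ε := hz.trans (half_lt_self hε0)
    have h1 : twistedAverage N B f₁ z = f₁ z := by
      rw [twistedAverage, Finset.sum_congr rfl (g := fun _ => f₁ z), Finset.sum_const,
        Finset.card_range, ← Nat.cast_smul_eq_nsmul ℂ, smul_smul, inv_mul_cancel₀ hN', one_smul]
      intro j _
      rw [hshift j z hz1 hz0, ← mul_apply_eq_comp, ← hcomm.mul_pow, hBA, one_pow,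
        one_apply_eq_self]
    have h2 : twistedAverage N B k z = G z - f₁ z := by
      conv_rhs => rw [← h1]
      rw [hG, twistedAverage_sub, twistedAverage, twistedAverage]
      congr 1
      refine Finset.sum_congr rfl fun j _ => ?_
      rw [hkF (z + j) (by simpa using hz) (by simpa using hz0)]
    simp only
    rw [hff z hz0, h2]
    simp only [hf₁]
    abel

end PeriodicRepresentative

/-! ### Germs on the real projective line -/

section Germs

theorem coe_mem_realLine {z : ℂ} : (z : OnePoint ℂ) ∈ realLine ↔ z.im = 0 := by
  constructor
  · rintro ⟨p, hp⟩
    induction p with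
    | infty => simp at hp
    | coe x =>
      rw [OnePoint.map_some, OnePoint.coe_eq_coe] at hp
      rw [← hp, Complex.ofReal_im]
  · intro h
    refine ⟨(z.re : ℝ), ?_⟩
    rw [OnePoint.map_some, OnePoint.coe_eq_coe]
    exact Complex.ext (by simp) (by simp [h])

theorem infty_mem_realLine : (∞ : OnePoint ℂ) ∈ realLine := ⟨∞, by simp⟩

theorem invChart_zero : invChart 0 = ∞ := by simp [invChart]

theorem invChart_of_ne {w : ℂ} (hw : w ≠ 0) : invChart w = ((w⁻¹ : ℂ) : OnePoint ℂ) := by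
  simp [invChart, hw]

theorem coe_eq_invChart {z : ℂ} (hz : z ≠ 0) : (z : OnePoint ℂ) = invChart z⁻¹ := by
  rw [invChart_of_ne (inv_ne_zero hz), inv_inv]

theorem exists_chart (p : OnePoint ℂ) : (∃ z : ℂ, p = z) ∨ p = invChart 0 := by
  induction p with
  | infty => exact Or.inr invChart_zero.symm
  | coe z => exact Or.inl ⟨z, rfl⟩

theorem invChart_mem_realLine {w : ℂ} : invChart w ∈ realLine ↔ w.im = 0 := by
  by_cases hw : w = 0
  · subst hw
    simp [invChart_zero, infty_mem_realLine]
  · rw [invChart_of_ne hw, coe_mem_realLine, Complex.inv_im, div_eq_zero_iff, neg_eq_zero,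
      Complex.normSq_eq_zero]
    simp [hw]

/-- The complement of the real line is dense in the plane. -/
theorem nhdsWithin_im_ne_zero_neBot (z : ℂ) : (𝓝[{z : ℂ | z.im ≠ 0}] z).NeBot := by
  rw [← mem_closure_iff_nhdsWithin_neBot]
  refine mem_closure_of_tendsto (f := fun n : ℕ => z + ((n + 1 : ℝ)⁻¹ : ℝ) * (if 0 ≤ z.im then
    Complex.I else -Complex.I)) (b := atTop) ?_ (Eventually.of_forall fun n => ?_)
  · have h1 : Tendsto (fun n : ℕ => ((n + 1 : ℝ)⁻¹ : ℝ)) atTop (𝓝 0) :=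
      tendsto_inv_atTop_zero.comp (tendsto_natCast_atTop_atTop.atTop_add tendsto_const_nhds)
    have h2 := ((Complex.continuous_ofReal.tendsto 0).comp h1).mul_const
      (if 0 ≤ z.im then Complex.I else -Complex.I)
    simpa using! h2.const_add z
  · have h3 : (0 : ℝ) < (n + 1 : ℝ)⁻¹ := by positivity
    split_ifs with h
    · have : 0 < z.im + (n + 1 : ℝ)⁻¹ := by linarith
      rw [Set.mem_ofPred_eq, Complex.add_im, Complex.im_ofReal_mul, Complex.I_im, mul_one]
      exact this.ne'
    · have : z.im - (n + 1 : ℝ)⁻¹ < 0 := by linarith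
      rw [Set.mem_ofPred_eq, Complex.add_im, Complex.im_ofReal_mul, Complex.neg_im, Complex.I_im]
      intro h'
      linarith

instance nhdsWithin_compl_realLine_neBot (p : OnePoint ℂ) : (𝓝[realLineᶜ] p).NeBot := by
  rw [← mem_closure_iff_nhdsWithin_neBot]
  rcases exists_chart p with ⟨z, rfl⟩ | rfl
  · have := nhdsWithin_im_ne_zero_neBot z
    rw [← mem_closure_iff_nhdsWithin_neBot] at this
    exact map_mem_closure OnePoint.continuous_coe this fun u hu h => hu (coe_mem_realLine.1 h)
  · have := nhdsWithin_im_ne_zero_neBot 0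
    rw [← mem_closure_iff_nhdsWithin_neBot] at this
    exact map_mem_closure continuous_invChart this fun u hu h => hu (invChart_mem_realLine.1 h)

variable {V : Type*} [NormedAddCommGroup V] [NormedSpace ℂ V]

theorem HolomorphicOn.continuousAt {f : OnePoint ℂ → V} {U : Set (OnePoint ℂ)}
    (hf : HolomorphicOn f U) (hU : IsOpen U) {p : OnePoint ℂ} (hp : p ∈ U) :
    ContinuousAt f p := by
  rcases exists_chart p with ⟨z, rfl⟩ | rfl
  · have h1 : {z : ℂ | (z : OnePoint ℂ) ∈ U} ∈ 𝓝 z :=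
      (hU.preimage OnePoint.continuous_coe).mem_nhds hp
    have h2 := (hf.1.differentiableAt h1).continuousAt
    exact OnePoint.continuousAt_coe.2 h2
  · have h1 : {w : ℂ | invChart w ∈ U} ∈ 𝓝 0 := (hU.preimage continuous_invChart).mem_nhds hp
    have h2 := (hf.2.differentiableAt h1).continuousAt
    rw [invChart_zero, OnePoint.continuousAt_infty']
    have h3 : Tendsto (fun z : ℂ => z⁻¹) (coclosedCompact ℂ) (𝓝 0) := by
      rw [coclosedCompact_eq_cocompact, ← Metric.cobounded_eq_cocompact]
      exact tendsto_inv₀_cobounded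
    have h4 := h2.tendsto.comp h3
    simp only [invChart_zero] at h4
    refine h4.congr' ?_
    have h5 : ∀ᶠ z : ℂ in coclosedCompact ℂ, z ≠ 0 := by
      rw [coclosedCompact_eq_cocompact, ← Metric.cobounded_eq_cocompact]
      exact Bornology.eventually_ne_cobounded 0
    filter_upwards [h5] with z hz
    simp only [Function.comp_apply]
    rw [← coe_eq_invChart hz]

theorem HolomorphicOn.of_locally {f : OnePoint ℂ → V} {U : Set (OnePoint ℂ)}
    (h : ∀ p ∈ U, ∃ U', IsOpen U' ∧ p ∈ U' ∧ HolomorphicOn f U') : HolomorphicOn f U := by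
  refine ⟨fun z hz => ?_, fun w hw => ?_⟩
  · obtain ⟨U', hU', hp, hf⟩ := h _ hz
    exact (hf.1.differentiableAt
      ((hU'.preimage OnePoint.continuous_coe).mem_nhds hp)).differentiableWithinAt
  · obtain ⟨U', hU', hp, hf⟩ := h _ hw
    exact (hf.2.differentiableAt
      ((hU'.preimage continuous_invChart).mem_nhds hp)).differentiableWithinAt

/-- In a set that does not contain `∞` only the affine chart matters. -/
theorem HolomorphicOn.of_infty_notMem {f : OnePoint ℂ → V} {U : Set (OnePoint ℂ)} (hU : ∞ ∉ U)
    (h : DifferentiableOn ℂ (fun z : ℂ => f z) {z : ℂ | (z : OnePoint ℂ) ∈ U}) :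
    HolomorphicOn f U := by
  refine ⟨h, ?_⟩
  have hne : ∀ w : ℂ, invChart w ∈ U → w ≠ 0 := by
    rintro w hw rfl
    rw [invChart_zero] at hw
    exact hU hw
  have h1 : DifferentiableOn ℂ (fun w : ℂ => w⁻¹) {w : ℂ | invChart w ∈ U} := fun w hw =>
    (differentiableAt_inv (hne w hw)).differentiableWithinAt
  refine (h.comp h1 fun w hw => ?_).congr fun w hw => ?_
  · have := invChart_of_ne (hne w hw)
    rw [Set.mem_ofPred_eq, ← this]
    exact hw
  · rw [Function.comp_apply, invChart_of_ne (hne w hw)]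

theorem nullGerms_mono {Ω Ω' : Set (OnePoint ℂ)} (h : Ω' ⊆ Ω) : nullGerms V Ω ≤ nullGerms V Ω' :=
  fun _ ⟨U, hU, hΩ, hf⟩ => ⟨U, hU, h.trans hΩ, hf⟩

/-- Nullity of a germ can be checked at each point: local extensions are unique, hence glue. -/
theorem mem_nullGerms_iff {Ω : Set (OnePoint ℂ)} {F : OnePoint ℂ → V} :
    F ∈ nullGerms V Ω ↔ ∀ p ∈ Ω, F ∈ nullGerms V {p} := by
  refine ⟨fun h p hp => nullGerms_mono (Set.singleton_subset_iff.2 hp) h, fun H => ?_⟩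
  choose! U hU hpU h hh hF using fun p hp => H p hp
  have hlim : ∀ p ∈ Ω, ∀ x ∈ U p, limUnder (𝓝[realLineᶜ] x) F = h p x := fun p hp x hx =>
    limUnder_eq_of_eqOn ((hU p hp).mem_nhds hx) ((hh p hp).continuousAt (hU p hp) hx)
      fun y hy => hF p hp hy
  refine ⟨⋃ p ∈ Ω, U p, isOpen_biUnion hU, fun p hp => Set.mem_biUnion hp (hpU p hp rfl),
    fun x => limUnder (𝓝[realLineᶜ] x) F, HolomorphicOn.of_locally fun x hx => ?_, fun x hx => ?_⟩
  · obtain ⟨p, hp, hx⟩ := Set.mem_iUnion₂.1 hx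
    exact ⟨U p, hU p hp, hx, (hh p hp).congr fun y hy => hlim p hp y hy⟩
  · obtain ⟨p, hp, hx'⟩ := Set.mem_iUnion₂.1 hx.1
    exact (hF p hp ⟨hx', hx.2⟩).trans (hlim p hp x hx').symm

theorem mem_nullGerms_of_eqOn {p : OnePoint ℂ} {F : OnePoint ℂ → V} {U : Set (OnePoint ℂ)}
    (hU : IsOpen U) (hp : p ∈ U) (hF : ∀ x ∈ U, x ∉ realLine → F x = 0) : F ∈ nullGerms V {p} :=
  ⟨U, hU, Set.singleton_subset_iff.2 hp, 0, HolomorphicOn.zero _, fun x hx => hF x hx.1 hx.2⟩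

/-- Nullity at an affine point, in terms of the affine coordinate. -/
theorem coe_mem_nullGerms_iff {z : ℂ} {F : OnePoint ℂ → V} :
    F ∈ nullGerms V {(z : OnePoint ℂ)} ↔ ∃ U : Set ℂ, IsOpen U ∧ z ∈ U ∧
      ∃ h : ℂ → V, DifferentiableOn ℂ h U ∧ ∀ u ∈ U, u.im ≠ 0 → F u = h u := by
  constructor
  · rintro ⟨U, hU, hzU, h, hh, hF⟩
    exact ⟨{u : ℂ | (u : OnePoint ℂ) ∈ U}, hU.preimage OnePoint.continuous_coe, hzU rfl,
      fun u => h u, hh.1, fun u hu hu0 => hF ⟨hu, fun h => hu0 (coe_mem_realLine.1 h)⟩⟩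
  · rintro ⟨U, hU, hzU, h, hh, hF⟩
    refine ⟨(↑) '' U, OnePoint.isOpen_image_coe.2 hU,
      Set.singleton_subset_iff.2 ⟨z, hzU, rfl⟩, fun p => p.elim 0 h,
      HolomorphicOn.of_infty_notMem (OnePoint.infty_notMem_image_coe) ?_, ?_⟩
    · refine hh.mono ?_
      rintro u ⟨u', hu', h'⟩
      rwa [← OnePoint.coe_eq_coe.1 h']
    · rintro _ ⟨⟨u, hu, rfl⟩, hu0⟩
      exact hF u hu fun h => hu0 (coe_mem_realLine.2 h)

theorem coe_mem_affineLine {z : ℂ} : (z : OnePoint ℂ) ∈ affineLine ↔ z.im = 0 := by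
  rw [affineLine, Set.mem_sdiff, coe_mem_realLine]
  simp

theorem principalSeriesFun_mul (ν : ℂ) (g h : SL(2, ℝ)) (F : OnePoint ℂ → V) {p : OnePoint ℂ}
    (h1 : p ∈ goodSet g) (h2 : moebius g⁻¹ p ∈ goodSet h) :
    principalSeriesFun V ν (g * h) F p =
      principalSeriesFun V ν g (principalSeriesFun V ν h F) p := by
  have hp1 : 0 < (factor g p).re := h1
  have hp2 : 0 < (factor h (moebius g⁻¹ p)).re := h2
  have hne1 : factor g p ≠ 0 := by
    intro h
    simp [h] at hp1
  have hne2 : factor h (moebius g⁻¹ p) ≠ 0 := by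
    intro h
    simp [h] at hp2
  show factor (g * h) p ^ (ν + 1 / 2) • F (moebius (g * h)⁻¹ p) =
    factor g p ^ (ν + 1 / 2) •
      (factor h (moebius g⁻¹ p) ^ (ν + 1 / 2) • F (moebius h⁻¹ (moebius g⁻¹ p)))
  have ha1 := abs_lt.1 (Complex.abs_arg_lt_pi_div_two_iff.2 (Or.inl hp1))
  have ha2 := abs_lt.1 (Complex.abs_arg_lt_pi_div_two_iff.2 (Or.inl hp2))
  have hlog := Complex.log_mul_eq_add_log_iff hne1 hne2 |>.2 ⟨by linarith, by linarith⟩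
  rw [factor_mul g h hne1, mul_inv_rev, moebius_mul, smul_smul,
    Complex.cpow_def_of_ne_zero (mul_ne_zero hne1 hne2), Complex.cpow_def_of_ne_zero hne1,
    Complex.cpow_def_of_ne_zero hne2, hlog, add_mul, Complex.exp_add]

/-- The operator `η(γ) π_ν(γ)` on functions. -/
def twistedAction (ν : ℂ) (η : Representation ℂ PSL(2, ℤ) V) (γ : SL(2, ℤ)) :
    (OnePoint ℂ → V) →ₗ[ℂ] (OnePoint ℂ → V) :=
  (η (γ : PSL(2, ℤ))).compLeft (OnePoint ℂ) ∘ₗ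
    principalSeriesFun V ν (γ.map (Int.castRingHom ℝ))

/-- The linear fractional transformation given by the inverse of an integral matrix. -/
def moebiusInv (γ : SL(2, ℤ)) (p : OnePoint ℂ) : OnePoint ℂ :=
  moebius (γ.map (Int.castRingHom ℝ))⁻¹ p

theorem twistedAction_apply (ν : ℂ) (η : Representation ℂ PSL(2, ℤ) V) (γ : SL(2, ℤ))
    (F : OnePoint ℂ → V) (p : OnePoint ℂ) :
    twistedAction ν η γ F p = η (γ : PSL(2, ℤ))
      (factor (γ.map (Int.castRingHom ℝ)) p ^ (ν + 1 / 2) • F (moebiusInv γ p)) := rfl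

theorem moebiusInv_mem_realLine_iff {γ : SL(2, ℤ)} {p : OnePoint ℂ} :
    moebiusInv γ p ∈ realLine ↔ p ∈ realLine := moebius_mem_realLine_iff _

theorem moebiusInv_mul (γ δ : SL(2, ℤ)) (p : OnePoint ℂ) :
    moebiusInv (γ * δ) p = moebiusInv δ (moebiusInv γ p) := by
  rw [moebiusInv, map_mul, mul_inv_rev, moebius_mul]
  rfl

theorem moebiusInv_one (p : OnePoint ℂ) : moebiusInv 1 p = p := by
  rw [moebiusInv, map_one, inv_one, moebius_one]

theorem isRepresentedBy_toAffine_iff {F : boundaryGerms V realLine} {G : OnePoint ℂ → V} :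
    IsRepresentedBy (Hyperfunction.toAffine (V := V) (Submodule.Quotient.mk F)) G ↔
      G ∈ boundaryGerms V affineLine ∧
        ∀ x : ℂ, x.im = 0 → G - F.1 ∈ nullGerms V {(x : OnePoint ℂ)} := by
  have h2 : (∀ x : ℂ, x.im = 0 → G - F.1 ∈ nullGerms V {(x : OnePoint ℂ)}) ↔
      G - F.1 ∈ nullGerms V affineLine := by
    rw [mem_nullGerms_iff]
    constructor
    · intro h p hp
      induction p with
      | infty => exact absurd rfl hp.2
      | coe x => exact h x (coe_mem_affineLine.1 hp)
    · exact fun h x hx => h x (coe_mem_affineLine.2 hx)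
  rw [h2]
  constructor
  · rintro ⟨h, h1⟩
    exact ⟨h, (Submodule.Quotient.eq ((nullGerms V affineLine).submoduleOf _)).1 h1⟩
  · rintro ⟨h, h1⟩
    exact ⟨h, (Submodule.Quotient.eq ((nullGerms V affineLine).submoduleOf _)).2 h1⟩

variable (ν : ℂ) (η : Representation ℂ PSL(2, ℤ) V)

theorem twistedAction_mem_nullGerms [FiniteDimensional ℂ V] {γ : SL(2, ℤ)} {p : OnePoint ℂ}
    (hp : p ∈ realLine)
    {F : OnePoint ℂ → V} (hF : F ∈ nullGerms V {moebiusInv γ p}) :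
    twistedAction ν η γ F ∈ nullGerms V {p} := by
  obtain ⟨U, hU, hpU, h, hh, hF⟩ := hF
  refine ⟨goodSet _ ∩ moebius (γ.map (Int.castRingHom ℝ))⁻¹ ⁻¹' U,
    (isOpen_goodSet _).inter (isOpen_preimage_moebius _ hU),
    Set.singleton_subset_iff.2 ⟨realLine_subset_goodSet _ hp, hpU rfl⟩,
    twistedAction ν η γ h, (hh.principalSeriesFun ν _).postcomp _, ?_⟩
  rintro x ⟨⟨-, h2⟩, h3⟩
  have h4 : F (moebiusInv γ x) = h (moebiusInv γ x) :=
    hF ⟨h2, fun h => h3 (moebiusInv_mem_realLine_iff.1 h)⟩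
  rw [twistedAction_apply, twistedAction_apply, h4]

theorem twistedAction_mul_sub_mem (γ δ : SL(2, ℤ)) {p : OnePoint ℂ} (hp : p ∈ realLine)
    (F : OnePoint ℂ → V) :
    twistedAction ν η (γ * δ) F - twistedAction ν η γ (twistedAction ν η δ F) ∈
      nullGerms V {p} := by
  refine mem_nullGerms_of_eqOn (U := goodSet (γ.map (Int.castRingHom ℝ)) ∩
    moebius (γ.map (Int.castRingHom ℝ))⁻¹ ⁻¹' goodSet (δ.map (Int.castRingHom ℝ)))
    ((isOpen_goodSet _).inter (isOpen_preimage_moebius _ (isOpen_goodSet _)))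
    ⟨realLine_subset_goodSet _ hp,
      realLine_subset_goodSet _ (moebiusInv_mem_realLine_iff.2 hp)⟩ ?_
  rintro x ⟨h1, h2⟩ -
  have h3 := principalSeriesFun_mul ν _ _ F h1 h2
  rw [← map_mul] at h3
  have h4 : η ((γ * δ : SL(2, ℤ)) : PSL(2, ℤ)) = η (γ : PSL(2, ℤ)) * η (δ : PSL(2, ℤ)) := by
    rw [← map_mul]
    rfl
  have h5 : twistedAction ν η (γ * δ) F x = η ((γ * δ : SL(2, ℤ)) : PSL(2, ℤ))
    (principalSeriesFun V ν ((γ * δ).map (Int.castRingHom ℝ)) F x) := rfl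
  rw [Pi.sub_apply, sub_eq_zero, h5, h3, h4, Module.End.mul_apply, twistedAction_apply,
    twistedAction_apply, ← map_smul (η (δ : PSL(2, ℤ)))]
  rfl

/-- The germ of `F` at `p` represents a hyperfunction germ fixed by `η(γ) π_ν(γ)`. -/
def FixedAt (F : OnePoint ℂ → V) (γ : SL(2, ℤ)) (p : OnePoint ℂ) : Prop :=
  twistedAction ν η γ F - F ∈ nullGerms V {p}

variable {ν η}

theorem fixedAt_one {F : OnePoint ℂ → V} {p : OnePoint ℂ} (hp : p ∈ realLine) :
    FixedAt ν η F 1 p := by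
  refine mem_nullGerms_of_eqOn (isOpen_goodSet 1) (realLine_subset_goodSet 1 hp) fun x hx _ => ?_
  have hp0 : 0 < (factor 1 x).re := hx
  have hne : factor 1 x ≠ 0 := by
    intro h
    simp [h] at hp0
  have h1 := factor_mul 1 1 hne
  rw [mul_one, inv_one, moebius_one] at h1
  have h2 : factor 1 x = 1 := (mul_left_cancel₀ hne ((mul_one _).trans h1)).symm
  have h3 : η ((1 : SL(2, ℤ)) : PSL(2, ℤ)) = 1 := map_one η
  rw [Pi.sub_apply, twistedAction_apply, map_one, h2, Complex.one_cpow, one_smul, h3,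
    moebiusInv_one, Module.End.one_apply, sub_self]

variable [FiniteDimensional ℂ V]

theorem FixedAt.mul {F : OnePoint ℂ → V} {γ δ : SL(2, ℤ)} {p : OnePoint ℂ} (hp : p ∈ realLine)
    (hγ : FixedAt ν η F γ p) (hδ : FixedAt ν η F δ (moebiusInv γ p)) :
    FixedAt ν η F (γ * δ) p := by
  have h1 := twistedAction_mul_sub_mem ν η γ δ hp F
  have h2 := twistedAction_mem_nullGerms ν η hp hδ
  have h3 := add_mem (add_mem h1 h2) hγ
  rwa [map_sub, sub_add_sub_cancel, sub_add_sub_cancel] at h3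

theorem FixedAt.inv {F : OnePoint ℂ → V} {γ : SL(2, ℤ)} {p : OnePoint ℂ} (hp : p ∈ realLine)
    (hγ : FixedAt ν η F γ (moebiusInv γ⁻¹ p)) : FixedAt ν η F γ⁻¹ p := by
  have h1 := twistedAction_mul_sub_mem ν η γ⁻¹ γ hp F
  have h2 := twistedAction_mem_nullGerms ν η hp hγ
  have h3 : FixedAt ν η F 1 p := fixedAt_one hp
  rw [FixedAt] at h3
  rw [inv_mul_cancel] at h1
  rw [map_sub] at h2
  have h4 := sub_mem h3 (add_mem h1 h2)
  rwa [sub_add_sub_cancel, sub_sub_sub_cancel_left] at h4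

theorem ModularGroup_S_T_relation : (ModularGroup.T : SL(2, ℤ)) =
    ModularGroup.S * ModularGroup.T⁻¹ * ModularGroup.S * ModularGroup.T⁻¹ * ModularGroup.S := by
  ext i j
  simp only [Matrix.SpecialLinearGroup.coe_mul, ModularGroup.coe_S, ModularGroup.coe_T,
    ModularGroup.coe_T_inv]
  fin_cases i <;> fin_cases j <;> simp [Matrix.mul_apply, Fin.sum_univ_two]

theorem moebiusInv_homog (γ : SL(2, ℤ)) {v : ℂ × ℂ} (hv : v ≠ 0) :
    moebiusInv γ (homog v) = homog ((γ 1 1 : ℂ) * v.1 - (γ 0 1 : ℂ) * v.2,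
      -(γ 1 0 : ℂ) * v.1 + (γ 0 0 : ℂ) * v.2) := by
  rw [moebiusInv, moebius_inv_homog _ hv]
  simp [linAct]

theorem homog_one_right (z : ℂ) : homog (z, 1) = z := by simp [homog]

theorem homog_one_zero : homog (1, 0) = ∞ := by simp [homog]

theorem moebiusInv_S_coe {z : ℂ} (hz : z ≠ 0) :
    moebiusInv ModularGroup.S (z : OnePoint ℂ) = ((-1 / z : ℂ) : OnePoint ℂ) := by
  rw [← homog_one_right z, moebiusInv_homog _ (by simp)]
  rw [homog_of_ne (by simpa [ModularGroup.S] using hz)]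
  simp [ModularGroup.S]
  field_simp

theorem moebiusInv_S_zero : moebiusInv ModularGroup.S ((0 : ℂ) : OnePoint ℂ) = ∞ := by
  rw [← homog_one_right 0, moebiusInv_homog _ (by simp)]
  simp [ModularGroup.S, homog]

theorem moebiusInv_S_infty : moebiusInv ModularGroup.S ∞ = ((0 : ℂ) : OnePoint ℂ) := by
  rw [← homog_one_zero, moebiusInv_homog _ (by simp)]
  simp [ModularGroup.S, homog]

theorem moebiusInv_T_coe (z : ℂ) :
    moebiusInv ModularGroup.T (z : OnePoint ℂ) = ((z - 1 : ℂ) : OnePoint ℂ) := by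
  rw [← homog_one_right z, moebiusInv_homog _ (by simp)]
  simp [ModularGroup.T, homog]

theorem moebiusInv_T_inv_coe (z : ℂ) :
    moebiusInv ModularGroup.T⁻¹ (z : OnePoint ℂ) = ((z + 1 : ℂ) : OnePoint ℂ) := by
  rw [← homog_one_right z, moebiusInv_homog _ (by simp)]
  simp [homog]

/-- Invariance under `S` everywhere and under `T` on the affine line implies invariance under the
modular group: near `∞` invariance under `T` results from the relation `T = S T⁻¹ S T⁻¹ S`, in
which `T⁻¹` is applied at the affine points `0` and `-1` only. -/
theorem fixedAt_of_generators {F : OnePoint ℂ → V}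
    (hS : ∀ p ∈ realLine, FixedAt ν η F ModularGroup.S p)
    (hT : ∀ x : ℂ, x.im = 0 → FixedAt ν η F ModularGroup.T x) (γ : SL(2, ℤ)) :
    ∀ p ∈ realLine, FixedAt ν η F γ p := by
  have hTi : ∀ x : ℂ, x.im = 0 → FixedAt ν η F ModularGroup.T⁻¹ x := fun x hx =>
    FixedAt.inv (coe_mem_realLine.2 hx) (by
      rw [moebiusInv_T_inv_coe]
      exact hT _ (by simpa using hx))
  have hinf : FixedAt ν η F ModularGroup.T ∞ := by
    have hi := infty_mem_realLine
    have e1 : moebiusInv (ModularGroup.S * ModularGroup.T⁻¹) ∞ = ((1 : ℂ) : OnePoint ℂ) := by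
      rw [moebiusInv_mul, moebiusInv_S_infty, moebiusInv_T_inv_coe, zero_add]
    have e2 : moebiusInv (ModularGroup.S * ModularGroup.T⁻¹ * ModularGroup.S) ∞ =
        ((-1 : ℂ) : OnePoint ℂ) := by
      rw [moebiusInv_mul, e1, moebiusInv_S_coe one_ne_zero, div_one]
    have e3 : moebiusInv (ModularGroup.S * ModularGroup.T⁻¹ * ModularGroup.S * ModularGroup.T⁻¹) ∞ =
        ((0 : ℂ) : OnePoint ℂ) := by
      rw [moebiusInv_mul, e2, moebiusInv_T_inv_coe, neg_add_cancel]
    rw [ModularGroup_S_T_relation]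
    refine FixedAt.mul hi (FixedAt.mul hi (FixedAt.mul hi (FixedAt.mul hi (hS _ hi) ?_) ?_) ?_) ?_
    · rw [moebiusInv_S_infty]
      exact hTi 0 (by simp)
    · rw [e1]
      exact hS _ (coe_mem_realLine.2 (by simp))
    · rw [e2]
      exact hTi (-1) (by simp)
    · rw [e3]
      exact hS _ (coe_mem_realLine.2 (by simp))
  have hT' : ∀ p ∈ realLine, FixedAt ν η F ModularGroup.T p := by
    intro p hp
    induction p with
    | infty => exact hinf
    | coe x => exact hT x (coe_mem_realLine.1 hp)
  have hγ : γ ∈ Subgroup.closure {ModularGroup.S, ModularGroup.T} := by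
    simp [SpecialLinearGroup.SL2Z_generators]
  induction hγ using Subgroup.closure_induction with
  | mem x hx =>
    rcases hx with rfl | rfl
    · exact hS
    · exact hT'
  | one => exact fun p hp => fixedAt_one hp
  | mul x y _ _ hx hy =>
    exact fun p hp => FixedAt.mul hp (hx p hp) (hy _ (moebiusInv_mem_realLine_iff.2 hp))
  | inv x _ hx => exact fun p hp => FixedAt.inv hp (hx _ (moebiusInv_mem_realLine_iff.2 hp))

theorem mk_mem_automorphicHyperfunctions_iff {F : boundaryGerms V realLine} :
    (Submodule.Quotient.mk F : Hyperfunction V realLine) ∈ automorphicHyperfunctions ν η ↔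
      ∀ γ : SL(2, ℤ), ∀ p ∈ realLine, FixedAt ν η F.1 γ p := by
  refine forall_congr' fun γ => ?_
  have h1 : Hyperfunction.mapValues (η (γ : PSL(2, ℤ)))
    (principalSeries V ν (γ.map (Int.castRingHom ℝ)) (Submodule.Quotient.mk F)) =
      Submodule.Quotient.mk F ↔ twistedAction ν η γ F.1 - F.1 ∈ nullGerms V realLine := by
    exact Submodule.Quotient.eq _
  rw [h1, mem_nullGerms_iff]
  rfl

end Germs

/-! ### Principal powers and the action of the generators -/

section Powers

/-- Compatibility of the principal power with quotients, if the difference of the arguments is again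
a principal argument. -/
theorem div_cpow_of_arg {a b : ℂ} (ha : a ≠ 0) (hb : b ≠ 0) (hb' : b.arg ≠ Real.pi)
    (h : a.arg - b.arg ∈ Set.Ioc (-Real.pi) Real.pi) (μ : ℂ) : (a / b) ^ μ = a ^ μ / b ^ μ := by
  have hlog : Complex.log (a / b) = Complex.log a - Complex.log b := by
    rw [div_eq_mul_inv, (Complex.log_mul_eq_add_log_iff ha (inv_ne_zero hb)).2,
      Complex.log_inv _ hb', sub_eq_add_neg]
    rwa [Complex.arg_inv, if_neg hb', ← sub_eq_add_neg]
  rw [Complex.cpow_def_of_ne_zero (div_ne_zero ha hb), Complex.cpow_def_of_ne_zero ha,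
    Complex.cpow_def_of_ne_zero hb, hlog, sub_mul, Complex.exp_sub]

theorem div_cpow_of_re_pos {a b : ℂ} (ha : 0 < a.re) (hb : 0 < b.re) (μ : ℂ) :
    (a / b) ^ μ = a ^ μ / b ^ μ := by
  have hne : ∀ {c : ℂ}, 0 < c.re → c ≠ 0 := by
    rintro c hc rfl
    simp at hc
  have ha1 := abs_lt.1 (Complex.abs_arg_lt_pi_div_two_iff.2 (Or.inl ha))
  have ha2 := abs_lt.1 (Complex.abs_arg_lt_pi_div_two_iff.2 (Or.inl hb))
  have hpi := Real.pi_pos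
  exact div_cpow_of_arg (hne ha) (hne hb) (by linarith) ⟨by linarith, by linarith⟩ μ

theorem div_cpow_of_im {a b : ℂ} (h : 0 < a.im ∧ 0 < b.im ∨ a.im < 0 ∧ b.im < 0) (μ : ℂ) :
    (a / b) ^ μ = a ^ μ / b ^ μ := by
  have hne : ∀ {c : ℂ}, c.im ≠ 0 → c ≠ 0 := by
    rintro c hc rfl
    exact hc Complex.zero_im
  have hpi : ∀ {c : ℂ}, c.im ≠ 0 → c.arg ≠ Real.pi := fun hc h =>
    hc (Complex.arg_eq_pi_iff.1 h).2
  have hb : b.im ≠ 0 := by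
    rcases h with h | h
    exacts [h.2.ne', h.2.ne]
  have ha : a.im ≠ 0 := by
    rcases h with h | h
    exacts [h.1.ne', h.1.ne]
  have h1 := Complex.neg_pi_lt_arg a
  have h2 := Complex.arg_le_pi a
  have h3 := (Complex.arg_le_pi b).lt_of_ne (hpi hb)
  have h4 := Complex.neg_pi_lt_arg b
  refine div_cpow_of_arg (hne ha) (hne hb) (hpi hb) ?_ μ
  rcases h with h | h
  · have h5 := Complex.arg_nonneg_iff.2 h.1.le
    have h6 := Complex.arg_nonneg_iff.2 h.2.le
    exact ⟨by linarith, by linarith⟩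
  · have h5 := Complex.arg_neg_iff.2 h.1
    have h6 := Complex.arg_neg_iff.2 h.2
    exact ⟨by linarith, by linarith⟩

theorem re_one_add_sq_pos {z : ℂ} (hz : |z.im| < 1) : 0 < (1 + z ^ 2).re := by
  have h := abs_lt.1 hz
  have : (1 + z ^ 2).re = 1 + (z.re ^ 2 - z.im ^ 2) := by simp [pow_two]
  rw [this]
  nlinarith [sq_nonneg z.re]

theorem one_add_sq_mem_slitPlane {z : ℂ} (hz : |z.im| < 1) : 1 + z ^ 2 ∈ Complex.slitPlane :=
  Or.inl (re_one_add_sq_pos hz)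

theorem one_add_sq_cpow_ne_zero {z : ℂ} (hz : |z.im| < 1) (μ : ℂ) : (1 + z ^ 2) ^ μ ≠ 0 := by
  rw [Ne, Complex.cpow_eq_zero_iff]
  exact fun h => Complex.slitPlane_ne_zero (one_add_sq_mem_slitPlane hz) h.1

theorem differentiableOn_one_add_sq_cpow (μ : ℂ) :
    DifferentiableOn ℂ (fun z : ℂ => (1 + z ^ 2) ^ μ) {z | |z.im| < 1} := by
  intro z hz
  refine DifferentiableAt.differentiableWithinAt ?_
  exact (by fun_prop : DifferentiableAt ℂ (fun z : ℂ => 1 + z ^ 2) z).cpow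
    (differentiableAt_const _) (one_add_sq_mem_slitPlane hz)

theorem re_sq_pos {z : ℂ} (hz : |z.im| < z.re) : 0 < (z ^ 2).re := by
  have h := abs_lt.1 hz
  have : (z ^ 2).re = z.re ^ 2 - z.im ^ 2 := by simp [pow_two]
  rw [this]
  nlinarith

/-- The transformation of `(1 + z²) ^ μ` under `z ↦ -1 / z` near the positive real axis. -/
theorem one_add_neg_inv_sq_cpow {z : ℂ} (hz : |z.im| < z.re) (μ : ℂ) :
    (1 + (-1 / z) ^ 2) ^ μ = (1 + z ^ 2) ^ μ * z ^ (-2 * μ) := by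
  have hre : 0 < z.re := (abs_nonneg _).trans_lt hz
  have hz0 : z ≠ 0 := by
    rintro rfl
    simp at hre
  have h2 := re_sq_pos hz
  have h1 : 0 < (1 + z ^ 2).re := by
    rw [Complex.add_re, Complex.one_re]
    linarith
  have e : 1 + (-1 / z) ^ 2 = (1 + z ^ 2) / z ^ 2 := by
    field_simp
    ring
  have ha := abs_lt.1 (Complex.abs_arg_lt_pi_div_two_iff.2 (Or.inl hre))
  have e2 : (z ^ 2) ^ μ = z ^ (2 * μ) := by
    rw [show (2 : ℂ) * μ = ((2 : ℕ) : ℂ) * μ by norm_num,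
      Complex.cpow_nat_mul' (by push_cast; linarith) (by push_cast; linarith)]
  rw [e, div_cpow_of_re_pos h1 h2, e2, neg_mul, Complex.cpow_neg, div_eq_mul_inv]

theorem neg_two_mul_add_half (ν : ℂ) : -2 * (ν + 1 / 2) = -2 * ν - 1 := by ring

end Powers

section Action

/-- The matrices `(0 -1; 1 0)` of Mathlib and `(0 1; -1 0)` represent the same element of
`PSL(2, ℤ)`. -/
theorem coe_S_eq : ((ModularGroup.S : SL(2, ℤ)) : PSL(2, ℤ)) = S := by
  have h : ∀ S' : SL(2, ℤ), S'.1 = !![0, 1; -1, 0] → ModularGroup.S⁻¹ * S' = -1 := by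
    intro S' hS'
    rw [inv_mul_eq_iff_eq_mul]
    ext i j
    rw [hS', mul_neg, mul_one, Matrix.SpecialLinearGroup.coe_neg, ModularGroup.coe_S]
    fin_cases i <;> fin_cases j <;> simp
  have hc : (-1 : SL(2, ℤ)) ∈ Subgroup.center SL(2, ℤ) :=
    Subgroup.mem_center_iff.2 fun g => by rw [mul_neg, neg_mul, mul_one, one_mul]
  have h' : ∀ S' : SL(2, ℤ), S'.1 = !![0, 1; -1, 0] →
      ((ModularGroup.S : SL(2, ℤ)) : PSL(2, ℤ)) = (S' : PSL(2, ℤ)) :=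
    fun S' hS' => QuotientGroup.eq.2 ((h S' hS').symm ▸ hc)
  exact h' ⟨!![0, 1; -1, 0], by simp [Matrix.det_fin_two]⟩ rfl

theorem coe_T_eq : ((ModularGroup.T : SL(2, ℤ)) : PSL(2, ℤ)) = T := rfl

theorem map_intCastRingHom_apply (γ : SL(2, ℤ)) (i j : Fin 2) :
    (γ.map (Int.castRingHom ℝ)) i j = (γ i j : ℝ) := rfl

theorem factor_S_coe {z : ℂ} (hz : 1 + z ^ 2 ≠ 0) :
    factor (ModularGroup.S.map (Int.castRingHom ℝ)) (z : OnePoint ℂ) = 1 := by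
  simp only [factor, OnePoint.elim_some, map_intCastRingHom_apply]
  simp [ModularGroup.S, add_comm (z ^ 2), div_self hz]

theorem factor_S_infty : factor (ModularGroup.S.map (Int.castRingHom ℝ)) ∞ = 1 := by
  simp only [factor, OnePoint.elim_infty, map_intCastRingHom_apply]
  simp [ModularGroup.S]

theorem factor_T_coe (z : ℂ) :
    factor (ModularGroup.T.map (Int.castRingHom ℝ)) (z : OnePoint ℂ) =
      (1 + z ^ 2) / (1 + (z - 1) ^ 2) := by
  simp only [factor, OnePoint.elim_some, map_intCastRingHom_apply]
  simp [ModularGroup.T]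

variable {V : Type*} [NormedAddCommGroup V] [NormedSpace ℂ V]

theorem twistedAction_T_coe (ν : ℂ) (η : Representation ℂ PSL(2, ℤ) V) (F : OnePoint ℂ → V) {z : ℂ}
    (hz : |z.im| < 1) : twistedAction ν η ModularGroup.T F z =
      (1 + z ^ 2) ^ (ν + 1 / 2) •
        η T (((1 + (z - 1) ^ 2) ^ (ν + 1 / 2))⁻¹ • F ((z - 1 : ℂ) : OnePoint ℂ)) := by
  rw [twistedAction_apply, factor_T_coe, moebiusInv_T_coe, coe_T_eq,
    div_cpow_of_re_pos (re_one_add_sq_pos hz) (re_one_add_sq_pos (by simpa using hz)),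
    ← map_smul, smul_smul, div_eq_mul_inv]

theorem twistedAction_S_coe (ν : ℂ) (η : Representation ℂ PSL(2, ℤ) V) (F : OnePoint ℂ → V) {z : ℂ}
    (hz0 : z ≠ 0) (hz : 1 + z ^ 2 ≠ 0) : twistedAction ν η ModularGroup.S F z =
      η S (F ((-1 / z : ℂ) : OnePoint ℂ)) := by
  rw [twistedAction_apply, factor_S_coe hz, moebiusInv_S_coe hz0, coe_S_eq, Complex.one_cpow,
    one_smul]

theorem affineRepresentative_coe (ν : ℂ) (f : ℂ → V) (z : ℂ) :
    affineRepresentative ν f (z : OnePoint ℂ) = (1 + z ^ 2) ^ (ν + 1 / 2) • f z := rfl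

/-- Near the positive real axis, the defect of invariance under `S` of the function represented by
`f` corresponds to `f(z) - z ^ (-2ν-1) η(S) f(-1/z)`. -/
theorem affineRepresentative_sub_S (ν : ℂ) (η : Representation ℂ PSL(2, ℤ) V) (f : ℂ → V) {z : ℂ}
    (hz : |z.im| < z.re) :
    affineRepresentative ν f (z : OnePoint ℂ) -
      twistedAction ν η ModularGroup.S (affineRepresentative ν f) z =
      (1 + z ^ 2) ^ (ν + 1 / 2) • bruggemanExpr ν η f z := by
  have hre : 0 < z.re := (abs_nonneg _).trans_lt hz
  have hz0 : z ≠ 0 := by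
    rintro rfl
    simp at hre
  have h1 : 1 + z ^ 2 ≠ 0 := by
    intro h
    have h2 := re_sq_pos hz
    have := congrArg Complex.re h
    rw [Complex.add_re, Complex.one_re, Complex.zero_re] at this
    linarith
  rw [twistedAction_S_coe ν η _ hz0 h1, affineRepresentative_coe, affineRepresentative_coe,
    one_add_neg_inv_sq_cpow hz, neg_two_mul_add_half, bruggemanExpr, smul_sub, smul_smul, map_smul]

theorem affineRepresentative_mem_boundaryGerms (ν : ℂ) {f : ℂ → V}
    (hf : DifferentiableOn ℂ f {z | z.im ≠ 0}) :
    affineRepresentative ν f ∈ boundaryGerms V affineLine := by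
  refine ⟨(↑) '' {z : ℂ | |z.im| < 1}, OnePoint.isOpen_image_coe.2 (isOpen_strip 1), ?_, ?_⟩
  · intro p hp
    induction p with
    | infty => exact absurd rfl hp.2
    | coe x =>
      refine ⟨x, ?_, rfl⟩
      rw [Set.mem_ofPred_eq, coe_mem_affineLine.1 hp, abs_zero]
      exact one_pos
  · refine HolomorphicOn.of_infty_notMem (fun h => OnePoint.infty_notMem_image_coe h.1) ?_
    have hsub : ∀ z : ℂ, (z : OnePoint ℂ) ∈ (↑) '' {z : ℂ | |z.im| < 1} \ realLine →
        |z.im| < 1 ∧ z.im ≠ 0 := by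
      rintro z ⟨⟨u, hu, h⟩, h2⟩
      rw [OnePoint.coe_eq_coe] at h
      exact ⟨h ▸ hu, fun h => h2 (coe_mem_realLine.2 h)⟩
    exact ((differentiableOn_one_add_sq_cpow _).mono fun z hz => (hsub z hz).1).smul
      (hf.mono fun z hz => (hsub z hz).2)

theorem affineRepresentative_fixedAt_T (ν : ℂ) (η : Representation ℂ PSL(2, ℤ) V) {f : ℂ → V}
    (hf : ∀ z : ℂ, z.im ≠ 0 → f (z + 1) = η T (f z)) {x : ℂ} (hx : x.im = 0) :
    FixedAt ν η (affineRepresentative ν f) ModularGroup.T x := by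
  rw [FixedAt, coe_mem_nullGerms_iff]
  refine ⟨{z | |z.im| < 1}, isOpen_strip 1, by simp [hx], 0, differentiableOn_const 0, ?_⟩
  intro u hu hu0
  have hu' : |(u - 1).im| < 1 := by simpa using hu
  have h1 := hf (u - 1) (by simpa using hu0)
  rw [sub_add_cancel] at h1
  rw [Pi.sub_apply, twistedAction_T_coe ν η _ hu, affineRepresentative_coe,
    affineRepresentative_coe, smul_smul, inv_mul_cancel₀ (one_add_sq_cpow_ne_zero hu' _), one_smul,
    ← h1, sub_self]
  rfl

end Action

section Extension

variable {V : Type*} [NormedAddCommGroup V] [NormedSpace ℂ V]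

/-- A function on `ℂ ∖ ℝ` that extends holomorphically near each point of an open set `Ω` extends
to a holomorphic function on `Ω`. -/
theorem exists_extension {Ω : Set ℂ} {φ : ℂ → V}
    (h : ∀ x ∈ Ω, ∃ U : Set ℂ, IsOpen U ∧ x ∈ U ∧
      ∃ h : ℂ → V, DifferentiableOn ℂ h U ∧ ∀ u ∈ U, u.im ≠ 0 → φ u = h u) :
    ∃ g : ℂ → V, DifferentiableOn ℂ g Ω ∧ ∀ z ∈ Ω, z.im ≠ 0 → g z = φ z := by
  choose! U hU hxU k hk hφ using h
  have hlim : ∀ x ∈ Ω, ∀ y ∈ U x, limUnder (𝓝[{z : ℂ | z.im ≠ 0}] y) φ = k x y := by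
    intro x hx y hy
    have := nhdsWithin_im_ne_zero_neBot y
    have hUy := (hU x hx).mem_nhds hy
    exact limUnder_eq_of_eqOn hUy ((hk x hx).differentiableAt hUy).continuousAt
      fun u hu => hφ x hx u hu.1 hu.2
  refine ⟨fun y => limUnder (𝓝[{z : ℂ | z.im ≠ 0}] y) φ, fun x hx => ?_, fun x hx hx0 => ?_⟩
  · have hUx := (hU x hx).mem_nhds (hxU x hx)
    refine DifferentiableAt.differentiableWithinAt ?_
    refine ((hk x hx).differentiableAt hUx).congr_of_eventuallyEq ?_
    filter_upwards [hUx] with y hy using hlim x hx y hy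
  · rw [hφ x hx x (hxU x hx) hx0]
    exact hlim x hx x (hxU x hx)

/-- A germ `(1 + z²) ^ μ φ(z)` at a real point is null if and only if `φ` extends. -/
theorem exists_extension_of_smul_mem_nullGerms {μ x : ℂ} (hx : x.im = 0) {φ : ℂ → V}
    {F : OnePoint ℂ → V} {W : Set ℂ} (hW : IsOpen W) (hxW : x ∈ W)
    (hF : F ∈ nullGerms V {(x : OnePoint ℂ)})
    (hφ : ∀ u ∈ W, u.im ≠ 0 → F u = (1 + u ^ 2) ^ μ • φ u) :
    ∃ U : Set ℂ, IsOpen U ∧ x ∈ U ∧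
      ∃ h : ℂ → V, DifferentiableOn ℂ h U ∧ ∀ u ∈ U, u.im ≠ 0 → φ u = h u := by
  obtain ⟨U, hU, hxU, h, hh, hFh⟩ := coe_mem_nullGerms_iff.1 hF
  refine ⟨U ∩ W ∩ {z | |z.im| < 1}, (hU.inter hW).inter (isOpen_strip 1),
    ⟨⟨hxU, hxW⟩, by simp [hx]⟩, fun u => ((1 + u ^ 2) ^ μ)⁻¹ • h u, ?_, ?_⟩
  · exact (((differentiableOn_one_add_sq_cpow μ).mono fun z hz => hz.2).inv
      fun z hz => one_add_sq_cpow_ne_zero hz.2 μ).smul (hh.mono fun z hz => hz.1.1)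
  · rintro u ⟨⟨hu1, hu2⟩, hu3⟩ hu0
    simp only
    rw [← hFh u hu1 hu0, hφ u hu2 hu0, smul_smul, inv_mul_cancel₀ (one_add_sq_cpow_ne_zero hu3 μ),
      one_smul]

theorem isOpen_im_ne_zero : IsOpen {z : ℂ | z.im ≠ 0} :=
  isOpen_ne.preimage Complex.continuous_im

theorem eq_of_eq_off_real {X : Type*} [TopologicalSpace X] [T2Space X] {g₁ g₂ : ℂ → X}
    {Ω : Set ℂ} (hΩ : IsOpen Ω) (h1 : ContinuousOn g₁ Ω)
    (h2 : ContinuousOn g₂ Ω) (h : ∀ z ∈ Ω, z.im ≠ 0 → g₁ z = g₂ z) : ∀ z ∈ Ω, g₁ z = g₂ z := by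
  intro z hz
  have := nhdsWithin_im_ne_zero_neBot z
  have hn := hΩ.mem_nhds hz
  refine tendsto_nhds_unique (f := g₁) (l := 𝓝[{z : ℂ | z.im ≠ 0}] z)
    ((h1.continuousAt hn).tendsto.mono_left nhdsWithin_le_nhds)
    (((h2.continuousAt hn).tendsto.mono_left nhdsWithin_le_nhds).congr' ?_)
  filter_upwards [mem_nhdsWithin_of_mem_nhds hn, self_mem_nhdsWithin] with u hu hu0
  exact (h u hu hu0).symm

theorem mem_slitPlane_of_im_ne_zero {z : ℂ} (hz : z.im ≠ 0) : z ∈ Complex.slitPlane := Or.inr hz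

theorem im_neg_one_div (z : ℂ) : (-1 / z).im = z.im / Complex.normSq z := by
  rw [neg_div, Complex.neg_im, one_div, Complex.inv_im, neg_div, neg_neg]

theorem im_neg_one_div_ne_zero {z : ℂ} (hz : z.im ≠ 0) : (-1 / z).im ≠ 0 := by
  rw [im_neg_one_div]
  refine div_ne_zero hz fun h => hz ?_
  rw [Complex.normSq_eq_zero.1 h, Complex.zero_im]

theorem differentiableOn_bruggemanExpr [FiniteDimensional ℂ V] (ν : ℂ)
    (η : Representation ℂ PSL(2, ℤ) V) {f : ℂ → V} (hf : DifferentiableOn ℂ f {z | z.im ≠ 0}) :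
    DifferentiableOn ℂ (bruggemanExpr ν η f) {z | z.im ≠ 0} := by
  have hne : ∀ z ∈ {z : ℂ | z.im ≠ 0}, z ≠ 0 := by
    rintro z hz rfl
    exact hz Complex.zero_im
  have h1 : DifferentiableOn ℂ (fun z : ℂ => z ^ (-2 * ν - 1)) {z : ℂ | z.im ≠ 0} :=
    fun z hz => (differentiableAt_id.cpow (differentiableAt_const _)
      (mem_slitPlane_of_im_ne_zero hz)).differentiableWithinAt
  have h2 : DifferentiableOn ℂ (fun z : ℂ => -1 / z) {z : ℂ | z.im ≠ 0} :=
    fun z hz => ((differentiableAt_const _).div differentiableAt_id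
      (hne z hz)).differentiableWithinAt
  have h3 : DifferentiableOn ℂ (fun z => η S (f (-1 / z))) {z : ℂ | z.im ≠ 0} :=
    (LinearMap.toContinuousLinearMap (η S)).differentiable.comp_differentiableOn
      (hf.comp h2 fun z hz => im_neg_one_div_ne_zero hz)
  exact hf.sub (h1.smul h3)

end Extension

/-! ### The function associated with an automorphic hyperfunction -/

section Existence

/-- Every neighbourhood of the real projective line contains a strip. -/
theorem exists_strip_subset {U : Set (OnePoint ℂ)} (hU : IsOpen U) (hR : realLine ⊆ U) :
    ∃ ε : ℝ, 0 < ε ∧ ε ≤ 1 / 2 ∧ ∀ z : ℂ, |z.im| ≤ ε → (z : OnePoint ℂ) ∈ U := by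
  have hopen : ∀ n : ℕ, IsOpen ((↑) '' {z : ℂ | ((n : ℝ) + 2)⁻¹ < |z.im|} : Set (OnePoint ℂ)) :=
    fun n => OnePoint.isOpen_image_coe.2
      (isOpen_lt continuous_const (continuous_abs.comp Complex.continuous_im))
  obtain ⟨n, hn⟩ := (hU.isClosed_compl.isCompact).elim_directed_cover
    (fun n : ℕ => ((↑) '' {z : ℂ | ((n : ℝ) + 2)⁻¹ < |z.im|} : Set (OnePoint ℂ))) hopen (by
      intro p hp
      have hp' : p ∉ realLine := fun h => hp (hR h)
      induction p with
      | infty => exact absurd infty_mem_realLine hp'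
      | coe z =>
        have h0 : 0 < |z.im| := abs_pos.2 fun h => hp' (coe_mem_realLine.2 h)
        obtain ⟨n, hn⟩ := exists_nat_gt |z.im|⁻¹
        refine Set.mem_iUnion.2 ⟨n, z, ?_, rfl⟩
        exact inv_lt_of_inv_lt₀ h0 (by linarith)) (by
      refine Monotone.directed_le fun m n hmn => Set.image_mono fun z hz => ?_
      refine lt_of_le_of_lt (inv_anti₀ (by positivity) ?_) (show ((m : ℝ) + 2)⁻¹ < |z.im| from hz)
      have : (m : ℝ) ≤ n := by exact_mod_cast hmn
      linarith)
  refine ⟨((n : ℝ) + 2)⁻¹, by positivity, ?_, fun z hz => ?_⟩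
  · rw [one_div]
    exact inv_anti₀ two_pos (by linarith [(n.cast_nonneg : (0 : ℝ) ≤ n)])
  · by_contra h
    obtain ⟨u, hu, huz⟩ := hn h
    rw [OnePoint.coe_eq_coe] at huz
    subst huz
    exact absurd hz (not_le.2 hu)

variable {V : Type*} [NormedAddCommGroup V] [NormedSpace ℂ V]

/-- A function that is holomorphic near the real projective line is bounded on strips: it is
continuous at `∞`, and the closed strip together with `∞` is compact. -/
theorem HolomorphicOn.exists_bound_strip {h : OnePoint ℂ → V} {U : Set (OnePoint ℂ)}
    (hh : HolomorphicOn h U) (hU : IsOpen U) (hinf : ∞ ∈ U) {ε : ℝ}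
    (hε : ∀ z : ℂ, |z.im| ≤ ε → (z : OnePoint ℂ) ∈ U) :
    ∃ C : ℝ, ∀ z : ℂ, |z.im| ≤ ε → ‖h z‖ ≤ C := by
  have hopen : IsOpen ((↑) '' {z : ℂ | ε < |z.im|} : Set (OnePoint ℂ)) :=
    OnePoint.isOpen_image_coe.2
      (isOpen_lt continuous_const (continuous_abs.comp Complex.continuous_im))
  have hnot : ∀ z : ℂ, |z.im| ≤ ε →
      (z : OnePoint ℂ) ∈ ((↑) '' {z : ℂ | ε < |z.im|} : Set (OnePoint ℂ))ᶜ := by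
    rintro z hz ⟨u, hu, huz⟩
    rw [OnePoint.coe_eq_coe] at huz
    subst huz
    exact absurd hz (not_le.2 hu)
  have hsub : ((↑) '' {z : ℂ | ε < |z.im|} : Set (OnePoint ℂ))ᶜ ⊆ U := by
    intro p hp
    induction p with
    | infty => exact hinf
    | coe z =>
      refine hε z ?_
      by_contra! h
      exact hp ⟨z, h, rfl⟩
  obtain ⟨C, hC⟩ := hopen.isClosed_compl.isCompact.exists_bound_of_continuousOn
    (f := h) fun p hp => (hh.continuousAt hU (hsub hp)).continuousWithinAt
  exact ⟨C, fun z hz => hC z (hnot z hz)⟩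

/-- Powers of `1 + z²` are of moderate growth in a strip. -/
theorem exists_norm_one_add_sq_cpow_le (w : ℂ) : ∃ C : ℝ, ∀ z : ℂ, |z.im| ≤ 1 / 2 →
    ‖(1 + z ^ 2) ^ w‖ ≤ C * Real.exp (|z.re| / 2) := by
  -- `|1 + z²| ^ Re w` is at most a multiple of `(1 + |Re z|) ^ m` for `m = 2n`, `n ≥ Re w`;
  -- the base is normalised to be at least `1` in order that the exponent can be raised from `Re w`
  -- to `n`.
  set n : ℕ := ⌈|w.re|⌉₊ + 1 with hn
  have hnw : w.re ≤ n := by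
    rw [hn]
    push_cast
    linarith [Nat.le_ceil |w.re|, le_abs_self w.re]
  set m : ℕ := 2 * n with hm
  have hm0 : (0 : ℝ) < m := by
    have : 0 < m := by omega
    exact_mod_cast this
  refine ⟨(3 / 4 : ℝ) ^ w.re * (3 ^ n * (2 * m) ^ m) * Real.exp (Real.pi * |w.im|), fun z hz => ?_⟩
  set a : ℂ := 1 + z ^ 2 with ha
  have hre : 3 / 4 ≤ a.re := by
    have h := abs_le.1 hz
    have : a.re = 1 + (z.re ^ 2 - z.im ^ 2) := by simp [ha, pow_two]
    rw [this]
    nlinarith [sq_nonneg z.re]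
  have ht : 3 / 4 ≤ ‖a‖ := hre.trans (Complex.re_le_norm a)
  have ha0 : a ≠ 0 := norm_pos_iff.1 (by linarith)
  have htop : 4 / 3 * ‖a‖ ≤ 3 * (1 + |z.re|) ^ 2 := by
    have h1 : ‖a‖ ≤ 1 + ‖z‖ ^ 2 := by
      refine (norm_add_le _ _).trans ?_
      rw [norm_one, norm_pow]
    have h2 : ‖z‖ ^ 2 = z.re ^ 2 + z.im ^ 2 := by rw [Complex.sq_norm, Complex.normSq_apply]; ring
    have h3 := abs_le.1 hz
    have h4 : |z.re| ^ 2 = z.re ^ 2 := sq_abs _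
    nlinarith [abs_nonneg z.re]
  have hexp : (1 + |z.re|) ^ m ≤ (2 * m) ^ m * Real.exp (|z.re| / 2) := by
    have h1 : 1 + |z.re| ≤ 2 * m * Real.exp (|z.re| / (2 * m)) := by
      have h2 := Real.add_one_le_exp (|z.re| / (2 * m))
      have h3 : (1 : ℝ) ≤ m := by
        have : 1 ≤ m := by omega
        exact_mod_cast this
      have h4 : 2 * (m : ℝ) * (|z.re| / (2 * m)) = |z.re| := by field_simp
      nlinarith
    calc (1 + |z.re|) ^ m ≤ (2 * m * Real.exp (|z.re| / (2 * m))) ^ m := by gcongr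
      _ = (2 * m) ^ m * Real.exp (|z.re| / 2) := by
        rw [mul_pow, ← Real.exp_nat_mul]
        congr 2
        field_simp
  have hmod : ‖a ^ w‖ ≤ ‖a‖ ^ w.re * Real.exp (Real.pi * |w.im|) := by
    rw [Complex.norm_cpow_of_ne_zero ha0, div_eq_mul_inv, ← Real.exp_neg]
    gcongr
    have h1 : -(a.arg * w.im) ≤ |a.arg * w.im| := neg_le_abs _
    rw [abs_mul] at h1
    exact h1.trans (mul_le_mul_of_nonneg_right (Complex.abs_arg_le_pi a) (abs_nonneg _))
  have hpow : ‖a‖ ^ w.re ≤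
      (3 / 4 : ℝ) ^ w.re * (3 ^ n * ((2 * m) ^ m * Real.exp (|z.re| / 2))) := by
    have h1 : ‖a‖ = 3 / 4 * (4 / 3 * ‖a‖) := by ring
    rw [h1, Real.mul_rpow (by norm_num) (by positivity)]
    gcongr
    calc (4 / 3 * ‖a‖) ^ w.re ≤ (4 / 3 * ‖a‖) ^ (n : ℝ) :=
          Real.rpow_le_rpow_of_exponent_le (by linarith) hnw
      _ = (4 / 3 * ‖a‖) ^ n := Real.rpow_natCast _ _
      _ ≤ (3 * (1 + |z.re|) ^ 2) ^ n := by gcongr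
      _ = 3 ^ n * (1 + |z.re|) ^ m := by rw [mul_pow, ← pow_mul]
      _ ≤ _ := by gcongr
  calc ‖a ^ w‖ ≤ _ := hmod
    _ ≤ (3 / 4 : ℝ) ^ w.re * (3 ^ n * ((2 * m) ^ m * Real.exp (|z.re| / 2))) *
        Real.exp (Real.pi * |w.im|) := by gcongr
    _ = _ := by ring

/-- The operator `η(T)` has finite order: a power of `T` is a parabolic element of `Γ`. -/
theorem exists_pow_eq_one (Γ : Subgroup PSL(2, ℤ)) [Γ.FiniteIndex]
    (η : Representation ℂ PSL(2, ℤ) V) (hpar : ∀ γ ∈ parabolicSubgroup Γ, η γ = 1) :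
    ∃ N : ℕ, 0 < N ∧ (η T) ^ N = 1 := by
  obtain ⟨N, hN, -, hmem⟩ := Subgroup.exists_pow_mem_of_index_ne_zero
    (Subgroup.FiniteIndex.index_ne_zero (H := Γ)) T
  refine ⟨N, hN, ?_⟩
  rw [← map_pow]
  refine hpar _ (Subgroup.subset_closure ⟨hmem, ModularGroup.T ^ N, ?_, ?_⟩)
  · rw [← coe_T_eq]
    rfl
  · have h1 : (ModularGroup.T ^ N).1 = !![1, (N : ℤ); 0, 1] := by
      have := ModularGroup.coe_T_zpow (N : ℤ)
      rwa [zpow_natCast] at this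
    rw [h1, Matrix.isParabolic_iff_of_upperTriangular (by simp)]
    simp [hN.ne']

/-- A function in `𝓕_η` that represents the zero hyperfunction on `ℝ`, i.e. that extends
across the real line, vanishes by Liouville's theorem: the extension is periodic and bounded, hence
constant, and its limits at `± i∞` are opposite. -/
theorem eq_zero_of_mem_spaceFη {ν : ℂ} {η : Representation ℂ PSL(2, ℤ) V} {N : ℕ} (hN : 0 < N)
    (hη : (η T) ^ N = 1) {f : ℂ → V} (hf : f ∈ spaceFη η)
    (hnull : ∀ x : ℂ, x.im = 0 → affineRepresentative ν f ∈ nullGerms V {(x : OnePoint ℂ)}) :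
    f = 0 := by
  obtain ⟨hf1, hf2, hf3, ⟨C, M, hCM⟩, v, w, hv, hw, hvw⟩ := hf
  obtain ⟨g, hg, hgf⟩ := exists_extension (Ω := Set.univ) (φ := f) (by
    intro x _
    by_cases hx : x.im = 0
    · exact exists_extension_of_smul_mem_nullGerms hx isOpen_univ trivial (hnull x hx)
        fun u _ _ => affineRepresentative_coe ν f u
    · exact ⟨_, isOpen_im_ne_zero, hx, f, hf2, fun u _ _ => rfl⟩)
  have hgf' : ∀ z : ℂ, z.im ≠ 0 → g z = f z := fun z hz => hgf z trivial hz
  have hgd : Differentiable ℂ g := differentiableOn_univ.1 hg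
  have hiter : ∀ (n : ℕ) (z : ℂ), z.im ≠ 0 → f (z + n) = ((η T) ^ n) (f z) := by
    intro n
    induction n with
    | zero => intro z _; simp
    | succ n ih =>
      intro z hz
      have := hf3 (z + n) (by simpa using hz)
      rw [pow_succ', Module.End.mul_apply, ← ih z hz, ← this]
      congr 1
      push_cast
      ring
  have hper : Function.Periodic g (N : ℂ) := by
    intro z
    refine eq_of_eq_off_real (g₁ := fun z => g (z + N)) isOpen_univ
      (hgd.continuous.comp (continuous_add_const _)).continuousOn hgd.continuous.continuousOn
      (fun u _ hu => ?_) z trivial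
    have hu' : (u + N).im ≠ 0 := by simpa using hu
    rw [hgf' _ hu', hgf' _ hu, hiter N u hu, hη]
    rfl
  have hN' : (0 : ℝ) < N := by exact_mod_cast hN
  obtain ⟨C', hC'⟩ := ((isCompact_Icc (a := (0 : ℝ)) (b := N)).reProdIm
    (isCompact_Icc (a := -|M| - 1) (b := |M| + 1))).exists_bound_of_continuousOn
      hgd.continuous.continuousOn
  have hbdd : Bornology.IsBounded (Set.range g) := by
    rw [isBounded_iff_forall_norm_le]
    refine ⟨max C C', ?_⟩
    rintro _ ⟨z, rfl⟩
    by_cases hz : |M| + 1 ≤ |z.im|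
    · have h0 : z.im ≠ 0 := by
        intro h
        rw [h, abs_zero] at hz
        linarith [abs_nonneg M]
      rw [hgf' z h0]
      exact (hCM z (by linarith [le_abs_self M])).trans (le_max_left _ _)
    · rw [not_le] at hz
      have h1 := hper.sub_zsmul_eq (x := z) ⌊z.re / N⌋
      rw [← h1]
      refine (hC' _ ?_).trans (le_max_right _ _)
      have hlt := abs_lt.1 hz
      have hfl := Int.floor_le (z.re / N)
      have hfl2 := (Int.lt_floor_add_one (z.re / N)).le
      rw [le_div_iff₀ hN'] at hfl
      rw [div_le_iff₀ hN'] at hfl2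
      have hre : (z - ⌊z.re / N⌋ • (N : ℂ)).re = z.re - ⌊z.re / N⌋ * N := by simp
      have him : (z - ⌊z.re / N⌋ • (N : ℂ)).im = z.im := by simp
      refine ⟨?_, ?_⟩
      · rw [Set.mem_preimage, hre]
        constructor <;> linarith
      · rw [Set.mem_preimage, him]
        constructor <;> linarith
  obtain ⟨c, hc⟩ := hgd.exists_const_forall_eq_of_bounded hbdd
  have hfc : ∀ z : ℂ, z.im ≠ 0 → f z = c := fun z hz => by rw [← hgf' z hz, hc]
  have hcv : c = v := tendsto_nhds_unique (tendsto_const_nhds.congr' (by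
    filter_upwards [eventually_atUpper 0] with z hz using (hfc z hz.ne').symm)) hv
  have hcw : c = w := tendsto_nhds_unique (tendsto_const_nhds.congr' (by
    filter_upwards [eventually_atLower 0] with z hz using (hfc z hz.ne).symm)) hw
  have hc0 : c = 0 := by
    rw [← hcv, ← hcw, ← two_smul ℂ] at hvw
    exact (smul_eq_zero.1 hvw).resolve_left two_ne_zero
  funext z
  by_cases hz : z.im = 0
  · exact hf1 z hz
  · rw [hfc z hz, hc0]
    rfl

variable [FiniteDimensional ℂ V]

theorem toContinuousLinearMap_pow_eq_one {L : V →ₗ[ℂ] V} {N : ℕ} (h : L ^ N = 1) :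
    (LinearMap.toContinuousLinearMap L) ^ N = 1 := by
  have h1 : ∀ n : ℕ, ∀ v, ((LinearMap.toContinuousLinearMap L) ^ n) v = (L ^ n) v := by
    intro n
    induction n with
    | zero => intro v; simp
    | succ n ih =>
      intro v
      rw [pow_succ', pow_succ', mul_apply_eq_comp, ih]
      rfl
  ext v
  rw [h1, h]
  rfl

/-- Existence of an equivariant function on `ℂ ∖ ℝ` representing the restriction to `ℝ` of a
hyperfunction invariant under `T`. -/
theorem exists_mem_spaceFη {ν : ℂ} {η : Representation ℂ PSL(2, ℤ) V} {N : ℕ} (hN : 0 < N)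
    (hη : (η T) ^ N = 1) {F : OnePoint ℂ → V} (hF : F ∈ boundaryGerms V realLine)
    (hT : ∀ p ∈ realLine, FixedAt ν η F ModularGroup.T p) :
    ∃ f ∈ spaceFη η, ∀ x : ℂ, x.im = 0 →
      affineRepresentative ν f - F ∈ nullGerms V {(x : OnePoint ℂ)} := by
  obtain ⟨U₁, hU₁, hR₁, hFd⟩ := hF
  obtain ⟨U₂, hU₂, hR₂, h, hh, hFh⟩ := mem_nullGerms_iff.2 hT
  obtain ⟨ε, hε0, hε1, hεU⟩ := exists_strip_subset (hU₁.inter hU₂) (Set.subset_inter hR₁ hR₂)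
  obtain ⟨C₁, hC₁⟩ := hh.exists_bound_strip hU₂ (hR₂ infty_mem_realLine) fun z hz => (hεU z hz).2
  set μ : ℂ := ν + 1 / 2 with hμ
  obtain ⟨C₂, hC₂⟩ := exists_norm_one_add_sq_cpow_le (-μ)
  have hlt : ∀ {z : ℂ}, |z.im| < ε → |z.im| < 1 := fun hz => by linarith
  have hne : ∀ {z : ℂ}, |z.im| < ε → (1 + z ^ 2) ^ μ ≠ 0 := fun hz =>
    one_add_sq_cpow_ne_zero (hlt hz) μ
  have hpd : DifferentiableOn ℂ (fun z : ℂ => ((1 + z ^ 2) ^ μ)⁻¹) {z | |z.im| < ε} :=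
    ((differentiableOn_one_add_sq_cpow μ).mono fun z hz => hlt hz).inv fun z hz => hne hz
  set A := LinearMap.toContinuousLinearMap (η T) with hA
  set f₀ : ℂ → V := fun z => ((1 + z ^ 2) ^ μ)⁻¹ • F z with hf₀
  obtain ⟨f, hf1, hf2, hf3, ⟨v, w, hv, hw, hvw⟩, k, hk, hfk⟩ := exists_equivariant_representative
    (f₀ := f₀) (h := fun z => -(((1 + z ^ 2) ^ μ)⁻¹ • h z)) (C := C₂ * C₁) hε0 (by linarith) hN
    (toContinuousLinearMap_pow_eq_one hη)
    (by
      refine (hpd.mono fun z hz => hz.1).smul (hFd.1.mono fun z hz => ?_)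
      exact ⟨(hεU z (show |z.im| < ε from hz.1).le).1, fun h => hz.2 (coe_mem_realLine.1 h)⟩)
    (by
      exact (hpd.smul (hh.1.mono fun z hz => (hεU z (show |z.im| < ε from hz).le).2)).neg)
    (by
      intro z hz
      rw [norm_neg, norm_smul, ← Complex.cpow_neg]
      have h1 := hC₂ z (hz.le.trans hε1)
      have h2 := hC₁ z hz.le
      calc _ ≤ C₂ * Real.exp (|z.re| / 2) * C₁ :=
            mul_le_mul h1 h2 (norm_nonneg _) ((norm_nonneg _).trans h1)
        _ = _ := by ring)
    (by
      intro z hz hz0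
      have h1 := hFh ⟨(hεU z hz.le).2, fun h => hz0 (coe_mem_realLine.1 h)⟩
      rw [Pi.sub_apply, twistedAction_T_coe ν η F (hlt hz)] at h1
      rw [← h1, smul_sub, smul_smul, inv_mul_cancel₀ (hne hz), one_smul, neg_sub]
      rfl)
  refine ⟨f, ⟨hf1, hf2, hf3, exists_bound_of_tendsto hv hw, v, w, hv, hw, hvw⟩, fun x hx => ?_⟩
  rw [coe_mem_nullGerms_iff]
  refine ⟨{z | |z.im| < ε / 2}, isOpen_strip _, by simp [hx, hε0],
    fun z => (1 + z ^ 2) ^ μ • k z, ?_, ?_⟩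
  · refine ((differentiableOn_one_add_sq_cpow μ).mono fun z hz => ?_).smul hk
    exact hlt ((show |z.im| < ε / 2 from hz).trans (half_lt_self hε0))
  · intro u hu hu0
    simp only
    rw [← hfk u hu hu0, Pi.sub_apply, affineRepresentative_coe, smul_sub]
    simp only [hf₀]
    rw [smul_smul, mul_inv_cancel₀ (hne (lt_trans hu (half_lt_self hε0))), one_smul]

/-- If `z ↦ (1 + z²) ^ (ν + 1/2) f(z)` represents the restriction of a hyperfunction that is
invariant under `S`, then the Bruggeman expression of `f` extends across the positive real axis. -/
theorem exists_extension_bruggemanExpr {ν : ℂ} {η : Representation ℂ PSL(2, ℤ) V}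
    {F : OnePoint ℂ → V} (hS : ∀ p ∈ realLine, FixedAt ν η F ModularGroup.S p) {f : ℂ → V}
    (hf : DifferentiableOn ℂ f {z | z.im ≠ 0})
    (hfF : ∀ x : ℂ, x.im = 0 → affineRepresentative ν f - F ∈ nullGerms V {(x : OnePoint ℂ)}) :
    ∃ g : ℂ → V, DifferentiableOn ℂ g Complex.slitPlane ∧
      ∀ z : ℂ, z.im ≠ 0 → g z = bruggemanExpr ν η f z := by
  obtain ⟨g, hg, hgf⟩ := exists_extension (Ω := Complex.slitPlane) (φ := bruggemanExpr ν η f) (by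
    intro x hx
    by_cases hx0 : x.im = 0
    · have hre : 0 < x.re := hx.resolve_right (not_not.2 hx0)
      have hxne : x ≠ 0 := by
        rintro rfl
        simp at hre
      have hxim : (-1 / x).im = 0 := by rw [im_neg_one_div, hx0, zero_div]
      have h1 := hfF x hx0
      have h2 := twistedAction_mem_nullGerms ν η (γ := ModularGroup.S) (p := (x : OnePoint ℂ))
        (coe_mem_realLine.2 hx0) (F := affineRepresentative ν f - F) (by
          rw [moebiusInv_S_coe hxne]
          exact hfF _ hxim)
      have h3 := hS x (coe_mem_realLine.2 hx0)
      have h4 := sub_mem (sub_mem h1 h2) h3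
      have h5 : affineRepresentative ν f - twistedAction ν η ModularGroup.S
          (affineRepresentative ν f) ∈ nullGerms V {(x : OnePoint ℂ)} := by
        convert h4 using 1
        rw [map_sub]
        abel
      refine exists_extension_of_smul_mem_nullGerms (μ := ν + 1 / 2) hx0
        (W := {z : ℂ | |z.im| < z.re})
        (isOpen_lt (continuous_abs.comp Complex.continuous_im) Complex.continuous_re)
        (by simpa [hx0] using hre) h5 fun u hu _ => ?_
      exact affineRepresentative_sub_S ν η f hu
    · exact ⟨_, isOpen_im_ne_zero, hx0, _, differentiableOn_bruggemanExpr ν η hf,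
        fun u _ _ => rfl⟩)
  exact ⟨g, hg, fun z hz => hgf z (mem_slitPlane_of_im_ne_zero hz) hz⟩

end Existence

/-! ### The Lewis equation -/

section Lewis

theorem ne_zero_of_im_ne_zero {z : ℂ} (hz : z.im ≠ 0) : z ≠ 0 := by
  rintro rfl
  exact hz Complex.zero_im

/-- The factor `1 + e^{∓2πiν}` that relates `f` to `ψ(z) + z ^ (-2ν-1) η(S) ψ(-1/z)` on the upper,
respectively lower, half-plane. -/
def branchFactor (ν z : ℂ) : ℂ :=
  1 + Complex.exp ((if 0 < z.im then -1 else 1) * (2 * Real.pi * Complex.I * ν))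

theorem branchFactor_of_pos (ν : ℂ) {z : ℂ} (hz : 0 < z.im) :
    branchFactor ν z = 1 + Complex.exp (-(2 * Real.pi * Complex.I * ν)) := by
  rw [branchFactor, if_pos hz, neg_one_mul]

theorem branchFactor_of_neg (ν : ℂ) {z : ℂ} (hz : z.im < 0) :
    branchFactor ν z = 1 + Complex.exp (2 * Real.pi * Complex.I * ν) := by
  rw [branchFactor, if_neg hz.le.not_gt, one_mul]

theorem im_neg_one_div_pos_iff {z : ℂ} (hz : z ≠ 0) : 0 < (-1 / z).im ↔ 0 < z.im := by
  rw [im_neg_one_div, div_pos_iff_of_pos_right (Complex.normSq_pos.2 hz)]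

theorem branchFactor_neg_one_div (ν : ℂ) {z : ℂ} (hz : z ≠ 0) :
    branchFactor ν (-1 / z) = branchFactor ν z := by
  simp only [branchFactor, im_neg_one_div_pos_iff hz]

theorem branchFactor_add_one (ν z : ℂ) : branchFactor ν (z + 1) = branchFactor ν z := by
  simp [branchFactor]

/-- The principal powers of `z` and `-1/z` do not cancel: `log z + log (-1/z)` is `πi` on the upper
and `-πi` on the lower half-plane. -/
theorem cpow_mul_neg_one_div_cpow (ν : ℂ) {z : ℂ} (hz : z.im ≠ 0) :
    z ^ (-2 * ν - 1) * (-1 / z) ^ (-2 * ν - 1) = 1 - branchFactor ν z := by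
  have hz0 := ne_zero_of_im_ne_zero hz
  have hne : (-z).arg ≠ Real.pi := fun h => hz (by simpa using (Complex.arg_eq_pi_iff.1 h).2)
  have hlog : Complex.log (-1 / z) = -Complex.log (-z) := by
    rw [← Complex.log_inv _ hne]
    congr 1
    field_simp
  have hexp : Complex.exp (-(Real.pi * Complex.I)) = -1 := by
    rw [Complex.exp_neg, Complex.exp_pi_mul_I]
    norm_num
  rw [Complex.cpow_def_of_ne_zero hz0, Complex.cpow_def_of_ne_zero (by simpa using hz0),
    ← Complex.exp_add, hlog]
  rcases lt_or_gt_of_ne hz with h | h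
  · have h1 : Complex.log (-z) = Complex.log z + Real.pi * Complex.I := by
      rw [Complex.log, Complex.log, norm_neg, Complex.arg_neg_eq_arg_add_pi_of_im_neg h]
      push_cast
      ring
    rw [h1, branchFactor_of_neg ν h]
    have h2 : Complex.log z * (-2 * ν - 1) + -(Complex.log z + Real.pi * Complex.I) * (-2 * ν - 1) =
        2 * Real.pi * Complex.I * ν + Real.pi * Complex.I := by ring
    rw [h2, Complex.exp_add, Complex.exp_pi_mul_I]
    ring
  · have h1 : Complex.log (-z) = Complex.log z - Real.pi * Complex.I := by
      rw [Complex.log, Complex.log, norm_neg, Complex.arg_neg_eq_arg_sub_pi_of_im_pos h]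
      push_cast
      ring
    rw [h1, branchFactor_of_pos ν h]
    have h2 : Complex.log z * (-2 * ν - 1) + -(Complex.log z - Real.pi * Complex.I) * (-2 * ν - 1) =
        -(2 * Real.pi * Complex.I * ν) + -(Real.pi * Complex.I) := by ring
    rw [h2, Complex.exp_add, hexp]
    ring

theorem add_one_cpow_mul_div_cpow (s : ℂ) {z : ℂ} (hz : z.im ≠ 0) :
    (z + 1) ^ s * (z / (z + 1)) ^ s = z ^ s := by
  have h1 : (z + 1).im = z.im := by simp
  rw [div_cpow_of_im, mul_div_cancel₀]
  · rw [Ne, Complex.cpow_eq_zero_iff]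
    exact fun h => ne_zero_of_im_ne_zero (h1 ▸ hz) h.1
  · rw [h1]
    rcases lt_or_gt_of_ne hz with h | h
    exacts [Or.inr ⟨h, h⟩, Or.inl ⟨h, h⟩]

variable {V : Type*} [NormedAddCommGroup V] [NormedSpace ℂ V] (ν : ℂ)
  (η : Representation ℂ PSL(2, ℤ) V)

theorem S_mul_S : S * S = 1 := by
  have h : ModularGroup.S * ModularGroup.S = (-1 : SL(2, ℤ)) := by
    ext i j
    rw [Matrix.SpecialLinearGroup.coe_mul, ModularGroup.coe_S, Matrix.SpecialLinearGroup.coe_neg]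
    fin_cases i <;> fin_cases j <;> simp [Matrix.mul_apply, Fin.sum_univ_two]
  rw [← coe_S_eq]
  refine (QuotientGroup.eq_one_iff (N := Subgroup.center SL(2, ℤ))
    (ModularGroup.S * ModularGroup.S)).2 ?_
  rw [h]
  exact Subgroup.mem_center_iff.2 fun g => by rw [mul_neg, neg_mul, mul_one, one_mul]

theorem S_T_relation : S * T⁻¹ * (S * T⁻¹) = T * S := by
  have h := congrArg (QuotientGroup.mk : SL(2, ℤ) → PSL(2, ℤ)) ModularGroup_S_T_relation
  have h' : T = S * T⁻¹ * S * T⁻¹ * S := by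
    rw [← coe_S_eq, ← coe_T_eq]
    exact h
  nth_rewrite 3 [h']
  rw [mul_assoc _ S S, S_mul_S, mul_one]
  simp only [mul_assoc]

theorem rep_S_S (v : V) : η S (η S v) = v := by
  rw [← Module.End.mul_apply, ← map_mul, S_mul_S, map_one]
  rfl

theorem rep_S_T_inv_T (v : V) : η (S * T⁻¹) (η T v) = η S v := by
  rw [← Module.End.mul_apply, ← map_mul, inv_mul_cancel_right]

theorem rep_relation (v : V) : η (S * T⁻¹) (η (S * T⁻¹) v) = η T (η S v) := by
  rw [← Module.End.mul_apply, ← map_mul, S_T_relation, map_mul]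
  rfl

variable {η}

/-- The Lewis equation off the real line: the terms in `f(z/(z+1))` and `f(-1/(z+1))` cancel because
of periodicity, the others match because of the relation `S T⁻¹ S T⁻¹ = T S`. -/
theorem bruggemanExpr_lewis {f : ℂ → V} (hf : ∀ z : ℂ, z.im ≠ 0 → f (z + 1) = η T (f z)) {z : ℂ}
    (hz : z.im ≠ 0) :
    η T (bruggemanExpr ν η f z) = bruggemanExpr ν η f (z + 1) +
      (z + 1) ^ (-2 * ν - 1) • η (S * T⁻¹) (bruggemanExpr ν η f (z / (z + 1))) := by
  have hz0 := ne_zero_of_im_ne_zero hz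
  have hz1 : (z + 1).im ≠ 0 := by simpa using hz
  have hz10 := ne_zero_of_im_ne_zero hz1
  have e1 : z / (z + 1) = -1 / (z + 1) + 1 := by field_simp; ring
  have h1 : f (z / (z + 1)) = η T (f (-1 / (z + 1))) := by
    rw [e1, hf _ (im_neg_one_div_ne_zero hz1)]
  have e2 : -1 / (z / (z + 1)) + 1 = -1 / z := by field_simp; ring
  have hz2 : (z / (z + 1)).im ≠ 0 := by
    rw [e1]
    simpa using im_neg_one_div_ne_zero hz1
  have h2 : f (-1 / z) = η T (f (-1 / (z / (z + 1)))) := by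
    rw [← hf _ (im_neg_one_div_ne_zero hz2), e2]
  have h3 : η (S * T⁻¹) (η S (f (-1 / (z / (z + 1))))) = η T (η S (f (-1 / z))) := by
    rw [h2, ← rep_relation, rep_S_T_inv_T]
  simp only [bruggemanExpr]
  rw [hf z hz, map_sub, map_smul, map_sub, map_smul, h1, rep_S_T_inv_T, h3, smul_sub, smul_smul,
    add_one_cpow_mul_div_cpow _ hz]
  abel

/-- Applying the inversion expression to the Bruggeman expression returns a multiple of `f`. -/
theorem inversionExpr_of_eq {f ψ : ℂ → V} (hψ : ∀ z : ℂ, z.im ≠ 0 → ψ z = bruggemanExpr ν η f z)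
    {z : ℂ} (hz : z.im ≠ 0) : inversionExpr ν η ψ z = branchFactor ν z • f z := by
  have hz0 := ne_zero_of_im_ne_zero hz
  have e : -1 / (-1 / z) = z := by field_simp
  rw [inversionExpr, hψ z hz, hψ _ (im_neg_one_div_ne_zero hz), bruggemanExpr, bruggemanExpr, e,
    map_sub, map_smul, rep_S_S, smul_sub, smul_smul, cpow_mul_neg_one_div_cpow ν hz, sub_smul,
    one_smul]
  abel

/-- Applying the Bruggeman expression to the inversion expression returns a multiple of `ψ`. -/
theorem bruggemanExpr_of_eq {f ψ : ℂ → V}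
    (hf : ∀ z : ℂ, z.im ≠ 0 → branchFactor ν z • f z = inversionExpr ν η ψ z)
    {z : ℂ} (hz : z.im ≠ 0) :
    branchFactor ν z • bruggemanExpr ν η f z = branchFactor ν z • ψ z := by
  have hz0 := ne_zero_of_im_ne_zero hz
  have e : -1 / (-1 / z) = z := by field_simp
  have h1 := hf z hz
  have h2 := hf _ (im_neg_one_div_ne_zero hz)
  rw [branchFactor_neg_one_div ν hz0, inversionExpr, e] at h2
  rw [bruggemanExpr, smul_sub, h1, inversionExpr, smul_comm (branchFactor ν z),
    ← map_smul _ (branchFactor ν z), h2, map_add, map_smul,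
    rep_S_S, smul_add, smul_smul, cpow_mul_neg_one_div_cpow ν hz, sub_smul, one_smul]
  abel

/-- The Lewis equation makes the inversion expression equivariant under translation. -/
theorem inversionExpr_add_one {ψ : ℂ → V}
    (hψ : ∀ z ∈ Complex.slitPlane, η T (ψ z) =
      ψ (z + 1) + (z + 1) ^ (-2 * ν - 1) • η (S * T⁻¹) (ψ (z / (z + 1)))) {z : ℂ}
    (hz : z.im ≠ 0) : inversionExpr ν η ψ (z + 1) = η T (inversionExpr ν η ψ z) := by
  have hz0 := ne_zero_of_im_ne_zero hz
  have hz1 : (z + 1).im ≠ 0 := by simpa using hz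
  have hz10 := ne_zero_of_im_ne_zero hz1
  have h1 := hψ z (mem_slitPlane_of_im_ne_zero hz)
  have h2 := hψ (-1 / (z + 1)) (mem_slitPlane_of_im_ne_zero (im_neg_one_div_ne_zero hz1))
  have e1 : -1 / (z + 1) + 1 = z / (z + 1) := by field_simp; ring
  have e2 : -1 / (z + 1) / (z / (z + 1)) = -1 / z := by field_simp
  rw [e1, e2] at h2
  -- The sum of the Lewis equation at `z` and the transformed Lewis equation at `-1 / (z + 1)`.
  have h3 := congrArg (fun v => (z + 1) ^ (-2 * ν - 1) • η (S * T⁻¹) v) h2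
  simp only [rep_S_T_inv_T, map_add, map_smul, rep_relation, smul_add, smul_smul,
    add_one_cpow_mul_div_cpow _ hz] at h3
  rw [inversionExpr, inversionExpr, h3, map_add, map_smul, h1]
  abel

/-- Opposite limits of `f` at `± i∞` correspond to the limit condition on `ψ`: both factors
`e^{±πiν} (1 + e^{∓2πiν})` are equal to `e^{πiν} + e^{-πiν}`. -/
theorem exp_smul_branch (v w : V) (h : v + w = 0) :
    Complex.exp (Real.pi * Complex.I * ν) •
      ((1 + Complex.exp (-(2 * Real.pi * Complex.I * ν))) • v) +
    Complex.exp (-(Real.pi * Complex.I * ν)) •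
      ((1 + Complex.exp (2 * Real.pi * Complex.I * ν)) • w) = 0 := by
  have e1 : Complex.exp (Real.pi * Complex.I * ν) *
      (1 + Complex.exp (-(2 * Real.pi * Complex.I * ν))) =
      Complex.exp (Real.pi * Complex.I * ν) + Complex.exp (-(Real.pi * Complex.I * ν)) := by
    rw [mul_add, mul_one, ← Complex.exp_add]
    ring_nf
  have e2 : Complex.exp (-(Real.pi * Complex.I * ν)) *
      (1 + Complex.exp (2 * Real.pi * Complex.I * ν)) =
      Complex.exp (Real.pi * Complex.I * ν) + Complex.exp (-(Real.pi * Complex.I * ν)) := by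
    rw [mul_add, mul_one, ← Complex.exp_add]
    ring_nf
  rw [smul_smul, smul_smul, e1, e2, ← smul_add, h, smul_zero]

/-- The Bruggeman expression of a function in `𝓕_{ν,η}` extends to an element of `Ψ_{ν,η}`. -/
theorem exists_mem_spacePsi [FiniteDimensional ℂ V] {f : ℂ → V} (hf : f ∈ spaceF ν η) :
    ∃ ψ ∈ spacePsi ν η, ∀ z : ℂ, z.im ≠ 0 → ψ z = bruggemanExpr ν η f z := by
  classical
  obtain ⟨⟨hf1, hf2, hf3, -, v, w, hv, hw, hvw⟩, g, hg, hgf⟩ := hf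
  set ψ : ℂ → V := fun z => if z ∈ Complex.slitPlane then g z else 0 with hψ
  have hψg : ∀ z ∈ Complex.slitPlane, ψ z = g z := fun z hz => if_pos hz
  have hψd : DifferentiableOn ℂ ψ Complex.slitPlane := hg.congr hψg
  have hψf : ∀ z : ℂ, z.im ≠ 0 → ψ z = bruggemanExpr ν η f z := fun z hz => by
    rw [hψg z (mem_slitPlane_of_im_ne_zero hz), hgf z hz]
  have hslit1 : ∀ z ∈ Complex.slitPlane, z + 1 ∈ Complex.slitPlane := by
    rintro z (hz | hz)
    · exact Or.inl (by rw [Complex.add_re, Complex.one_re]; linarith)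
    · exact Or.inr (by simpa using hz)
  have hslit2 : ∀ z ∈ Complex.slitPlane, z / (z + 1) ∈ Complex.slitPlane := by
    intro z hz
    have hz1 := Complex.slitPlane_ne_zero (hslit1 z hz)
    by_cases h0 : z.im = 0
    · have hre : 0 < z.re := hz.resolve_right (not_not.2 h0)
      obtain ⟨x, rfl⟩ : ∃ x : ℝ, z = x := ⟨z.re, Complex.ext rfl (by simp [h0])⟩
      rw [Complex.ofReal_re] at hre
      refine Or.inl ?_
      have : (x : ℂ) / (x + 1) = ((x / (x + 1) : ℝ) : ℂ) := by push_cast; rfl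
      rw [this, Complex.ofReal_re]
      positivity
    · have e1 : z / (z + 1) = -1 / (z + 1) + 1 := by field_simp; ring
      refine Or.inr ?_
      rw [e1]
      simpa using im_neg_one_div_ne_zero (z := z + 1) (by simpa using h0)
  have hlewis : ∀ z ∈ Complex.slitPlane, η T (ψ z) =
      ψ (z + 1) + (z + 1) ^ (-2 * ν - 1) • η (S * T⁻¹) (ψ (z / (z + 1))) := by
    have hd1 : DifferentiableOn ℂ (fun z => η T (ψ z)) Complex.slitPlane :=
      (LinearMap.toContinuousLinearMap (η T)).differentiable.comp_differentiableOn hψd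
    have hd2 : DifferentiableOn ℂ (fun z => ψ (z + 1)) Complex.slitPlane :=
      hψd.comp (by fun_prop) hslit1
    have hd3 : DifferentiableOn ℂ (fun z : ℂ => (z + 1) ^ (-2 * ν - 1)) Complex.slitPlane :=
      fun z hz => ((differentiableAt_id.add_const 1).cpow (differentiableAt_const _)
        (hslit1 z hz)).differentiableWithinAt
    have hd4 : DifferentiableOn ℂ (fun z : ℂ => z / (z + 1)) Complex.slitPlane :=
      fun z hz => (differentiableAt_id.div (differentiableAt_id.add_const (1 : ℂ))
        (Complex.slitPlane_ne_zero (hslit1 z hz))).differentiableWithinAt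
    have hd5 : DifferentiableOn ℂ (fun z => η (S * T⁻¹) (ψ (z / (z + 1)))) Complex.slitPlane :=
      (LinearMap.toContinuousLinearMap (η (S * T⁻¹))).differentiable.comp_differentiableOn
        (hψd.comp hd4 hslit2)
    refine eq_of_eq_off_real Complex.isOpen_slitPlane hd1.continuousOn
      (hd2.add (hd3.smul hd5)).continuousOn fun z hz hz0 => ?_
    have e1 : z / (z + 1) = -1 / (z + 1) + 1 := by
      have := Complex.slitPlane_ne_zero (hslit1 z hz)
      field_simp
      ring
    have hz2 : (z / (z + 1)).im ≠ 0 := by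
      rw [e1]
      simpa using im_neg_one_div_ne_zero (z := z + 1) (by simpa using hz0)
    rw [hψf z hz0, hψf (z + 1) (by simpa using hz0), hψf _ hz2]
    exact bruggemanExpr_lewis ν hf3 hz0
  refine ⟨ψ, ⟨fun z hz => if_neg hz, hψd, hlewis, _, _, ?_, ?_, exp_smul_branch ν v w hvw⟩, hψf⟩
  · refine (hv.const_smul _).congr' ?_
    filter_upwards [eventually_atUpper 0] with z hz
    rw [inversionExpr_of_eq ν hψf hz.ne', branchFactor_of_pos ν hz]
  · refine (hw.const_smul _).congr' ?_
    filter_upwards [eventually_atLower 0] with z hz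
    rw [inversionExpr_of_eq ν hψf hz.ne, branchFactor_of_neg ν hz]

theorem one_add_exp_ne_zero {ν : ℂ} (hν : ∀ n : ℤ, ν ≠ 1 / 2 + n) :
    1 + Complex.exp (2 * Real.pi * Complex.I * ν) ≠ 0 := by
  intro h
  have h1 : Complex.exp (2 * Real.pi * Complex.I * ν) = Complex.exp (Real.pi * Complex.I) := by
    rw [Complex.exp_pi_mul_I]
    linear_combination h
  obtain ⟨n, hn⟩ := Complex.exp_eq_exp_iff_exists_int.1 h1
  refine hν n ?_
  have hpi : (2 * Real.pi * Complex.I : ℂ) ≠ 0 := Complex.two_pi_I_ne_zero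
  apply mul_left_cancel₀ hpi
  rw [hn]
  ring

theorem branchFactor_ne_zero {ν : ℂ} (hν : ∀ n : ℤ, ν ≠ 1 / 2 + n) (z : ℂ) :
    branchFactor ν z ≠ 0 := by
  have h1 := one_add_exp_ne_zero hν
  rw [branchFactor]
  split_ifs
  · rw [neg_one_mul, Complex.exp_neg]
    intro h
    apply h1
    have := Complex.exp_ne_zero (2 * Real.pi * Complex.I * ν)
    field_simp at h
    linear_combination h
  · rwa [one_mul]

/-- For `ν ∉ 1/2 + ℤ` every element of `Ψ_{ν,η}` is the Bruggeman expression of an element of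
`𝓕_{ν,η}`. -/
theorem exists_mem_spaceF [FiniteDimensional ℂ V] {ν : ℂ} (hν : ∀ n : ℤ, ν ≠ 1 / 2 + n) {ψ : ℂ → V}
    (hψ : ψ ∈ spacePsi ν η) :
    ∃ f ∈ spaceF ν η, ∀ z : ℂ, z.im ≠ 0 → ψ z = bruggemanExpr ν η f z := by
  classical
  obtain ⟨-, hψd, hψl, v, w, hv, hw, hvw⟩ := hψ
  set f : ℂ → V := fun z => if z.im = 0 then 0 else (branchFactor ν z)⁻¹ • inversionExpr ν η ψ z
    with hf
  have hff : ∀ z : ℂ, z.im ≠ 0 → f z = (branchFactor ν z)⁻¹ • inversionExpr ν η ψ z :=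
    fun z hz => if_neg hz
  have hff' : ∀ z : ℂ, z.im ≠ 0 → branchFactor ν z • f z = inversionExpr ν η ψ z := fun z hz => by
    rw [hff z hz, smul_smul, mul_inv_cancel₀ (branchFactor_ne_zero hν z), one_smul]
  have hψf : ∀ z : ℂ, z.im ≠ 0 → ψ z = bruggemanExpr ν η f z := fun z hz =>
    (smul_right_injective V (branchFactor_ne_zero hν z) (bruggemanExpr_of_eq ν hff' hz)).symm
  -- The inversion expression is `2ψ` minus the Bruggeman expression of `ψ`.
  have hinvd : DifferentiableOn ℂ (inversionExpr ν η ψ) {z | z.im ≠ 0} := by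
    have h := differentiableOn_bruggemanExpr ν η
      (hψd.mono fun z (hz : z ∈ {z : ℂ | z.im ≠ 0}) => mem_slitPlane_of_im_ne_zero hz)
    have h2 : DifferentiableOn ℂ ψ {z | z.im ≠ 0} :=
      hψd.mono fun z hz => mem_slitPlane_of_im_ne_zero hz
    refine ((h2.const_smul (2 : ℂ)).sub h).congr fun z hz => ?_
    rw [Pi.sub_apply, Pi.smul_apply, two_smul, inversionExpr, bruggemanExpr]
    abel
  have hfd : DifferentiableOn ℂ f {z | z.im ≠ 0} := by
    have h := differentiableOn_im_ne_zero
      (f := fun z => (1 + Complex.exp (-(2 * Real.pi * Complex.I * ν)))⁻¹ • inversionExpr ν η ψ z)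
      (g := fun z => (1 + Complex.exp (2 * Real.pi * Complex.I * ν))⁻¹ • inversionExpr ν η ψ z)
      ((hinvd.mono fun z hz => ne_of_gt hz).const_smul _)
      ((hinvd.mono fun z hz => ne_of_lt hz).const_smul _)
    refine h.congr fun z hz => ?_
    rw [hff z hz]
    rcases lt_or_gt_of_ne (show z.im ≠ 0 from hz) with h0 | h0
    · rw [if_neg h0.le.not_gt, if_pos h0, branchFactor_of_neg ν h0]
    · rw [if_pos h0, branchFactor_of_pos ν h0]
  have hfv : Tendsto f atUpper
      (𝓝 ((1 + Complex.exp (-(2 * Real.pi * Complex.I * ν)))⁻¹ • v)) := by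
    refine (hv.const_smul _).congr' ?_
    filter_upwards [eventually_atUpper 0] with z hz
    rw [hff z hz.ne', branchFactor_of_pos ν hz]
  have hfw : Tendsto f atLower (𝓝 ((1 + Complex.exp (2 * Real.pi * Complex.I * ν))⁻¹ • w)) := by
    refine (hw.const_smul _).congr' ?_
    filter_upwards [eventually_atLower 0] with z hz
    rw [hff z hz.ne, branchFactor_of_neg ν hz]
  refine ⟨f, ⟨⟨fun z hz => if_pos hz, hfd, fun z hz => ?_, exists_bound_of_tendsto hfv hfw, _, _,
    hfv, hfw, ?_⟩, ψ, hψd, hψf⟩, hψf⟩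
  · have hz' : (z + 1).im ≠ 0 := by simpa using hz
    rw [hff z hz, hff _ hz', inversionExpr_add_one ν hψl hz, branchFactor_add_one, map_smul]
  · have h1 := one_add_exp_ne_zero hν
    set E := Complex.exp (Real.pi * Complex.I * ν) with hE
    have hE0 : E ≠ 0 := Complex.exp_ne_zero _
    have e1 : Complex.exp (2 * Real.pi * Complex.I * ν) = E ^ 2 := by
      rw [hE, ← Complex.exp_nat_mul]
      push_cast
      ring_nf
    have e2 : Complex.exp (-(Real.pi * Complex.I * ν)) = E⁻¹ := Complex.exp_neg _
    have e3 : Complex.exp (-(2 * Real.pi * Complex.I * ν)) = (E ^ 2)⁻¹ := by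
      rw [Complex.exp_neg, e1]
    rw [e1] at h1
    rw [e2] at hvw
    rw [e1, e3]
    have c1 : (1 + (E ^ 2)⁻¹)⁻¹ = E / (1 + E ^ 2) * E := by
      have h2 : E ^ 2 + 1 ≠ 0 := by rwa [add_comm]
      field_simp
      ring
    have c2 : (1 + E ^ 2)⁻¹ = E / (1 + E ^ 2) * E⁻¹ := by
      field_simp
    rw [c1, c2, mul_smul, mul_smul, ← smul_add, hvw, smul_zero]

end Lewis

/-! ### The inversion Cousin problem -/

section Cousin

variable {V : Type*} [NormedAddCommGroup V] [NormedSpace ℂ V]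

theorem CircleIntegrable.indicator {V : Type*} [NormedAddCommGroup V] {f : ℂ → V} {c : ℂ} {R : ℝ}
    (hf : CircleIntegrable f c R) {s : Set ℂ} (hs : MeasurableSet s) :
    CircleIntegrable (s.indicator f) c R := by
  have hs' : MeasurableSet (circleMap c R ⁻¹' s) := (continuous_circleMap c R).measurable hs
  exact ⟨hf.1.indicator hs', hf.2.indicator hs'⟩

theorem circleIntegral_indicator_add_compl {f : ℂ → V} {c : ℂ} {R : ℝ}
    (hf : CircleIntegrable f c R) {s : Set ℂ} (hs : MeasurableSet s) :
    (∮ ζ in C(c, R), s.indicator f ζ) + (∮ ζ in C(c, R), sᶜ.indicator f ζ) =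
      ∮ ζ in C(c, R), f ζ := by
  rw [← circleIntegral.integral_add (CircleIntegrable.indicator hf hs)
    (CircleIntegrable.indicator hf hs.compl)]
  simp only [Set.indicator_self_add_compl_apply]

/-- A disc around `1` together with its image under `z ↦ -1/z` and the unit disc; the union of this
set and its image under `z ↦ -1/z` is a neighbourhood of the real projective line. -/
def gluingDomain : Set ℂ :=
  Metric.ball 0 1 ∪ Metric.ball 1 (1 / 4) ∪ {z | z ≠ 0 ∧ -1 / z ∈ Metric.ball (1 : ℂ) (1 / 4)}

theorem isOpen_gluingDomain : IsOpen gluingDomain := by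
  refine (Metric.isOpen_ball.union Metric.isOpen_ball).union ?_
  have h : ContinuousOn (fun z : ℂ => -1 / z) {z | z ≠ 0} := fun z hz =>
    (continuousAt_const.div continuousAt_id hz).continuousWithinAt
  exact h.isOpen_inter_preimage isOpen_ne Metric.isOpen_ball

theorem re_of_mem_closedBall {z : ℂ} (hz : z ∈ Metric.closedBall (1 : ℂ) (1 / 4)) :
    3 / 4 ≤ z.re ∧ |z.im| ≤ 1 / 4 := by
  rw [Metric.mem_closedBall, dist_eq_norm] at hz
  have h1 := (Complex.abs_re_le_norm (z - 1)).trans hz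
  have h2 := (Complex.abs_im_le_norm (z - 1)).trans hz
  rw [Complex.sub_re, Complex.one_re] at h1
  rw [Complex.sub_im, Complex.one_im, sub_zero] at h2
  exact ⟨by linarith [(abs_le.1 h1).1], h2⟩

theorem re_neg_one_div (z : ℂ) : (-1 / z).re = -(z.re / Complex.normSq z) := by
  rw [neg_div, Complex.neg_re, one_div, Complex.inv_re]

theorem re_neg_of_neg_one_div_mem {z : ℂ} (hz : -1 / z ∈ Metric.ball (1 : ℂ) (1 / 4)) :
    z.re < 0 := by
  have h := (re_of_mem_closedBall (Metric.ball_subset_closedBall hz)).1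
  rw [re_neg_one_div] at h
  by_contra! h0
  have := div_nonneg h0 (Complex.normSq_nonneg z)
  linarith

/-- The gluing domain does not meet the arc outside the unit disc. -/
theorem ne_of_mem_gluingDomain {z ζ : ℂ} (hz : z ∈ gluingDomain)
    (hζ : ζ ∈ Metric.sphere (1 : ℂ) (1 / 4)) (hζ1 : 1 ≤ ‖ζ‖) : ζ ≠ z := by
  rintro rfl
  rcases hz with (h | h) | h
  · exact absurd hζ1 (not_le.2 (mem_ball_zero_iff.1 h))
  · exact absurd (Metric.mem_sphere.1 hζ) (ne_of_lt h)
  · have h1 := re_neg_of_neg_one_div_mem h.2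
    have h2 := (re_of_mem_closedBall (Metric.sphere_subset_closedBall hζ)).1
    linarith

/-- The image of the gluing domain under `z ↦ -1/z` does not meet the arc inside the unit disc. -/
theorem mul_add_one_ne_zero_of_mem_gluingDomain {z ζ : ℂ} (hz : z ∈ gluingDomain)
    (hζ : ζ ∈ Metric.sphere (1 : ℂ) (1 / 4)) (hζ1 : ‖ζ‖ ≤ 1) : ζ * z + 1 ≠ 0 := by
  intro h
  have hz0 : z ≠ 0 := by
    rintro rfl
    simp at h
  have hζz : ζ = -1 / z := by
    field_simp
    linear_combination h
  have hre := (re_of_mem_closedBall (Metric.sphere_subset_closedBall hζ)).1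
  rcases hz with (h' | h') | h'
  · have h1 : ‖ζ * z‖ = 1 := by
      rw [eq_neg_of_add_eq_zero_left h, norm_neg, norm_one]
    rw [norm_mul] at h1
    have h2 := mem_ball_zero_iff.1 h'
    nlinarith [norm_nonneg ζ, norm_nonneg z]
  · have h1 := (re_of_mem_closedBall (Metric.ball_subset_closedBall h')).1
    rw [hζz, re_neg_one_div] at hre
    have := div_nonneg (by linarith : 0 ≤ z.re) (Complex.normSq_nonneg z)
    linarith
  · exact absurd (Metric.mem_sphere.1 (hζz ▸ hζ)) (ne_of_lt h'.2)

/-- Solution of a Cousin problem: `H`, given near `1`, is written as `h - L h(-1/·)` with a function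
`h` that is holomorphic on the unit disc and near `±1`. The Cauchy integral of `H` over a circle
around `1` is split into the contributions of the arcs outside and inside the unit disc; the second
one is transported by `z ↦ -1/z`. -/
theorem exists_sub_comp_inversion_eq [CompleteSpace V] {H : ℂ → V}
    (hH : DifferentiableOn ℂ H (Metric.ball 1 (1 / 2))) (L : V →L[ℂ] V) (hL : ∀ v, L (L v) = v) :
    ∃ h : ℂ → V, DifferentiableOn ℂ h gluingDomain ∧
      ∀ z ∈ Metric.ball (1 : ℂ) (1 / 4), h z - L (h (-1 / z)) = H z := by
  have hsub : Metric.closedBall (1 : ℂ) (1 / 4) ⊆ Metric.ball 1 (1 / 2) :=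
    Metric.closedBall_subset_ball (by norm_num)
  have hHc : ContinuousOn H (Metric.closedBall 1 (1 / 4)) := hH.continuousOn.mono hsub
  have hHs : ContinuousOn H (Metric.sphere 1 (1 / 4)) := hHc.mono Metric.sphere_subset_closedBall
  have hr : (0 : ℝ) ≤ 1 / 4 := by norm_num
  have hab : |(1 / 4 : ℝ)| = 1 / 4 := abs_of_nonneg hr
  -- `Iout` and `Iin` are the contributions of the arcs outside and inside the unit disc, the
  -- kernel of the latter being `1 / (ζ - w)` with `w = -1 / z`.
  set s : Set ℂ := {ζ | 1 ≤ ‖ζ‖} with hs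
  have hsm : MeasurableSet s := (isClosed_le continuous_const continuous_norm).measurableSet
  set κ : ℂ := (2 * Real.pi * Complex.I : ℂ)⁻¹ with hκ
  obtain ⟨C, hC⟩ := (isCompact_sphere (1 : ℂ) (1 / 4)).exists_bound_of_continuousOn hHs
  have hmeas : ∀ t : Set ℂ, MeasurableSet t → AEStronglyMeasurable
      (fun θ => t.indicator H (circleMap 1 (1 / 4) θ))
      (volume.restrict (Set.Ioc 0 (2 * Real.pi))) := by
    intro t ht
    have h1 : Continuous fun θ => H (circleMap 1 (1 / 4) θ) :=
      hHs.comp_continuous (continuous_circleMap 1 (1 / 4)) fun θ => circleMap_mem_sphere 1 hr θ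
    exact h1.aestronglyMeasurable.indicator ((continuous_circleMap 1 (1 / 4)).measurable ht)
  have hbd : ∀ t : Set ℂ, ∀ ζ ∈ Metric.sphere (1 : ℂ) |1 / 4|, ‖t.indicator H ζ‖ ≤ C := by
    intro t ζ hζ
    rw [hab] at hζ
    exact (norm_indicator_le_norm_self H ζ).trans (hC ζ hζ)
  set Iout : ℂ → V := fun z => ∮ ζ in C(1, 1 / 4), (ζ - z)⁻¹ • s.indicator H ζ with hIout
  set Iin : ℂ → V := fun z => ∮ ζ in C(1, 1 / 4), (z / (ζ * z + 1)) • sᶜ.indicator H ζ with hIin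
  have hd1 : DifferentiableOn ℂ Iout gluingDomain := by
    refine differentiableOn_circleIntegral_of_compact (C := C) isOpen_gluingDomain
      (K := Metric.sphere 1 (1 / 4) ∩ s)
      ((isCompact_sphere _ _).inter_right (isClosed_le continuous_const continuous_norm))
      (hmeas s hsm) (hbd s) ?_ (fun z _ => by fun_prop) ?_
    · intro ζ hζ hζ0
      rw [hab] at hζ
      exact ⟨hζ, Set.mem_of_indicator_ne_zero hζ0⟩
    · intro z hz ζ hζ
      have : ζ - z ≠ 0 := sub_ne_zero.2 (ne_of_mem_gluingDomain hz hζ.1 hζ.2)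
      fun_prop (disch := exact this)
  have hd2 : DifferentiableOn ℂ Iin gluingDomain := by
    refine differentiableOn_circleIntegral_of_compact (C := C) isOpen_gluingDomain
      (K := Metric.sphere 1 (1 / 4) ∩ {ζ | ‖ζ‖ ≤ 1})
      ((isCompact_sphere _ _).inter_right (isClosed_le continuous_norm continuous_const))
      (hmeas _ hsm.compl) (hbd _) ?_ (fun z _ => by fun_prop) ?_
    · intro ζ hζ hζ0
      rw [hab] at hζ
      have : ¬1 ≤ ‖ζ‖ := Set.mem_of_indicator_ne_zero hζ0
      exact ⟨hζ, (not_le.1 this).le⟩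
    · intro z hz ζ hζ
      have := mul_add_one_ne_zero_of_mem_gluingDomain hz hζ.1 hζ.2
      fun_prop (disch := exact this)
  refine ⟨fun z => κ • (Iout z - L (Iin z)),
    (hd1.sub (L.differentiable.comp_differentiableOn hd2)).const_smul κ, fun z hz => ?_⟩
  have hzre := (re_of_mem_closedBall (Metric.ball_subset_closedBall hz)).1
  have hz0 : z ≠ 0 := by
    rintro rfl
    rw [Complex.zero_re] at hzre
    linarith
  have hne1 : ∀ ζ ∈ Metric.sphere (1 : ℂ) (1 / 4), ζ - z ≠ 0 := fun ζ hζ h => by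
    rw [sub_eq_zero] at h
    subst h
    exact absurd (Metric.mem_sphere.1 hζ) (ne_of_lt hz)
  have hne2 : ∀ ζ ∈ Metric.closedBall (1 : ℂ) (1 / 4), ζ * z + 1 ≠ 0 := fun ζ hζ h => by
    have hζz : ζ = -1 / z := by
      field_simp
      linear_combination h
    have hre := (re_of_mem_closedBall hζ).1
    rw [hζz, re_neg_one_div] at hre
    have := div_nonneg (by linarith : 0 ≤ z.re) (Complex.normSq_nonneg z)
    linarith
  have hc1 : CircleIntegrable (fun ζ => (ζ - z)⁻¹ • H ζ) 1 (1 / 4) := by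
    refine ContinuousOn.circleIntegrable hr (ContinuousOn.smul (fun ζ hζ => ?_) hHs)
    exact ((continuous_id.sub continuous_const).continuousAt.inv₀ (hne1 ζ hζ)).continuousWithinAt
  have hkd : ∀ ζ ∈ Metric.closedBall (1 : ℂ) (1 / 4),
      DifferentiableAt ℂ (fun ζ : ℂ => z / (ζ * z + 1)) ζ := fun ζ hζ => by
    have := hne2 ζ hζ
    fun_prop (disch := exact this)
  have hc2c : ContinuousOn (fun ζ => (z / (ζ * z + 1)) • H ζ) (Metric.closedBall 1 (1 / 4)) :=
    ContinuousOn.smul (fun ζ hζ => (hkd ζ hζ).continuousAt.continuousWithinAt) hHc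
  have hc2 : CircleIntegrable (fun ζ => (z / (ζ * z + 1)) • H ζ) 1 (1 / 4) :=
    ContinuousOn.circleIntegrable hr (hc2c.mono Metric.sphere_subset_closedBall)
  have hsm' : ∀ (t : Set ℂ) (k : ℂ → ℂ), (fun ζ => k ζ • t.indicator H ζ) =
      t.indicator fun ζ => k ζ • H ζ := fun t k => (Set.indicator_smul t k H).symm
  have e1 : Iout (-1 / z) =
      ∮ ζ in C(1, 1 / 4), s.indicator (fun ζ => (z / (ζ * z + 1)) • H ζ) ζ := by
    rw [hIout, ← hsm']
    refine circleIntegral.integral_congr hr fun ζ hζ => ?_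
    have := hne2 ζ (Metric.sphere_subset_closedBall hζ)
    have e : (ζ - -1 / z)⁻¹ = z / (ζ * z + 1) := by
      rw [eq_div_iff this, inv_mul_eq_iff_eq_mul₀]
      · field_simp
        ring
      · intro h0
        apply this
        field_simp at h0
        linear_combination h0
    simp only [e]
  have e2 : Iin (-1 / z) = ∮ ζ in C(1, 1 / 4), sᶜ.indicator (fun ζ => (ζ - z)⁻¹ • H ζ) ζ := by
    rw [hIin, ← hsm']
    refine circleIntegral.integral_congr hr fun ζ hζ => ?_
    have := hne1 ζ hζ
    have e : -1 / z / (ζ * (-1 / z) + 1) = (ζ - z)⁻¹ := by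
      have h1 : ζ * (-1 / z) + 1 = -(ζ - z) / z := by
        field_simp
        ring
      rw [h1, div_div_div_cancel_right₀ hz0, neg_div_neg_eq, one_div]
    simp only [e]
  have e3 : Iout z = ∮ ζ in C(1, 1 / 4), s.indicator (fun ζ => (ζ - z)⁻¹ • H ζ) ζ := by
    rw [hIout, ← hsm']
  have e4 : Iin z = ∮ ζ in C(1, 1 / 4), sᶜ.indicator (fun ζ => (z / (ζ * z + 1)) • H ζ) ζ := by
    rw [hIin, ← hsm']
  -- The two arcs together give `H z` by Cauchy's formula for the kernel `1 / (ζ - z)`, and `0` by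
  -- Cauchy's theorem for the kernel `z / (ζ z + 1)`, whose pole `-1 / z` lies outside the circle.
  have h1 := circleIntegral_indicator_add_compl hc1 hsm
  have h2 := circleIntegral_indicator_add_compl hc2 hsm
  rw [← e3, ← e2, Complex.circleIntegral_sub_inv_smul_of_differentiable_on_off_countable
    Set.countable_empty hz hHc fun ζ hζ => hH.differentiableAt
      (Metric.isOpen_ball.mem_nhds (hsub (Metric.ball_subset_closedBall hζ.1)))] at h1
  rw [← e1, ← e4, Complex.circleIntegral_eq_zero_of_differentiable_on_off_countable hr
    Set.countable_empty hc2c fun ζ hζ => (hkd ζ (Metric.ball_subset_closedBall hζ.1)).smul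
      (hH.differentiableAt (Metric.isOpen_ball.mem_nhds
        (hsub (Metric.ball_subset_closedBall hζ.1))))] at h2
  have h3 : L (Iout (-1 / z)) + L (Iin z) = 0 := by rw [← map_add, h2, map_zero]
  have h4 : κ • (Iout z - L (Iin z)) - L (κ • (Iout (-1 / z) - L (Iin (-1 / z)))) =
      κ • (Iout z + Iin (-1 / z)) - κ • (L (Iout (-1 / z)) + L (Iin z)) := by
    rw [map_smul, map_sub, hL, smul_sub, smul_sub, smul_add, smul_add]
    abel
  simp only
  rw [h4, h3, h1, smul_zero, sub_zero, smul_smul,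
    inv_mul_cancel₀ Complex.two_pi_I_ne_zero, one_smul]

end Cousin

/-! ### Realization of associated functions by hyperfunctions -/

section Realization

variable {V : Type*} [NormedAddCommGroup V] [NormedSpace ℂ V]

theorem isClosed_realLine : IsClosed realLine := by
  have h : Tendsto (fun x : ℝ => (x : ℂ)) (coclosedCompact ℝ) (coclosedCompact ℂ) := by
    rw [coclosedCompact_eq_cocompact, coclosedCompact_eq_cocompact]
    exact Complex.isometry_ofReal.isClosedEmbedding.tendsto_cocompact
  exact (isCompact_range (OnePoint.continuous_map Complex.continuous_ofReal h)).isClosed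

/-- The neighbourhood of the real projective line on which the factor of `S` equals `1`, i.e. the
complement of `± i`, where the quotient that defines the factor is `0 / 0`. -/
def goodSetS : Set (OnePoint ℂ) := goodSet (ModularGroup.S.map (Int.castRingHom ℝ))

theorem coe_mem_goodSetS {z : ℂ} : (z : OnePoint ℂ) ∈ goodSetS ↔ 1 + z ^ 2 ≠ 0 := by
  constructor
  · intro h h0
    have h' : 0 < (factor (ModularGroup.S.map (Int.castRingHom ℝ)) (z : OnePoint ℂ)).re := h
    simp only [factor, OnePoint.elim_some, h0, zero_div, Complex.zero_re, lt_irrefl] at h'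
  · intro h
    show 0 < (factor (ModularGroup.S.map (Int.castRingHom ℝ)) (z : OnePoint ℂ)).re
    rw [factor_S_coe h, Complex.one_re]
    exact one_pos

theorem factor_S_of_mem {p : OnePoint ℂ} (hp : p ∈ goodSetS) :
    factor (ModularGroup.S.map (Int.castRingHom ℝ)) p = 1 := by
  induction p with
  | infty => exact factor_S_infty
  | coe z => exact factor_S_coe (coe_mem_goodSetS.1 hp)

theorem moebiusInv_S_S (p : OnePoint ℂ) :
    moebiusInv ModularGroup.S (moebiusInv ModularGroup.S p) = p := by
  induction p with
  | infty => rw [moebiusInv_S_infty, moebiusInv_S_zero]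
  | coe z =>
    by_cases hz : z = 0
    · rw [hz, moebiusInv_S_zero, moebiusInv_S_infty]
    · rw [moebiusInv_S_coe hz, moebiusInv_S_coe (div_ne_zero (neg_ne_zero.2 one_ne_zero) hz),
        div_div_cancel₀ (neg_ne_zero.2 one_ne_zero)]

theorem moebiusInv_S_mem_goodSetS {p : OnePoint ℂ} (hp : p ∈ goodSetS) :
    moebiusInv ModularGroup.S p ∈ goodSetS := by
  induction p with
  | infty =>
    rw [moebiusInv_S_infty, coe_mem_goodSetS]
    simp
  | coe z =>
    by_cases hz : z = 0
    · rw [hz, moebiusInv_S_zero]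
      exact realLine_subset_goodSet _ infty_mem_realLine
    · rw [coe_mem_goodSetS] at hp
      rw [moebiusInv_S_coe hz, coe_mem_goodSetS]
      intro h
      apply hp
      field_simp at h
      linear_combination h

variable (ν : ℂ) (η : Representation ℂ PSL(2, ℤ) V)

theorem twistedAction_S_of_mem (F : OnePoint ℂ → V) {p : OnePoint ℂ} (hp : p ∈ goodSetS) :
    twistedAction ν η ModularGroup.S F p = η S (F (moebiusInv ModularGroup.S p)) := by
  rw [twistedAction_apply, factor_S_of_mem hp, coe_S_eq, Complex.one_cpow, one_smul]

theorem twistedAction_S_S (F : OnePoint ℂ → V) {p : OnePoint ℂ} (hp : p ∈ goodSetS) :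
    twistedAction ν η ModularGroup.S (twistedAction ν η ModularGroup.S F) p = F p := by
  rw [twistedAction_S_of_mem ν η _ hp,
    twistedAction_S_of_mem ν η _ (moebiusInv_S_mem_goodSetS hp), rep_S_S, moebiusInv_S_S]

variable [FiniteDimensional ℂ V]

/-- A function on a neighbourhood of a set that covers the real projective line together with its
image under `S` extends to a representative of an `S`-invariant hyperfunction, provided that it is
`S`-invariant where this makes sense. -/
theorem exists_fixedAt_S_of_compatible {A : Set (OnePoint ℂ)} (hA : IsOpen A)
    (hcov : ∀ p ∈ realLine, p ∈ A ∨ moebiusInv ModularGroup.S p ∈ A) {P : OnePoint ℂ → V}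
    (hP : HolomorphicOn P (A \ realLine))
    (hcomp : ∀ p ∈ A, moebiusInv ModularGroup.S p ∈ A → p ∉ realLine → p ∈ goodSetS →
      η S (P (moebiusInv ModularGroup.S p)) = P p) :
    ∃ F ∈ boundaryGerms V realLine, (∀ p ∈ A, F p = P p) ∧
      ∀ p ∈ realLine, FixedAt ν η F ModularGroup.S p := by
  classical
  set s := moebiusInv ModularGroup.S with hs
  have hsA : IsOpen (s ⁻¹' A) := isOpen_preimage_moebius _ hA
  have hW : IsOpen goodSetS := isOpen_goodSet _
  have hRW : realLine ⊆ goodSetS := realLine_subset_goodSet _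
  set F : OnePoint ℂ → V := fun p => if p ∈ A then P p else η S (P (s p)) with hF
  have hFA : ∀ p ∈ A, F p = P p := fun p hp => if_pos hp
  have hFS : ∀ p, s p ∈ A → p ∉ realLine → p ∈ goodSetS → F p = η S (P (s p)) := by
    intro p h1 h2 h3
    by_cases h : p ∈ A
    · rw [hFA p h, hcomp p h h1 h2 h3]
    · exact if_neg h
  refine ⟨F, ⟨(A ∪ s ⁻¹' A) ∩ goodSetS, (hA.union hsA).inter hW,
    fun p hp => ⟨hcov p hp, hRW hp⟩, ?_⟩, hFA, fun p hp => ?_⟩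
  · have hR : IsOpen (realLineᶜ) := isClosed_realLine.isOpen_compl
    refine HolomorphicOn.of_locally ?_
    rintro p ⟨⟨hp | hp, hpW⟩, hpR⟩
    · exact ⟨A ∩ realLineᶜ, hA.inter hR, ⟨hp, hpR⟩, hP.congr fun x hx => hFA x hx.1⟩
    · refine ⟨goodSetS ∩ s ⁻¹' (A ∩ realLineᶜ), hW.inter (isOpen_preimage_moebius _ (hA.inter hR)),
        ⟨hpW, hp, fun h => hpR (moebiusInv_mem_realLine_iff.1 h)⟩, ?_⟩
      refine ((hP.principalSeriesFun ν _).postcomp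
        (η ((ModularGroup.S : SL(2, ℤ)) : PSL(2, ℤ)))).congr fun x hx => ?_
      rw [hFS x hx.2.1 (fun h => hx.2.2 (moebiusInv_mem_realLine_iff.2 h)) hx.1]
      exact (twistedAction_S_of_mem ν η P hx.1).symm
  · refine mem_nullGerms_of_eqOn ((hA.union hsA).inter hW) ⟨hcov p hp, hRW hp⟩ ?_
    rintro x ⟨hx, hxW⟩ hxR
    rw [Pi.sub_apply, twistedAction_S_of_mem ν η F hxW, sub_eq_zero, ← hs]
    rcases hx with hx | hx
    · have hss : s (s x) = x := moebiusInv_S_S x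
      rw [hFS (s x) (by rwa [hss]) (fun h => hxR (moebiusInv_mem_realLine_iff.1 h))
        (moebiusInv_S_mem_goodSetS hxW), rep_S_S, hss, hFA x hx]
    · rw [hFA _ hx, hFS x hx hxR hxW]

variable {ν η}

theorem abs_im_lt_of_mem_gluingDomain {z : ℂ} (hz : z ∈ gluingDomain) : |z.im| < 1 := by
  rcases hz with (h | h) | ⟨h0, h⟩
  · exact (Complex.abs_im_le_norm z).trans_lt (mem_ball_zero_iff.1 h)
  · exact (re_of_mem_closedBall (Metric.ball_subset_closedBall h)).2.trans_lt (by norm_num)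
  · obtain ⟨h1, h2⟩ := re_of_mem_closedBall (Metric.ball_subset_closedBall h)
    have e : z = -1 / (-1 / z) := by
      rw [div_div_cancel₀ (neg_ne_zero.2 one_ne_zero)]
    have h3 : 9 / 16 ≤ Complex.normSq (-1 / z) := by
      rw [Complex.normSq_apply]
      nlinarith [mul_self_nonneg (-1 / z).im]
    rw [e, im_neg_one_div, abs_div, abs_of_nonneg (Complex.normSq_nonneg _),
      div_lt_one (by linarith)]
    linarith

theorem mem_gluingDomain_or {p : OnePoint ℂ} (hp : p ∈ realLine) :
    p ∈ ((↑) '' gluingDomain : Set (OnePoint ℂ)) ∨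
      moebiusInv ModularGroup.S p ∈ ((↑) '' gluingDomain : Set (OnePoint ℂ)) := by
  have h0 : (0 : ℂ) ∈ gluingDomain := Or.inl (Or.inl (by simp))
  have h1 : (1 : ℂ) ∈ gluingDomain := Or.inl (Or.inr (by simp))
  induction p with
  | infty =>
    rw [moebiusInv_S_infty]
    exact Or.inr ⟨0, h0, rfl⟩
  | coe z =>
    rcases lt_trichotomy ‖z‖ 1 with h | h | h
    · exact Or.inl ⟨z, Or.inl (Or.inl (mem_ball_zero_iff.2 h)), rfl⟩
    · have him := coe_mem_realLine.1 hp
      have hz : z = (z.re : ℂ) := Complex.ext (by simp) (by simp [him])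
      rw [hz, Complex.norm_real, Real.norm_eq_abs, abs_eq zero_le_one] at h
      rcases h with h | h
      · rw [h] at hz
        exact Or.inl ⟨1, h1, by rw [hz]; simp⟩
      · rw [h] at hz
        have hz' : z = -1 := by rw [hz]; simp
        refine Or.inr ⟨1, h1, ?_⟩
        rw [hz', moebiusInv_S_coe (neg_ne_zero.2 one_ne_zero), div_self (neg_ne_zero.2 one_ne_zero)]
    · have hz : z ≠ 0 := by
        rintro rfl
        rw [norm_zero] at h
        linarith
      rw [moebiusInv_S_coe hz]
      refine Or.inr ⟨_, Or.inl (Or.inl (mem_ball_zero_iff.2 ?_)), rfl⟩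
      rw [norm_div, norm_neg, norm_one]
      exact (div_lt_one (by linarith)).2 h

theorem mem_ball_or_of_mem_gluingDomain {z : ℂ} (hz : z ≠ 0) (h1 : z ∈ gluingDomain)
    (h2 : -1 / z ∈ gluingDomain) :
    z ∈ Metric.ball (1 : ℂ) (1 / 4) ∨ -1 / z ∈ Metric.ball (1 : ℂ) (1 / 4) := by
  rcases h1 with (h | h) | h
  · rcases h2 with (h' | h') | h'
    · rw [mem_ball_zero_iff] at h h'
      rw [norm_div, norm_neg, norm_one, div_lt_one (norm_pos_iff.2 hz)] at h'
      linarith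
    · exact Or.inr h'
    · rw [Set.mem_ofPred_eq, div_div_cancel₀ (neg_ne_zero.2 one_ne_zero)] at h'
      exact Or.inl h'.2
  · exact Or.inl h
  · exact Or.inr h.2

/-- Away from `0` and `∞`, the germ represented by `f ∈ 𝓕_{ν,η}` is invariant under `S`. -/
theorem affineRepresentative_fixedAt_S {f g : ℂ → V} (hg : DifferentiableOn ℂ g Complex.slitPlane)
    (hgf : ∀ z : ℂ, z.im ≠ 0 → g z = bruggemanExpr ν η f z) {x : ℂ} (hx : x.im = 0) (hx0 : x ≠ 0) :
    FixedAt ν η (affineRepresentative ν f) ModularGroup.S x := by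
  have hpos : ∀ x : ℂ, x.im = 0 → 0 < x.re →
      FixedAt ν η (affineRepresentative ν f) ModularGroup.S x := by
    intro x hx hre
    rw [FixedAt, coe_mem_nullGerms_iff]
    refine ⟨{z | |z.im| < z.re} ∩ {z | |z.im| < 1}, (isOpen_lt
      (continuous_abs.comp Complex.continuous_im) Complex.continuous_re).inter (isOpen_strip 1),
      ⟨by simpa [hx] using hre, by simp [hx]⟩, fun z => -((1 + z ^ 2) ^ (ν + 1 / 2) • g z), ?_, ?_⟩
    · refine (((differentiableOn_one_add_sq_cpow _).mono fun z hz => hz.2).smul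
        (hg.mono fun z hz => Or.inl ((abs_nonneg _).trans_lt hz.1))).neg
    · rintro u ⟨hu, -⟩ hu0
      simp only
      rw [hgf u hu0, ← affineRepresentative_sub_S ν η f hu, neg_sub]
      rfl
  -- The defect `d` of invariance satisfies `S d = -d`, which transports its nullity from `-1 / x`
  -- to a negative `x`.
  rcases lt_or_gt_of_ne (a := x.re) (b := 0) (fun h => hx0 (Complex.ext h hx)) with h | h
  · have hxR : (x : OnePoint ℂ) ∈ realLine := coe_mem_realLine.2 hx
    have h1 : FixedAt ν η (affineRepresentative ν f) ModularGroup.S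
        (moebiusInv ModularGroup.S x) := by
      rw [moebiusInv_S_coe hx0]
      refine hpos _ ?_ ?_
      · rw [im_neg_one_div, hx, zero_div]
      · rw [re_neg_one_div, ← neg_div]
        exact div_pos (neg_pos.2 h) (Complex.normSq_pos.2 hx0)
    have h2 := twistedAction_mem_nullGerms ν η hxR h1
    have h3 : twistedAction ν η ModularGroup.S
        (twistedAction ν η ModularGroup.S (affineRepresentative ν f)) -
          affineRepresentative ν f ∈ nullGerms V {(x : OnePoint ℂ)} :=
      mem_nullGerms_of_eqOn (isOpen_goodSet _) (realLine_subset_goodSet _ hxR) fun p hp _ => by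
        rw [Pi.sub_apply, twistedAction_S_S ν η _ hp, sub_self]
    rw [map_sub] at h2
    have h4 := sub_mem h3 h2
    rwa [sub_sub_sub_cancel_left] at h4
  · exact hpos x hx h

/-- Every element of `𝓕_{ν,η}` is associated with an automorphic hyperfunction. After subtraction of
a function `h` that is holomorphic near the real points of the gluing domain, the function
represented by `f` satisfies exact `S`-invariance, and hence extends across `∞`. -/
theorem exists_isAssociated {f : ℂ → V} (hf : f ∈ spaceF ν η) :
    ∃ α : automorphicHyperfunctions ν η, IsAssociated ν η α f := by
  obtain ⟨⟨-, hfd, hfT, -⟩, g, hg, hgf⟩ := id hf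
  set G := affineRepresentative ν f with hG
  have hsec : ∀ z ∈ Metric.ball (1 : ℂ) (1 / 2), |z.im| < z.re ∧ |z.im| < 1 := by
    intro z hz
    rw [Metric.mem_ball, dist_eq_norm] at hz
    have h1 := (Complex.abs_re_le_norm (z - 1)).trans_lt hz
    have h2 := (Complex.abs_im_le_norm (z - 1)).trans_lt hz
    rw [Complex.sub_re, Complex.one_re] at h1
    rw [Complex.sub_im, Complex.one_im, sub_zero] at h2
    have := (abs_lt.1 h1).1
    exact ⟨by linarith, by linarith⟩
  obtain ⟨h, hh, hhH⟩ := exists_sub_comp_inversion_eq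
    (H := fun z => (1 + z ^ 2) ^ (ν + 1 / 2) • g z)
    (((differentiableOn_one_add_sq_cpow _).mono fun z hz => (hsec z hz).2).smul
      (hg.mono fun z hz => Or.inl ((abs_nonneg _).trans_lt (hsec z hz).1)))
    (LinearMap.toContinuousLinearMap (η S)) (rep_S_S η)
  set A : Set (OnePoint ℂ) := (↑) '' gluingDomain with hA
  have hAo : IsOpen A := OnePoint.isOpen_image_coe.2 isOpen_gluingDomain
  have hmemA : ∀ {z : ℂ}, (z : OnePoint ℂ) ∈ A ↔ z ∈ gluingDomain := by
    intro z
    exact OnePoint.coe_injective.mem_set_image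
  set P : OnePoint ℂ → V := fun p => G p - p.elim 0 h with hP
  have hPz : ∀ z : ℂ, P z = (1 + z ^ 2) ^ (ν + 1 / 2) • f z - h z := fun z => rfl
  have hball : ∀ z : ℂ, z.im ≠ 0 → z ∈ Metric.ball (1 : ℂ) (1 / 4) →
      η S (P ((-1 / z : ℂ) : OnePoint ℂ)) = P z := by
    intro z hz0 hz
    have hz' := (hsec z (Metric.ball_subset_ball (by norm_num) hz)).1
    have hne : 1 + z ^ 2 ≠ 0 := Complex.slitPlane_ne_zero (one_add_sq_mem_slitPlane
      (hsec z (Metric.ball_subset_ball (by norm_num) hz)).2)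
    have h1 := affineRepresentative_sub_S ν η f hz'
    rw [← hgf z hz0, twistedAction_S_coe ν η _ (ne_zero_of_im_ne_zero hz0) hne] at h1
    have h2 : h z - η S (h (-1 / z)) = (1 + z ^ 2) ^ (ν + 1 / 2) • g z := hhH z hz
    have h3 : η S (P ((-1 / z : ℂ) : OnePoint ℂ)) =
        η S (affineRepresentative ν f ((-1 / z : ℂ) : OnePoint ℂ)) - η S (h (-1 / z)) :=
      map_sub _ _ _
    have h4 : P z = affineRepresentative ν f z - h z := rfl
    rw [h3, h4, eq_comm, ← sub_eq_zero, sub_sub_sub_comm, h1, h2, sub_self]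
  obtain ⟨F, hF, hFP, hFS⟩ := exists_fixedAt_S_of_compatible ν η hAo
    (fun p hp => mem_gluingDomain_or hp) (P := P) (by
      refine HolomorphicOn.of_infty_notMem
        (fun h => OnePoint.infty_notMem_image_coe h.1) ?_
      refine DifferentiableOn.sub (f := fun z : ℂ => (1 + z ^ 2) ^ (ν + 1 / 2) • f z) ?_
        (hh.mono fun z hz => hmemA.1 hz.1)
      exact ((differentiableOn_one_add_sq_cpow _).mono fun z hz =>
        abs_im_lt_of_mem_gluingDomain (hmemA.1 hz.1)).smul
          (hfd.mono fun z hz => fun h0 => hz.2 (coe_mem_realLine.2 h0))) (by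
      intro p hp hsp hpR _
      induction p with
      | infty => exact absurd infty_mem_realLine hpR
      | coe z =>
        have hz : z.im ≠ 0 := fun h0 => hpR (coe_mem_realLine.2 h0)
        have hz0 := ne_zero_of_im_ne_zero hz
        rw [moebiusInv_S_coe hz0] at hsp ⊢
        rcases mem_ball_or_of_mem_gluingDomain hz0 (hmemA.1 hp) (hmemA.1 hsp) with h' | h'
        · exact hball z hz h'
        · have := hball _ (im_neg_one_div_ne_zero hz) h'
          rw [div_div_cancel₀ (neg_ne_zero.2 one_ne_zero)] at this
          rw [← this, rep_S_S])
  have hnullA : ∀ x : ℂ, (x : OnePoint ℂ) ∈ A → F - G ∈ nullGerms V {(x : OnePoint ℂ)} := by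
    intro x hx
    refine coe_mem_nullGerms_iff.2 ⟨gluingDomain, isOpen_gluingDomain, hmemA.1 hx, fun z => -h z,
      hh.neg, fun u hu _ => ?_⟩
    rw [Pi.sub_apply, hFP u (hmemA.2 hu)]
    exact sub_sub_cancel_left _ _
  -- At a real point `x` outside the gluing domain, `F - G` is compared with its image under `S`;
  -- both `F` and `G` are invariant under `S` there.
  have hnull : ∀ x : ℂ, x.im = 0 → F - G ∈ nullGerms V {(x : OnePoint ℂ)} := by
    intro x hx
    have hxR : (x : OnePoint ℂ) ∈ realLine := coe_mem_realLine.2 hx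
    by_cases hxA : (x : OnePoint ℂ) ∈ A
    · exact hnullA x hxA
    have hx0 : x ≠ 0 := by
      rintro rfl
      exact hxA (hmemA.2 (Or.inl (Or.inl (by simp))))
    have hsx := (mem_gluingDomain_or hxR).resolve_left hxA
    rw [moebiusInv_S_coe hx0] at hsx
    have h1 := twistedAction_mem_nullGerms ν η (γ := ModularGroup.S) hxR (F := F - G) (by
      rw [moebiusInv_S_coe hx0]
      exact hnullA _ hsx)
    have h2 := sub_mem (add_mem h1 (affineRepresentative_fixedAt_S hg hgf hx hx0)) (hFS x hxR)
    rw [map_sub, sub_add_sub_cancel] at h2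
    rwa [sub_sub_sub_cancel_left] at h2
  have hFT : ∀ x : ℂ, x.im = 0 → FixedAt ν η F ModularGroup.T x := by
    intro x hx
    have h1 := twistedAction_mem_nullGerms ν η (γ := ModularGroup.T) (coe_mem_realLine.2 hx)
      (F := F - G) (by
        rw [moebiusInv_T_coe]
        exact hnull _ (by simpa using hx))
    have h2 := sub_mem (add_mem h1 (affineRepresentative_fixedAt_T ν η hfT hx)) (hnull x hx)
    rwa [map_sub, sub_add_sub_cancel, sub_sub_sub_cancel_right] at h2
  refine ⟨⟨Submodule.Quotient.mk ⟨F, hF⟩, mk_mem_automorphicHyperfunctions_iff.2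
    (fixedAt_of_generators hFS hFT)⟩, hf, isRepresentedBy_toAffine_iff.2
      ⟨affineRepresentative_mem_boundaryGerms ν hfd, fun x hx => ?_⟩⟩
  rw [← neg_sub]
  exact neg_mem (hnull x hx)

end Realization

/-! ### The Bruggeman transform -/

section Transform

variable {V : Type*} [NormedAddCommGroup V] [NormedSpace ℂ V]
  {ν : ℂ} {η : Representation ℂ PSL(2, ℤ) V}

theorem bruggemanExpr_add (f g : ℂ → V) (z : ℂ) :
    bruggemanExpr ν η (f + g) z = bruggemanExpr ν η f z + bruggemanExpr ν η g z := by
  simp only [bruggemanExpr, Pi.add_apply, map_add, smul_add]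
  abel

theorem bruggemanExpr_smul (c : ℂ) (f : ℂ → V) (z : ℂ) :
    bruggemanExpr ν η (c • f) z = c • bruggemanExpr ν η f z := by
  simp only [bruggemanExpr, Pi.smul_apply, map_smul, smul_sub]
  rw [smul_comm c]

theorem add_mem_spaceFη {f g : ℂ → V} (hf : f ∈ spaceFη η) (hg : g ∈ spaceFη η) :
    f + g ∈ spaceFη η := by
  obtain ⟨h1, h2, h3, ⟨C, M, h4⟩, v, w, h5, h6, h7⟩ := hf
  obtain ⟨k1, k2, k3, ⟨C', M', k4⟩, v', w', k5, k6, k7⟩ := hg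
  refine ⟨fun z hz => by simp [h1 z hz, k1 z hz], h2.add k2, fun z hz => ?_,
    ⟨C + C', max M M', fun z hz => (norm_add_le _ _).trans (add_le_add
      (h4 z ((le_max_left _ _).trans hz)) (k4 z ((le_max_right _ _).trans hz)))⟩,
    v + v', w + w', h5.add k5, h6.add k6, ?_⟩
  · simp only [Pi.add_apply, h3 z hz, k3 z hz, map_add]
  · rw [add_add_add_comm, h7, k7, add_zero]

theorem smul_mem_spaceFη (c : ℂ) {f : ℂ → V} (hf : f ∈ spaceFη η) : c • f ∈ spaceFη η := by
  obtain ⟨h1, h2, h3, ⟨C, M, h4⟩, v, w, h5, h6, h7⟩ := hf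
  refine ⟨fun z hz => by simp [h1 z hz], h2.const_smul c, fun z hz => ?_,
    ⟨‖c‖ * C, M, fun z hz => ?_⟩, c • v, c • w, h5.const_smul c, h6.const_smul c, ?_⟩
  · simp only [Pi.smul_apply, h3 z hz, map_smul]
  · rw [Pi.smul_apply, norm_smul]
    exact mul_le_mul_of_nonneg_left (h4 z hz) (norm_nonneg c)
  · rw [← smul_add, h7, smul_zero]

theorem affineRepresentative_add (f g : ℂ → V) :
    affineRepresentative ν (f + g) = affineRepresentative ν f + affineRepresentative ν g := by
  ext p
  induction p with
  | infty => exact (add_zero 0).symm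
  | coe z => exact smul_add _ _ _

theorem affineRepresentative_smul (c : ℂ) (f : ℂ → V) :
    affineRepresentative ν (c • f) = c • affineRepresentative ν f := by
  ext p
  induction p with
  | infty => exact (smul_zero c).symm
  | coe z => exact smul_comm _ _ _

theorem IsRepresentedBy.add {Ω : Set (OnePoint ℂ)} {α β : Hyperfunction V Ω}
    {F G : OnePoint ℂ → V} (hα : IsRepresentedBy α F) (hβ : IsRepresentedBy β G) :
    IsRepresentedBy (α + β) (F + G) := by
  obtain ⟨h, rfl⟩ := hα
  obtain ⟨k, rfl⟩ := hβ
  exact ⟨add_mem h k, rfl⟩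

theorem IsRepresentedBy.smul {Ω : Set (OnePoint ℂ)} {α : Hyperfunction V Ω}
    {F : OnePoint ℂ → V} (c : ℂ) (hα : IsRepresentedBy α F) :
    IsRepresentedBy (c • α) (c • F) := by
  obtain ⟨h, rfl⟩ := hα
  exact ⟨Submodule.smul_mem _ c h, rfl⟩

theorem eq_of_mem_spacePsi {ψ φ : ℂ → V} (hψ : ψ ∈ spacePsi ν η) (hφ : φ ∈ spacePsi ν η)
    (h : ∀ z : ℂ, z.im ≠ 0 → ψ z = φ z) : ψ = φ := by
  funext z
  by_cases hz : z ∈ Complex.slitPlane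
  · exact eq_of_eq_off_real Complex.isOpen_slitPlane hψ.2.1.continuousOn hφ.2.1.continuousOn
      (fun z _ hz => h z hz) z hz
  · rw [hψ.1 z hz, hφ.1 z hz]

/-- For `ν ∉ 1/2 + ℤ`, the function `f` is determined by its Bruggeman expression. -/
theorem eq_zero_of_bruggemanExpr_eq_zero (hν : ∀ n : ℤ, ν ≠ 1 / 2 + n) {f : ℂ → V}
    (hf : ∀ z : ℂ, z.im = 0 → f z = 0) (h : ∀ z : ℂ, z.im ≠ 0 → bruggemanExpr ν η f z = 0) :
    f = 0 := by
  funext z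
  by_cases hz : z.im = 0
  · exact hf z hz
  · have h1 := inversionExpr_of_eq ν (η := η) (ψ := 0) (f := f) (fun z hz => (h z hz).symm) hz
    have h2 : inversionExpr ν η (0 : ℂ → V) z = 0 := by simp [inversionExpr]
    rw [h2] at h1
    exact (smul_eq_zero.1 h1.symm).resolve_left (branchFactor_ne_zero hν z)

variable [FiniteDimensional ℂ V]

theorem IsAssociated.add {α β : automorphicHyperfunctions ν η} {f g : ℂ → V}
    (hf : IsAssociated ν η α f) (hg : IsAssociated ν η β g) :
    IsAssociated ν η (α + β) (f + g) := by
  obtain ⟨⟨h1, k, hk, hkf⟩, h2⟩ := hf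
  obtain ⟨⟨h1', k', hk', hkg⟩, h2'⟩ := hg
  refine ⟨⟨add_mem_spaceFη h1 h1', k + k', hk.add hk', fun z hz => ?_⟩, ?_⟩
  · rw [Pi.add_apply, hkf z hz, hkg z hz, bruggemanExpr_add]
  · rw [affineRepresentative_add, Submodule.coe_add, map_add]
    exact h2.add h2'

theorem IsAssociated.smul (c : ℂ) {α : automorphicHyperfunctions ν η} {f : ℂ → V}
    (hf : IsAssociated ν η α f) : IsAssociated ν η (c • α) (c • f) := by
  obtain ⟨⟨h1, k, hk, hkf⟩, h2⟩ := hf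
  refine ⟨⟨smul_mem_spaceFη c h1, c • k, hk.const_smul c, fun z hz => ?_⟩, ?_⟩
  · rw [Pi.smul_apply, hkf z hz, bruggemanExpr_smul]
  · rw [affineRepresentative_smul, Submodule.coe_smul, map_smul]
    exact h2.smul c

theorem IsAssociated.unique {N : ℕ} (hN : 0 < N) (hη : (η T) ^ N = 1)
    {α : automorphicHyperfunctions ν η} {f g : ℂ → V}
    (hf : IsAssociated ν η α f) (hg : IsAssociated ν η α g) : f = g := by
  have h := hf.add (hg.smul (-1))
  have e : α + (-1 : ℂ) • α = 0 := by module
  rw [e, neg_one_smul] at h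
  have h0 : (0 : automorphicHyperfunctions ν η).1 =
    Submodule.Quotient.mk (0 : boundaryGerms V realLine) := rfl
  obtain ⟨h1, h2⟩ := h
  rw [h0, isRepresentedBy_toAffine_iff] at h2
  have h3 := eq_zero_of_mem_spaceFη (ν := ν) hN hη h1.1 fun x hx => by
    simpa using h2.2 x hx
  rwa [← sub_eq_add_neg, sub_eq_zero] at h3

theorem exists_isAssociated_of_automorphic {N : ℕ} (hN : 0 < N) (hη : (η T) ^ N = 1)
    (α : automorphicHyperfunctions ν η) : ∃ f, IsAssociated ν η α f := by
  obtain ⟨α, hα⟩ := α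
  obtain ⟨F, rfl⟩ := Submodule.Quotient.mk_surjective _ α
  have hfix := mk_mem_automorphicHyperfunctions_iff.1 hα
  obtain ⟨f, hf, hfF⟩ := exists_mem_spaceFη (ν := ν) hN hη F.2 (hfix ModularGroup.T)
  exact ⟨f, ⟨hf, exists_extension_bruggemanExpr (hfix ModularGroup.S) hf.2.1 hfF⟩,
    isRepresentedBy_toAffine_iff.2 ⟨affineRepresentative_mem_boundaryGerms ν hf.2.1, hfF⟩⟩

/-- An automorphic hyperfunction is determined by its restriction to the affine line, since `S`
maps `∞` to `0`. -/
theorem eq_zero_of_isAssociated_zero {α : automorphicHyperfunctions ν η}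
    (hα : IsAssociated ν η α 0) : α = 0 := by
  obtain ⟨α, hα'⟩ := α
  obtain ⟨F, rfl⟩ := Submodule.Quotient.mk_surjective _ α
  have hfix := mk_mem_automorphicHyperfunctions_iff.1 hα'
  have h1 := (isRepresentedBy_toAffine_iff.1 hα.2).2
  have h0 : affineRepresentative ν (0 : ℂ → V) = 0 := by
    have := affineRepresentative_smul (ν := ν) 0 (0 : ℂ → V)
    rwa [zero_smul, zero_smul] at this
  have h2 : ∀ x : ℂ, x.im = 0 → F.1 ∈ nullGerms V {(x : OnePoint ℂ)} := fun x hx => by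
    have := h1 x hx
    rw [h0, zero_sub] at this
    exact neg_mem_iff.1 this
  have h3 : F.1 ∈ nullGerms V realLine := by
    refine mem_nullGerms_iff.2 fun p hp => ?_
    induction p with
    | infty =>
      have h4 := twistedAction_mem_nullGerms ν η (γ := ModularGroup.S) infty_mem_realLine
        (F := F.1) (by
          rw [moebiusInv_S_infty]
          exact h2 0 Complex.zero_im)
      have h5 := sub_mem h4 (hfix ModularGroup.S ∞ infty_mem_realLine)
      rwa [sub_sub_cancel] at h5
    | coe x => exact h2 x (coe_mem_realLine.1 hp)
  exact Subtype.ext ((Submodule.Quotient.mk_eq_zero _).2 h3)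

/-- The Bruggeman transform `α ↦ ψ_α`. -/
theorem exists_bruggemanTransform {N : ℕ} (hN : 0 < N) (hη : (η T) ^ N = 1) :
    ∃ B : automorphicHyperfunctions ν η →ₗ[ℂ] spacePsi ν η,
      ∀ (α : automorphicHyperfunctions ν η) (f : ℂ → V), IsAssociated ν η α f →
        ∀ z : ℂ, z.im ≠ 0 → (B α).1 z = bruggemanExpr ν η f z := by
  choose f hf using exists_isAssociated_of_automorphic (ν := ν) (η := η) hN hη
  choose ψ hψ hψf using fun α => exists_mem_spacePsi ν (hf α).1
  refine ⟨{ toFun := fun α => ⟨ψ α, hψ α⟩, map_add' := fun α β => ?_, map_smul' := fun c α => ?_ },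
    fun α g hg z hz => ?_⟩
  · refine Subtype.ext (eq_of_mem_spacePsi (hψ _) (add_mem (hψ α) (hψ β)) fun z hz => ?_)
    show ψ (α + β) z = ψ α z + ψ β z
    rw [hψf _ z hz, hψf _ z hz, hψf _ z hz, ← bruggemanExpr_add,
      (hf (α + β)).unique hN hη ((hf α).add (hf β))]
  · refine Subtype.ext (eq_of_mem_spacePsi (hψ _) (Submodule.smul_mem _ c (hψ α)) fun z hz => ?_)
    show ψ (c • α) z = c • ψ α z
    rw [hψf _ z hz, hψf _ z hz, ← bruggemanExpr_smul,
      (hf (c • α)).unique hN hη ((hf α).smul c)]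
  · rw [hg.unique hN hη (hf α)]
    exact hψf α z hz

end Transform

end LewisTransform
end

theorem mainTheorem3 {V : Type*} [NormedAddCommGroup V] [NormedSpace ℂ V] [FiniteDimensional ℂ V]
    (Γ : Subgroup PSL(2, ℤ)) [Γ.Normal] [Γ.FiniteIndex]
    (hΓ : ∀ γ ∈ Γ, IsOfFinOrder γ → γ = 1)
    (q : ℕ) (η : Representation ℂ PSL(2, ℤ) V)
    (hpar : ∀ γ ∈ LewisTransform.parabolicSubgroup Γ, η γ = 1)
    (huni : LewisTransform.IsUnipotentOfLength Γ η q)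
    (ν : ℂ) :
    (∀ α : LewisTransform.automorphicHyperfunctions ν η,
      ∃! f : ℂ → V, LewisTransform.IsAssociated ν η α f) ∧
    ∃ B : LewisTransform.automorphicHyperfunctions ν η →ₗ[ℂ] LewisTransform.spacePsi ν η,
      (∀ (α : LewisTransform.automorphicHyperfunctions ν η) (f : ℂ → V),
        LewisTransform.IsAssociated ν η α f →
        ∀ z : ℂ, z.im ≠ 0 → (B α).1 z = f z - z ^ (-2 * ν - 1) • η LewisTransform.S (f (-1 / z))) ∧
      ((∀ n : ℤ, ν ≠ 1 / 2 + n) → Function.Bijective B) := by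
  obtain ⟨N, hN, hη⟩ := LewisTransform.exists_pow_eq_one Γ η hpar
  have hex := LewisTransform.exists_isAssociated_of_automorphic (ν := ν) (η := η) hN hη
  obtain ⟨B, hB⟩ := LewisTransform.exists_bruggemanTransform (ν := ν) (η := η) hN hη
  refine ⟨fun α => (hex α).imp fun f hf => ⟨hf, fun g hg => hg.unique hN hη hf⟩, B, hB,
    fun hν => ⟨(injective_iff_map_eq_zero B).2 fun α hα => ?_, fun ψ => ?_⟩⟩
  · obtain ⟨f, hf⟩ := hex α
    have h0 := LewisTransform.eq_zero_of_bruggemanExpr_eq_zero (η := η) hν hf.1.1.1 fun z hz => by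
      rw [← hB α f hf z hz, hα]
      rfl
    exact LewisTransform.eq_zero_of_isAssociated_zero (h0 ▸ hf)
  · obtain ⟨f, hf, hψf⟩ := LewisTransform.exists_mem_spaceF hν ψ.2
    obtain ⟨α, hα⟩ := LewisTransform.exists_isAssociated hf
    refine ⟨α, Subtype.ext (LewisTransform.eq_of_mem_spacePsi (B α).2 ψ.2 fun z hz => ?_)⟩
    rw [hB α f hα z hz, hψf z hz]
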